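/- Fix $\beta\in\{-1,0,1\}$. For $\lambda\ge 1$ put $\mathbb T_\lambda=\mathbb R/2\pi\lambda\mathbb Z$, $\dot{\mathbb Z}_\lambda=\frac1\lambda(\mathbb Z\setminus\{0\})$, $\langle x\rangle=(1+|x|^2)^{1/2}$ and $p_\lambda(k)=k^5+\beta\lambda^{-2}k^3$. We consider (generalized) functions $u$ on $\mathbb R\times\mathbb T_\lambda$ whose spatial zero mode vanishes, with space-time Fourier transform $\widehat u(\tau,k)=\frac1{2\pi}\int_{\mathbb R}\int_0^{2\pi\lambda}e^{-i(t\tau+kx)}u(t,x)\,dx\,dt$ a measurable function of $(\tau,k)\in\mathbb R\times\dot{\mathbb Z}_\lambda$. Put $$\|u\|_{X^{s,b}}=\Bigl(\frac1\lambda\sum_{k\in\dot{\mathbb Z}_\lambda}\int_{\mathbb R}\langle k\rangle^{2s}\langle\tau-p_\lambda(k)\rangle^{2b}|\widehat u(\tau,k)|^2d\tau\Bigr)^{1/2},\qquad \|u\|_{Y^s}=\Bigl(\frac1\lambda\sum_{k\in\dot{\mathbb Z}_\lambda}\langle k\rangle^{2s}\Bigl(\int_{\mathbb R}|\widehat u(\tau,k)|\,d\tau\Bigr)^2\Bigr)^{1/2},$$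 and, with $P_D$ the Fourier projection onto $D\subset\mathbb R\times\dot{\mathbb Z}_\lambda$, $$\|u\|_{Z^s}=\|P_{D_1}u\|_{X^{s,3/4}}+\|P_{D_2}u\|_{X^{-3s-1,s+1}}+\|P_{D_3}u\|_{X^{-s/2-1,s/2+1}}+\|u\|_{Y^s},$$ where $$D_1=\{|\tau-p_\lambda(k)|\le|k|^4/10\text{ and }|k|\ge1\},\quad D_2=\{|k|^4/10\le|\tau-p_\lambda(k)|\le|k|^5/10\text{ and }|k|\ge1\},$$ $$D_3=\{|\tau-p_\lambda(k)|\ge|k|^5/10\ \text{ or }\ 1/\lambda\le|k|\le1\}.$$ Let $Z^s$ be the space of such $u$ with $\|u\|_{Z^s}<\infty$, and let $\Lambda^{-1}$ be the Fourier multiplier with symbol $\langle\tau-p_\lambda(k)\rangle^{-1}$. **Proposition.** Let $-3/2\le s<-1$. There is a constant $C>0$, independent of $\lambda$, such that for all $\lambda\ge1$ and all $u,v\in Z^s$ $$\|\Lambda^{-1}\partial_x(uv)\|_{Z^s}\le C\,\|u\|_{Z^s}\|v\|_{Z^s}.$$ Here $uv$ is the pointwise product if $u,v$ are smooth on $\mathbb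 R\times\mathbb T_\lambda$ and decay rapidly in $t$ with all derivatives. For general $u,v\in Z^s$, $\partial_x(uv)$ is defined by $$\widehat{\partial_x(uv)}(\tau,k)=ik\,\frac1{2\pi\lambda}\sum_{k_1\in\dot{\mathbb Z}_\lambda,\,k_1\ne k}\int_{\mathbb R}\widehat u(\tau_1,k_1)\,\widehat v(\tau-\tau_1,k-k_1)\,d\tau_1,\qquad k\in\dot{\mathbb Z}_\lambda,$$ where the sum of integrals converges absolutely for every $k\in\dot{\mathbb Z}_\lambda$ and almost every $\tau$, and $\Lambda^{-1}\partial_x(uv)$ belongs to $Z^s$. -/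

import Mathlib

open MeasureTheory
open scoped ENNReal

noncomputable section

namespace Kawahara

/-- The Japanese bracket `⟨x⟩ = (1 + |x|²)^{1/2}`. -/
def jb (x : ℝ) : ℝ := Real.sqrt (1 + x ^ 2)

/-- The frequency `k = n / lam` in `ℤ_lam = (1/lam) ℤ`, labelled by the integer `n`; the frequencies
of `(1/lam) (ℤ ∖ {0})` are those with `n ≠ 0`. -/
def freq (lam : ℝ) (n : ℤ) : ℝ := (n : ℝ) / lam

/-- The dispersion relation `p_lam(k) = k⁵ + β lam⁻² k³`. -/
def disp (lam β k : ℝ) : ℝ := k ^ 5 + β * (lam ^ 2)⁻¹ * k ^ 3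

/-- A space-time Fourier transform on `ℝ × ℤ_lam`: `F n τ` is its value at `(τ, n / lam)`. -/
abbrev FT : Type := ℤ → ℝ → ℂ

/-- The space-time Fourier transform of a function `u(t,x)` which is `2 π lam`-periodic in `x`:
`(2π)⁻¹ ∫_ℝ ∫_0^{2π lam} e^{-i(tτ + kx)} u(t,x) dx dt`. -/
def spaceTimeFourier (lam : ℝ) (u : ℝ → ℝ → ℂ) : FT := fun n τ =>
  ((2 * Real.pi)⁻¹ : ℝ) * ∫ t : ℝ, ∫ x in (0 : ℝ)..(2 * Real.pi * lam),
    Complex.exp (-(Complex.I * ((t * τ + freq lam n * x : ℝ) : ℂ))) * u t x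

/-- The Fourier transform of the product of the functions or distributions with Fourier transforms
`F` and `G`, that is the convolution on `ℝ × ℤ_lam` (with `1/lam` times counting measure on
`ℤ_lam`), in the normalization of `spaceTimeFourier`. -/
def fourierProduct (lam : ℝ) (F G : FT) : FT := fun n τ =>
  ((2 * Real.pi)⁻¹ * lam⁻¹ : ℝ) * ∑' m : ℤ, ∫ σ : ℝ, F m σ * G (n - m) (τ - σ)

/-- The `x`-derivative on the Fourier side: multiplication by `i k`. -/
def dx (lam : ℝ) (F : FT) : FT := fun n τ => Complex.I * (freq lam n : ℂ) * F n τ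

/-- The Fourier multiplier `Λ^b` with symbol `⟨τ - p_lam(k)⟩^b`. -/
def bigLambda (lam β b : ℝ) (F : FT) : FT := fun n τ =>
  ((jb (τ - disp lam β (freq lam n)) ^ b : ℝ) : ℂ) * F n τ

/-- The Fourier projection `P_D` onto a set `D` of pairs `(τ, k)`. -/
def proj (lam : ℝ) (D : Set (ℝ × ℝ)) (F : FT) : FT := fun n =>
  Set.indicator {τ : ℝ | (τ, freq lam n) ∈ D} (F n)

/-- The `X^{s,b}` norm
`((1/lam) ∑_{k ≠ 0} ∫ ⟨k⟩^{2s} ⟨τ - p_lam(k)⟩^{2b} |F(τ,k)|² dτ)^{1/2}`. -/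
def xNorm (lam β s b : ℝ) (F : FT) : ℝ≥0∞ :=
  (ENNReal.ofReal lam⁻¹ * ∑' n : {n : ℤ // n ≠ 0}, ∫⁻ τ : ℝ,
    (ENNReal.ofReal (jb (freq lam n) ^ s * jb (τ - disp lam β (freq lam n)) ^ b) *
      ‖F n τ‖ₑ) ^ 2) ^ (1 / 2 : ℝ)

/-- The `Y^s` norm `((1/lam) ∑_{k ≠ 0} (⟨k⟩^s ∫ |F(τ,k)| dτ)²)^{1/2}`. -/
def yNorm (lam s : ℝ) (F : FT) : ℝ≥0∞ :=
  (ENNReal.ofReal lam⁻¹ * ∑' n : {n : ℤ // n ≠ 0},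
    (ENNReal.ofReal (jb (freq lam n) ^ s) * ∫⁻ τ : ℝ, ‖F n τ‖ₑ) ^ 2) ^ (1 / 2 : ℝ)

/-- The region `D₁`: `|k| ≥ 1` and `|τ - p_lam(k)| ≤ |k|⁴/10`. -/
def D₁ (lam β : ℝ) : Set (ℝ × ℝ) :=
  {q | |q.1 - disp lam β q.2| ≤ |q.2| ^ 4 / 10 ∧ 1 ≤ |q.2|}

/-- The region `D₂`: `|k| ≥ 1` and `|k|⁴/10 ≤ |τ - p_lam(k)| ≤ |k|⁵/10`. -/
def D₂ (lam β : ℝ) : Set (ℝ × ℝ) :=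
  {q | |q.2| ^ 4 / 10 ≤ |q.1 - disp lam β q.2| ∧ |q.1 - disp lam β q.2| ≤ |q.2| ^ 5 / 10 ∧
    1 ≤ |q.2|}

/-- The region `D₃`: `|τ - p_lam(k)| ≥ |k|⁵/10` or `1/lam ≤ |k| ≤ 1`. Together, `D₁`, `D₂` and `D₃`
cover all pairs `(τ, k)` with `k` a nonzero frequency. -/
def D₃ (lam β : ℝ) : Set (ℝ × ℝ) :=
  {q | |q.2| ^ 5 / 10 ≤ |q.1 - disp lam β q.2| ∨ (1 / lam ≤ |q.2| ∧ |q.2| ≤ 1)}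

/-- The `Z^s` norm. -/
def zNorm (lam β s : ℝ) (F : FT) : ℝ≥0∞ :=
  xNorm lam β s (3 / 4) (proj lam (D₁ lam β) F)
    + xNorm lam β (-3 * s - 1) (s + 1) (proj lam (D₂ lam β) F)
    + xNorm lam β (-s / 2 - 1) (s / 2 + 1) (proj lam (D₃ lam β) F)
    + yNorm lam s F

/-- `F` is the space-time Fourier transform of an element of `Z^s`: it is measurable, its zero mode
vanishes (the mean-zero condition) and its `Z^s` norm is finite. -/
structure MemZ (lam β s : ℝ) (F : FT) : Prop where
  measurable : ∀ n : ℤ, AEStronglyMeasurable (F n) volume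
  zero_mode : ∀ τ : ℝ, F 0 τ = 0
  finite : zNorm lam β s F < ∞

/-- Smooth functions `u(t,x)`, `2 π lam`-periodic and of mean zero in `x`, that decay rapidly in `t`
together with all derivatives. -/
structure IsTestFunction (lam : ℝ) (u : ℝ → ℝ → ℂ) : Prop where
  smooth : ContDiff ℝ (⊤ : ℕ∞) (fun q : ℝ × ℝ => u q.1 q.2)
  periodic : ∀ t : ℝ, Function.Periodic (u t) (2 * Real.pi * lam)
  mean_zero : ∀ t : ℝ, ∫ x in (0 : ℝ)..(2 * Real.pi * lam), u t x = 0
  decay : ∀ N j : ℕ, ∃ A : ℝ, ∀ q : ℝ × ℝ,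
    |q.1| ^ N * ‖iteratedFDeriv ℝ j (fun q : ℝ × ℝ => u q.1 q.2) q‖ ≤ A

end Kawahara

end

open MeasureTheory
open scoped ENNReal

noncomputable section

namespace Kawahara

/-! On the Fourier side the output at (τ, k) is a convolution over k = k₁ + k₂. If L, L₁, L₂ are the
modulations τ - p(k) of output and inputs, then L = L₁ + L₂ - H, where the resonance function
satisfies |H| ~ |k k₁ k₂| max(|k|, |k₁|, |k₂|)². Hence one modulation is at least of the order of
|H|, and this gain pays for the derivative.

The X weights of neighbouring regions agree up to constants where the regions meet, so the L² part
of the Z norm is comparable to a single weighted L² norm, with the weight `weight` built from the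
three by a minimum and a maximum. In logarithms all size relations are piecewise linear and each
inequality needed is affine in s, so it follows from the endpoints s = -3/2 and s = -1 by linear
arithmetic. The strong bound controls |k|⟨k⟩^s⟨L⟩^{-1/4}, which dominates the X weight of the output
and, after a further factor ⟨L⟩^{-3/4} in L², its Y norm. When the output modulation dominates and
the strong bound is not available, the weak bound treats the X and Y weights separately. The result
is `strongBound_or_weakBound`, exponentiated in `output_weight_bounds`.

The output weight is thereby dominated by input weights times kernels of two kinds. (i) ρ(k) =
|k|^{-(s/2+1)}⟨k⟩^{-3/8} at one of the three frequencies. It is square summable uniformly in λ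
(`exists_tsum_sq_rho_le`); its singularity at 0 is square integrable exactly when s < -1.
Cauchy-Schwarz handles the frequencies; in τ one uses Young's inequality with the Y norm, or a
bounded convolution times ⟨L⟩^{-9/16} in L². (ii) Two negative powers of modulations, with the
remaining frequency at least 1 in size. Cauchy-Schwarz and integration in τ leave a lattice sum of
⟨a - Φ⟩^{-1/2}, where Φ is a difference of two values of p. It is bounded uniformly in a and λ,
because Φ has a derivative of at least cubic size (`tsum_jb_dispDiff_le`).

`exists_energy_lconv_le` collects these estimates for nonnegative functions. Taking absolute values
gives the estimate in Z^s, and finiteness of the Y part gives absolute convergence almost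
everywhere. For test functions, `spaceTimeFourier_mul` identifies the convolution with the pointwise
product. -/

/-! ### Lower bounds for the weight in logarithmic variables. -/

/-- An inequality between affine functions of `s` on `[-3/2, -1]` follows from the endpoints. -/
theorem le_of_affine {f g : ℝ → ℝ} {s : ℝ} (hs₁ : -3 / 2 ≤ s) (hs₂ : s ≤ -1)
    (h : ∀ t, g t - f t = (g 0 - f 0) + t * ((g 1 - f 1) - (g 0 - f 0)))
    (h₁ : f (-3 / 2) ≤ g (-3 / 2)) (h₂ : f (-1) ≤ g (-1)) : f s ≤ g s := by
  have e := h s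
  have e₁ := h (-3 / 2)
  have e₂ := h (-1)
  nlinarith

/-- The logarithm of the weight, as a function of `x = log ⟨k⟩` and `l = log ⟨τ - p(k)⟩`. -/
def logWeight (s x l : ℝ) : ℝ :=
  min (s * x + 3 / 4 * l)
    (max ((-3 * s - 1) * x + (s + 1) * l) ((-s / 2 - 1) * x + (s / 2 + 1) * l))

/-- The logarithm of the kernel `|k|^{-(s/2+1)} ⟨k⟩^{-3/8}`, with `z = log |k|`, `x = log ⟨k⟩`. -/
def logRho (s z x : ℝ) : ℝ := -(s / 2 + 1) * z - 3 / 8 * x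

section

variable {s x l : ℝ} (hs₁ : -3 / 2 ≤ s) (hs₂ : s ≤ -1)

include hs₁ hs₂

/-- The first two branches differ by `(-s - 1/4) * (l - 4 * x)`, so they cross at `l = 4 * x`. The
slack 40 absorbs multiplicative constants, and 50 is 40 times the largest slope 5/4. -/
theorem le_logWeight_of_le (h : l ≤ 4 * x + 40) :
    s * x + 3 / 4 * l - 50 ≤ logWeight s x l := by
  refine le_min (by linarith) (le_max_of_le_left ?_)
  apply le_of_affine hs₁ hs₂ <;> [(intro; ring); linarith; linarith]

theorem le_logWeight_of_ge (hx : 0 ≤ x) (h : 4 * x - 40 ≤ l) :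
    max ((-3 * s - 1) * x + (s + 1) * l) ((-s / 2 - 1) * x + (s / 2 + 1) * l) - 50
      ≤ logWeight s x l := by
  refine le_min ?_ (by linarith)
  rw [sub_le_iff_le_add]
  refine max_le ?_ ?_
  · apply le_of_affine hs₁ hs₂ <;> [(intro; ring); linarith; linarith]
  · apply le_of_affine hs₁ hs₂ <;> [(intro; ring); linarith; linarith]

theorem le_logWeight_of_ge_left (hx : 0 ≤ x) (h : 4 * x - 40 ≤ l) :
    (-3 * s - 1) * x + (s + 1) * l - 50 ≤ logWeight s x l :=
  (sub_le_sub_right (le_max_left _ _) _).trans (le_logWeight_of_ge hs₁ hs₂ hx h)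

theorem le_logWeight_of_ge_right (hx : 0 ≤ x) (h : 4 * x - 40 ≤ l) :
    (-s / 2 - 1) * x + (s / 2 + 1) * l - 50 ≤ logWeight s x l :=
  (sub_le_sub_right (le_max_right _ _) _).trans (le_logWeight_of_ge hs₁ hs₂ hx h)

/-- As functions of `l` the second branch has slope `s + 1 ≤ 0` and the third has slope `s / 2 + 1 >
0`. They meet at `l = 5 * x` with the value `(2 * s + 4) * x`, the minimum of their maximum. -/
theorem le_logWeight_of_ge_const (hx : 0 ≤ x) (h : 4 * x - 40 ≤ l) :
    (2 * s + 4) * x - 50 ≤ logWeight s x l := by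
  rcases le_total l (5 * x) with h' | h'
  · refine le_trans ?_ (le_logWeight_of_ge_left hs₁ hs₂ hx h)
    apply le_of_affine hs₁ hs₂ <;> [(intro; ring); linarith; linarith]
  · refine le_trans ?_ (le_logWeight_of_ge_right hs₁ hs₂ hx h)
    apply le_of_affine hs₁ hs₂ <;> [(intro; ring); linarith; linarith]

theorem le_logWeight_of_small (hx1 : x ≤ 1) (hl : 0 ≤ l) :
    (s / 2 + 1) * l - 50 ≤ logWeight s x l := by
  refine le_min ?_ (le_max_of_le_right ?_)
  all_goals apply le_of_affine hs₁ hs₂ <;> [(intro; ring); linarith; linarith]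

end

/-! ### Size relations between frequencies and modulations, and the case analysis. -/

/-- The logarithmic form of the size relations between three frequencies `k = k₁ + k₂`, their
modulations and the resonance function: `z = log |k|`, `x = log ⟨k⟩`, `l = log ⟨τ - p(k)⟩`, and `e`
is the logarithm of the resonance function. -/
structure LogConfig (z z₁ z₂ x x₁ x₂ l l₁ l₂ e : ℝ) : Prop where
  zx : z ≤ x
  zx₁ : z₁ ≤ x₁
  zx₂ : z₂ ≤ x₂
  x0 : 0 ≤ x
  x0₁ : 0 ≤ x₁
  x0₂ : 0 ≤ x₂
  xz : x ≤ max z 0 + 1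
  xz₁ : x₁ ≤ max z₁ 0 + 1
  xz₂ : x₂ ≤ max z₂ 0 + 1
  l0 : 0 ≤ l
  l0₁ : 0 ≤ l₁
  l0₂ : 0 ≤ l₂
  tri : z ≤ max z₁ z₂ + 1
  tri₁ : z₁ ≤ max z z₂ + 1
  tri₂ : z₂ ≤ max z z₁ + 1
  le_e : z + z₁ + z₂ + 2 * max z (max z₁ z₂) - 4 ≤ e
  e_le : e ≤ z + z₁ + z₂ + 2 * max z (max z₁ z₂) + 4
  e_max : e ≤ max l (max l₁ l₂) + 2
  -- The `0` is the logarithm of the 1 in ⟨L₁⟩ ≤ 1 + |L₁|.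
  l₁_max : l₁ ≤ max (max e 0) (max l l₂) + 2
  l₂_max : l₂ ≤ max (max e 0) (max l l₁) + 2

theorem LogConfig.swap {z z₁ z₂ x x₁ x₂ l l₁ l₂ e : ℝ}
    (h : LogConfig z z₁ z₂ x x₁ x₂ l l₁ l₂ e) : LogConfig z z₂ z₁ x x₂ x₁ l l₂ l₁ e where
  zx := h.zx
  zx₁ := h.zx₂
  zx₂ := h.zx₁
  x0 := h.x0
  x0₁ := h.x0₂
  x0₂ := h.x0₁
  xz := h.xz
  xz₁ := h.xz₂
  xz₂ := h.xz₁
  l0 := h.l0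
  l0₁ := h.l0₂
  l0₂ := h.l0₁
  tri := by rw [max_comm]; exact h.tri
  tri₁ := h.tri₂
  tri₂ := h.tri₁
  le_e := by have := h.le_e; rw [max_comm z₂ z₁]; linarith
  e_le := by have := h.e_le; rw [max_comm z₂ z₁]; linarith
  e_max := by rw [max_comm l₂ l₁]; exact h.e_max
  l₁_max := h.l₂_max
  l₂_max := h.l₁_max

/-- The alternatives for the strong form of the output weight. -/
def StrongBound (D s z z₁ z₂ x x₁ x₂ l l₁ l₂ : ℝ) : Prop :=
  (∃ r, (r = logRho s z x ∨ r = logRho s z₁ x₁ ∨ r = logRho s z₂ x₂) ∧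
    (z + s * x - l / 4 ≤ D + r + logWeight s x₁ l₁ + s * x₂ ∨
     z + s * x - l / 4 ≤ D + r + s * x₁ + logWeight s x₂ l₂ ∨
     z + s * x - l / 4 ≤ D + r - 9 / 16 * l + logWeight s x₁ l₁ + logWeight s x₂ l₂)) ∨
  (0 ≤ z₁ ∧ z + s * x - l / 4 ≤
    D - l / 4 - 3 / 4 * l₂ + logWeight s x₁ l₁ + logWeight s x₂ l₂) ∨
  (0 ≤ z₂ ∧ z + s * x - l / 4 ≤
    D - l / 4 - 3 / 4 * l₁ + logWeight s x₁ l₁ + logWeight s x₂ l₂)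

/-- The alternatives for the output weights when the output modulation is dominant. -/
def WeakBound (D s z z₁ z₂ x x₁ x₂ l l₁ l₂ : ℝ) : Prop :=
  (z - l + logWeight s x l ≤ D + logRho s z x + logWeight s x₁ l₁ + s * x₂ ∨
    (0 ≤ z ∧ z - l + logWeight s x l ≤
      D - 3 / 4 * l₁ - 3 / 4 * l₂ + logWeight s x₁ l₁ + logWeight s x₂ l₂)) ∧
  (∃ r, (r = logRho s z x ∨ r = logRho s z₁ x₁ ∨ r = logRho s z₂ x₂) ∧
    z + s * x - l ≤ D + r + s * x₁ + s * x₂)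

section

variable {D s z z₁ z₂ x x₁ x₂ l l₁ l₂ e : ℝ}

theorem StrongBound.swap (h : StrongBound D s z z₂ z₁ x x₂ x₁ l l₂ l₁) :
    StrongBound D s z z₁ z₂ x x₁ x₂ l l₁ l₂ := by
  rcases h with ⟨r, hr, h⟩ | ⟨h0, h⟩ | ⟨h0, h⟩
  · refine Or.inl ⟨r, by tauto, ?_⟩
    rcases h with h | h | h
    · exact Or.inr (Or.inl (by linarith))
    · exact Or.inl (by linarith)
    · exact Or.inr (Or.inr (by linarith))
  · exact Or.inr (Or.inr ⟨h0, by linarith⟩)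
  · exact Or.inr (Or.inl ⟨h0, by linarith⟩)

variable (hs₁ : -3 / 2 ≤ s) (hs₂ : s ≤ -1) (h : LogConfig z z₁ z₂ x x₁ x₂ l l₁ l₂ e)

include hs₁ hs₂ h

/-- For |k₁| ≤ 1 the other two frequencies are comparable, unless all are bounded, and |H| ~
|k₁||k|⁴. The dominant modulation contributes a power of |H| of at least 1/4, which pays for |k|;
this uses s/2 + 1 ≥ 1/4, that is s ≥ -3/2. Negative powers of |k₁| are left to ρ(k₁). -/
theorem strongBound_of_low_input (hz : z₁ ≤ 0) :
    StrongBound 1000 s z z₁ z₂ x x₁ x₂ l l₁ l₂ := by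
  obtain ⟨zx, zx₁, zx₂, x0, x0₁, x0₂, xz, xz₁, xz₂, l0, l0₁, l0₂, tri, tri₁, tri₂, le_e, e_le,
    e_max, l₁_max, l₂_max⟩ := h
  have hx1 : x₁ ≤ 1 := by rw [max_eq_right hz] at xz₁; linarith
  have w₁ := le_logWeight_of_small hs₁ hs₂ hx1 l0₁
  refine Or.inl ⟨_, Or.inr (Or.inl rfl), ?_⟩
  unfold logRho
  -- If `z ≤ 2`, all three frequencies are bounded and the resonance is not needed.
  rcases le_total z 2 with hz2 | hz2
  · left
    have : z₂ ≤ 3 := tri₂.trans (by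
      have : max z z₁ ≤ 2 := max_le hz2 (by linarith)
      linarith)
    have : x₂ ≤ 4 := xz₂.trans (by
      have : max z₂ 0 ≤ 3 := max_le this (by linarith)
      linarith)
    suffices z + s * x - l / 4 ≤ 1000 + (-(s / 2 + 1) * z₁ - 3 / 8 * x₁) +
      ((s / 2 + 1) * l₁ - 50) + s * x₂ by linarith
    apply le_of_affine hs₁ hs₂ <;> [(intro; ring); linarith; linarith]
  · have h2 : z - 1 ≤ z₂ := by
      rcases le_max_iff.1 (show z - 1 ≤ max z₁ z₂ by linarith) with h | h <;> linarith
    have h3 : z₂ ≤ z + 1 := by rw [max_eq_left (by linarith)] at tri₂; exact tri₂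
    rw [max_eq_left (by linarith)] at xz xz₂
    have hM1 : z ≤ max z (max z₁ z₂) := le_max_left _ _
    have hM2 : max z (max z₁ z₂) ≤ z + 1 := max_le (by linarith) (max_le (by linarith) h3)
    set M := max z (max z₁ z₂)
    by_cases c1 : e - 2 ≤ l
    · left
      suffices z + s * x - l / 4 ≤ 1000 + (-(s / 2 + 1) * z₁ - 3 / 8 * x₁) +
        ((s / 2 + 1) * l₁ - 50) + s * x₂ by linarith
      apply le_of_affine hs₁ hs₂ <;> [(intro; ring); linarith; linarith]
    by_cases c2 : e - 2 ≤ l₁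
    · left
      suffices z + s * x - l / 4 ≤ 1000 + (-(s / 2 + 1) * z₁ - 3 / 8 * x₁) +
        ((s / 2 + 1) * l₁ - 50) + s * x₂ by linarith
      apply le_of_affine hs₁ hs₂ <;> [(intro; ring); linarith; linarith]
    push Not at c1 c2
    have c3 : e - 2 ≤ l₂ := by
      have : e - 2 ≤ max l (max l₁ l₂) := by linarith
      rcases le_max_iff.1 this with h | h
      · linarith
      rcases le_max_iff.1 h with h | h <;> linarith
    right; left
    -- A dominant `l₂` is also at most of the order of `e`, and `e ≤ 4 * z₂` up to a constant
    -- because `z₁ ≤ 0`. So the first branch applies to the second input.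
    have c4 : l₂ ≤ 4 * x₂ + 40 := by
      have : max (max e 0) (max l l₁) ≤ 4 * x₂ + 30 :=
        max_le (max_le (by linarith) (by linarith)) (max_le (by linarith) (by linarith))
      linarith
    have w₂ := le_logWeight_of_le hs₁ hs₂ c4
    suffices z + s * x - l / 4 ≤ 1000 + (-(s / 2 + 1) * z₁ - 3 / 8 * x₁) +
        s * x₁ + (s * x₂ + 3 / 4 * l₂ - 50) by linarith
    apply le_of_affine hs₁ hs₂ <;> [(intro; ring); linarith; linarith]

end

section

variable {s z z₁ z₂ x x₁ x₂ l l₁ l₂ e : ℝ}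
variable (hs₁ : -3 / 2 ≤ s) (hs₂ : s ≤ -1) (h : LogConfig z z₁ z₂ x x₁ x₂ l l₁ l₂ e)

include hs₁ hs₂ h

/-- The inputs have a common size N and |H| ~ |k|N⁴. The dominant input gives |H|^{3/4}, and the
powers of N balance because 2s + 3 ≥ 0. -/
theorem strongBound_of_low_output_of_input (hz : z ≤ 0) (hz₁ : 0 ≤ z₁) (hz₂ : 0 ≤ z₂)
    (h₁ : l₁ ≤ 4 * x₁ + 40) (h₂ : e - 2 ≤ l₁) :
    StrongBound 1000 s z z₁ z₂ x x₁ x₂ l l₁ l₂ := by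
  obtain ⟨zx, zx₁, zx₂, x0, x0₁, x0₂, xz, xz₁, xz₂, l0, l0₁, l0₂, tri, tri₁, tri₂, le_e, e_le,
    e_max, l₁_max, l₂_max⟩ := h
  rw [max_eq_right hz] at xz
  rw [max_eq_left hz₁] at xz₁
  rw [max_eq_left hz₂] at xz₂
  have t₁ : z₁ ≤ z₂ + 1 := tri₁.trans (by rw [max_eq_right (hz.trans hz₂)])
  have t₂ : z₂ ≤ z₁ + 1 := tri₂.trans (by rw [max_eq_right (hz.trans hz₁)])
  have hM1 : z₁ ≤ max z (max z₁ z₂) := (le_max_left _ _).trans (le_max_right _ _)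
  have hM2 : max z (max z₁ z₂) ≤ z₁ + 1 := max_le (by linarith) (max_le (by linarith) t₂)
  set M := max z (max z₁ z₂)
  have w₁ := le_logWeight_of_le hs₁ hs₂ h₁
  refine Or.inl ⟨_, Or.inl rfl, Or.inl ?_⟩
  unfold logRho
  suffices z + s * x - l / 4 ≤ 1000 + (-(s / 2 + 1) * z - 3 / 8 * x) +
    (s * x₁ + 3 / 4 * l₁ - 50) + s * x₂ by linarith
  apply le_of_affine hs₁ hs₂ <;> [(intro; ring); linarith; linarith]

theorem strongBound_of_low_output_of_output (hz : z ≤ 0) (hz₁ : 0 ≤ z₁) (hz₂ : 0 ≤ z₂)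
    (h₁ : 4 * x₁ - 40 ≤ l₁) (h₂ : e - 2 ≤ l) :
    StrongBound 1000 s z z₁ z₂ x x₁ x₂ l l₁ l₂ := by
  obtain ⟨zx, zx₁, zx₂, x0, x0₁, x0₂, xz, xz₁, xz₂, l0, l0₁, l0₂, tri, tri₁, tri₂, le_e, e_le,
    e_max, l₁_max, l₂_max⟩ := h
  rw [max_eq_right hz] at xz
  rw [max_eq_left hz₁] at xz₁
  rw [max_eq_left hz₂] at xz₂
  have t₁ : z₁ ≤ z₂ + 1 := tri₁.trans (by rw [max_eq_right (hz.trans hz₂)])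
  have t₂ : z₂ ≤ z₁ + 1 := tri₂.trans (by rw [max_eq_right (hz.trans hz₁)])
  have hM1 : z₁ ≤ max z (max z₁ z₂) := (le_max_left _ _).trans (le_max_right _ _)
  have hM2 : max z (max z₁ z₂) ≤ z₁ + 1 := max_le (by linarith) (max_le (by linarith) t₂)
  set M := max z (max z₁ z₂)
  have w₁ := le_logWeight_of_ge_const hs₁ hs₂ x0₁ h₁
  refine Or.inl ⟨_, Or.inl rfl, Or.inl ?_⟩
  unfold logRho
  suffices z + s * x - l / 4 ≤ 1000 + (-(s / 2 + 1) * z - 3 / 8 * x) +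
    ((2 * s + 4) * x₁ - 50) + s * x₂ by linarith
  apply le_of_affine hs₁ hs₂ <;> [(intro; ring); linarith; linarith]

theorem strongBound_of_low_output_of_inputs (hz : z ≤ 0) (hz₁ : 0 ≤ z₁) (hz₂ : 0 ≤ z₂)
    (h₁ : 4 * x₁ - 40 ≤ l₁) (h₂ : 4 * x₂ - 40 ≤ l₂) (h₃ : l ≤ e - 2) :
    StrongBound 1000 s z z₁ z₂ x x₁ x₂ l l₁ l₂ := by
  obtain ⟨zx, zx₁, zx₂, x0, x0₁, x0₂, xz, xz₁, xz₂, l0, l0₁, l0₂, tri, tri₁, tri₂, le_e, e_le,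
    e_max, l₁_max, l₂_max⟩ := h
  rw [max_eq_right hz] at xz
  rw [max_eq_left hz₁] at xz₁
  rw [max_eq_left hz₂] at xz₂
  have t₁ : z₁ ≤ z₂ + 1 := tri₁.trans (by rw [max_eq_right (hz.trans hz₂)])
  have t₂ : z₂ ≤ z₁ + 1 := tri₂.trans (by rw [max_eq_right (hz.trans hz₁)])
  have hM1 : z₁ ≤ max z (max z₁ z₂) := (le_max_left _ _).trans (le_max_right _ _)
  have hM2 : max z (max z₁ z₂) ≤ z₁ + 1 := max_le (by linarith) (max_le (by linarith) t₂)
  set M := max z (max z₁ z₂)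
  have w₁ := le_logWeight_of_ge_const hs₁ hs₂ x0₁ h₁
  have w₂ := le_logWeight_of_ge_const hs₁ hs₂ x0₂ h₂
  refine Or.inl ⟨_, Or.inl rfl, Or.inr (Or.inr ?_)⟩
  unfold logRho
  suffices z + s * x - l / 4 ≤ 1000 + (-(s / 2 + 1) * z - 3 / 8 * x) - 9 / 16 * l +
    ((2 * s + 4) * x₁ - 50) + ((2 * s + 4) * x₂ - 50) by linarith
  apply le_of_affine hs₁ hs₂ <;> [(intro; ring); linarith; linarith]

/-- The X weight of the output leaves at most ⟨L⟩^{s/2} since ⟨k⟩ is bounded, and |H|^{s/2} ~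
|k|^{s/2}N^{2s}. The factor N^{2s} matches ⟨k₁⟩^s⟨k₂⟩^s, and the power of |k| ≤ 1 is left to ρ(k).
-/
theorem weakBound_of_low_output (hz : z ≤ 0) (hz₁ : 0 ≤ z₁) (hz₂ : 0 ≤ z₂)
    (h₁ : l₁ ≤ 4 * x₁ + 40) (h₂ : e - 2 ≤ l) :
    WeakBound 1000 s z z₁ z₂ x x₁ x₂ l l₁ l₂ := by
  obtain ⟨zx, zx₁, zx₂, x0, x0₁, x0₂, xz, xz₁, xz₂, l0, l0₁, l0₂, tri, tri₁, tri₂, le_e, e_le,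
    e_max, l₁_max, l₂_max⟩ := h
  rw [max_eq_right hz] at xz
  rw [max_eq_left hz₁] at xz₁
  rw [max_eq_left hz₂] at xz₂
  have t₁ : z₁ ≤ z₂ + 1 := tri₁.trans (by rw [max_eq_right (hz.trans hz₂)])
  have t₂ : z₂ ≤ z₁ + 1 := tri₂.trans (by rw [max_eq_right (hz.trans hz₁)])
  have hM1 : z₁ ≤ max z (max z₁ z₂) := (le_max_left _ _).trans (le_max_right _ _)
  have hM2 : max z (max z₁ z₂) ≤ z₁ + 1 := max_le (by linarith) (max_le (by linarith) t₂)
  set M := max z (max z₁ z₂)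
  have w₁ := le_logWeight_of_le hs₁ hs₂ h₁
  constructor
  · left
    unfold logRho
    suffices z - l + max ((-3 * s - 1) * x + (s + 1) * l) ((-s / 2 - 1) * x + (s / 2 + 1) * l) ≤
        1000 + (-(s / 2 + 1) * z - 3 / 8 * x) + (s * x₁ + 3 / 4 * l₁ - 50) + s * x₂ by
      have : logWeight s x l ≤ _ := min_le_right _ _
      linarith
    rw [← le_sub_iff_add_le']
    refine max_le ?_ ?_
    · apply le_of_affine hs₁ hs₂ <;> [(intro; ring); linarith; linarith]
    · apply le_of_affine hs₁ hs₂ <;> [(intro; ring); linarith; linarith]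
  · refine ⟨_, Or.inl rfl, ?_⟩
    unfold logRho
    apply le_of_affine hs₁ hs₂ <;> [(intro; ring); linarith; linarith]

theorem bound_of_low_output (hz : z ≤ 0) (hz₁ : 0 ≤ z₁) (hz₂ : 0 ≤ z₂) :
    StrongBound 1000 s z z₁ z₂ x x₁ x₂ l l₁ l₂ ∨ WeakBound 1000 s z z₁ z₂ x x₁ x₂ l l₁ l₂ := by
  rcases le_or_gt (e - 2) l with c | c
  · rcases le_total (4 * x₁) l₁ with c₁ | c₁
    · exact Or.inl (strongBound_of_low_output_of_output hs₁ hs₂ h hz hz₁ hz₂ (by linarith) c)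
    rcases le_total (4 * x₂) l₂ with c₂ | c₂
    · exact Or.inl (strongBound_of_low_output_of_output hs₁ hs₂ h.swap hz hz₂ hz₁
        (by linarith) c).swap
    · exact Or.inr (weakBound_of_low_output hs₁ hs₂ h hz hz₁ hz₂ (by linarith) c)
  left
  rcases le_total (4 * x₁) l₁ with c₁ | c₁ <;> rcases le_total (4 * x₂) l₂ with c₂ | c₂
  · exact strongBound_of_low_output_of_inputs hs₁ hs₂ h hz hz₁ hz₂ (by linarith) (by linarith) c.le
  -- Here one input lies below the D₁ threshold. Since `l < e - 2` and `e ≤ 4 * z + const` for both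
  -- input frequencies, the other input then lies below it too, up to the slack.
  all_goals
    have key : l₁ ≤ 4 * x₁ + 40 ∧ l₂ ≤ 4 * x₂ + 40 ∧ e - 2 ≤ max l₁ l₂ := by
      obtain ⟨zx, zx₁, zx₂, x0, x0₁, x0₂, xz, xz₁, xz₂, l0, l0₁, l0₂, tri, tri₁, tri₂, le_e, e_le,
        e_max, l₁_max, l₂_max⟩ := h
      rw [max_eq_left hz₁] at xz₁
      rw [max_eq_left hz₂] at xz₂
      have t₁ : z₁ ≤ z₂ + 1 := tri₁.trans (by rw [max_eq_right (hz.trans hz₂)])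
      have t₂ : z₂ ≤ z₁ + 1 := tri₂.trans (by rw [max_eq_right (hz.trans hz₁)])
      have hM2 : max z (max z₁ z₂) ≤ z₁ + 1 := max_le (by linarith) (max_le (by linarith) t₂)
      refine ⟨?_, ?_, ?_⟩
      · refine le_of_not_gt fun hc => ?_
        have : max (max e 0) (max l l₂) ≤ 4 * x₁ + 30 :=
          max_le (max_le (by linarith) (by linarith)) (max_le (by linarith) (by linarith))
        linarith
      · refine le_of_not_gt fun hc => ?_
        have : max (max e 0) (max l l₁) ≤ 4 * x₂ + 30 :=
          max_le (max_le (by linarith) (by linarith)) (max_le (by linarith) (by linarith))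
        linarith
      · rcases le_max_iff.1 (show e - 2 ≤ max l (max l₁ l₂) by linarith) with hc | hc
        · linarith
        · exact hc
    rcases le_max_iff.1 key.2.2 with hc | hc
    · exact strongBound_of_low_output_of_input hs₁ hs₂ h hz hz₁ hz₂ key.1 hc
    · exact (strongBound_of_low_output_of_input hs₁ hs₂ h.swap hz hz₂ hz₁ key.2.1 hc).swap

end

/-- By the triangle inequality the two largest frequencies are comparable, so `e` is the smallest
logarithm plus four times the largest, up to constants. The alternatives record which frequency is
the smallest. -/
theorem LogConfig.high {z z₁ z₂ x x₁ x₂ l l₁ l₂ e : ℝ} (h : LogConfig z z₁ z₂ x x₁ x₂ l l₁ l₂ e) :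
    (z ≤ z₁ ∧ z ≤ z₂ ∧ z₁ ≤ z₂ + 1 ∧ z₂ ≤ z₁ + 1 ∧ z + 4 * z₁ - 10 ≤ e ∧ e ≤ z + 4 * z₁ + 10) ∨
    (z₁ ≤ z ∧ z₁ ≤ z₂ ∧ z ≤ z₂ + 1 ∧ z₂ ≤ z + 1 ∧ z₁ + 4 * z - 10 ≤ e ∧ e ≤ z₁ + 4 * z + 10) ∨
    (z₂ ≤ z ∧ z₂ ≤ z₁ ∧ z ≤ z₁ + 1 ∧ z₁ ≤ z + 1 ∧ z₂ + 4 * z - 10 ≤ e ∧ e ≤ z₂ + 4 * z + 10) := by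
  have tri := h.tri
  have tri₁ := h.tri₁
  have tri₂ := h.tri₂
  have le_e := h.le_e
  have e_le := h.e_le
  rcases le_total z z₁ with a | a <;> rcases le_total z z₂ with b | b <;>
    rcases le_total z₁ z₂ with c | c <;>
    simp only [a, b, c, max_eq_left, max_eq_right] at tri tri₁ tri₂ le_e e_le <;>
    first
      | (left; refine ⟨?_, ?_, ?_, ?_, ?_, ?_⟩ <;> linarith)
      | (right; left; refine ⟨?_, ?_, ?_, ?_, ?_, ?_⟩ <;> linarith)
      | (right; right; refine ⟨?_, ?_, ?_, ?_, ?_, ?_⟩ <;> linarith)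

section

variable {s z z₁ z₂ x x₁ x₂ l l₁ l₂ e : ℝ}
variable (hs₁ : -3 / 2 ≤ s) (hs₂ : s ≤ -1) (h : LogConfig z z₁ z₂ x x₁ x₂ l l₁ l₂ e)
  (hz : 0 ≤ z) (hz₁ : 0 ≤ z₁) (hz₂ : 0 ≤ z₂)

include hs₁ hs₂ h hz hz₁ hz₂

/-- Only the value `(2 * s + 4) * x₁` at the bottom of the weight is used. The kernel ρ is taken at
the smallest frequency. -/
theorem strongBound_of_high_of_output (h₁ : 4 * x₁ - 40 ≤ l₁) (h₂ : e - 2 ≤ l) :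
    StrongBound 1000 s z z₁ z₂ x x₁ x₂ l l₁ l₂ := by
  have geo := h.high
  obtain ⟨zx, zx₁, zx₂, x0, x0₁, x0₂, xz, xz₁, xz₂, l0, l0₁, l0₂, tri, tri₁, tri₂, le_e, e_le,
    e_max, l₁_max, l₂_max⟩ := h
  rw [max_eq_left hz] at xz
  rw [max_eq_left hz₁] at xz₁
  rw [max_eq_left hz₂] at xz₂
  have w₁ := le_logWeight_of_ge_const hs₁ hs₂ x0₁ h₁
  rcases geo with geo | geo | geo <;> obtain ⟨g₁, g₂, g₃, g₄, g₅, g₆⟩ := geo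
  · refine Or.inl ⟨_, Or.inl rfl, Or.inl ?_⟩
    unfold logRho
    suffices z + s * x - l / 4 ≤ 1000 + (-(s / 2 + 1) * z - 3 / 8 * x) +
      ((2 * s + 4) * x₁ - 50) + s * x₂ by linarith
    apply le_of_affine hs₁ hs₂ <;> [(intro; ring); linarith; linarith]
  · refine Or.inl ⟨_, Or.inr (Or.inl rfl), Or.inl ?_⟩
    unfold logRho
    suffices z + s * x - l / 4 ≤ 1000 + (-(s / 2 + 1) * z₁ - 3 / 8 * x₁) +
      ((2 * s + 4) * x₁ - 50) + s * x₂ by linarith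
    apply le_of_affine hs₁ hs₂ <;> [(intro; ring); linarith; linarith]
  · refine Or.inl ⟨_, Or.inr (Or.inr rfl), Or.inl ?_⟩
    unfold logRho
    suffices z + s * x - l / 4 ≤ 1000 + (-(s / 2 + 1) * z₂ - 3 / 8 * x₂) +
      ((2 * s + 4) * x₁ - 50) + s * x₂ by linarith
    apply le_of_affine hs₁ hs₂ <;> [(intro; ring); linarith; linarith]

/-- The factor ⟨L⟩^{-9/16} costs 5/16 of `l` beyond the `l / 4` on the left. This is bounded through
`l ≤ e` and paid for by the two input weights. -/
theorem strongBound_of_high_of_inputs (h₁ : 4 * x₁ - 40 ≤ l₁) (h₂ : 4 * x₂ - 40 ≤ l₂)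
    (h₃ : l ≤ e - 2) : StrongBound 1000 s z z₁ z₂ x x₁ x₂ l l₁ l₂ := by
  have geo := h.high
  obtain ⟨zx, zx₁, zx₂, x0, x0₁, x0₂, xz, xz₁, xz₂, l0, l0₁, l0₂, tri, tri₁, tri₂, le_e, e_le,
    e_max, l₁_max, l₂_max⟩ := h
  rw [max_eq_left hz] at xz
  rw [max_eq_left hz₁] at xz₁
  rw [max_eq_left hz₂] at xz₂
  have w₁ := le_logWeight_of_ge_const hs₁ hs₂ x0₁ h₁
  have w₂ := le_logWeight_of_ge_const hs₁ hs₂ x0₂ h₂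
  rcases geo with geo | geo | geo <;> obtain ⟨g₁, g₂, g₃, g₄, g₅, g₆⟩ := geo
  · refine Or.inl ⟨_, Or.inl rfl, Or.inr (Or.inr ?_)⟩
    unfold logRho
    suffices z + s * x - l / 4 ≤ 1000 + (-(s / 2 + 1) * z - 3 / 8 * x) - 9 / 16 * l +
      ((2 * s + 4) * x₁ - 50) + ((2 * s + 4) * x₂ - 50) by linarith
    apply le_of_affine hs₁ hs₂ <;> [(intro; ring); linarith; linarith]
  · refine Or.inl ⟨_, Or.inr (Or.inl rfl), Or.inr (Or.inr ?_)⟩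
    unfold logRho
    suffices z + s * x - l / 4 ≤ 1000 + (-(s / 2 + 1) * z₁ - 3 / 8 * x₁) - 9 / 16 * l +
      ((2 * s + 4) * x₁ - 50) + ((2 * s + 4) * x₂ - 50) by linarith
    apply le_of_affine hs₁ hs₂ <;> [(intro; ring); linarith; linarith]
  · refine Or.inl ⟨_, Or.inr (Or.inr rfl), Or.inr (Or.inr ?_)⟩
    unfold logRho
    suffices z + s * x - l / 4 ≤ 1000 + (-(s / 2 + 1) * z₂ - 3 / 8 * x₂) - 9 / 16 * l +
      ((2 * s + 4) * x₁ - 50) + ((2 * s + 4) * x₂ - 50) by linarith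
    apply le_of_affine hs₁ hs₂ <;> [(intro; ring); linarith; linarith]

/-- Since `l₁` is close to `e`, it is above `5 * x₁` up to constants when k₁ is the smallest
frequency, so the third branch applies; otherwise it lies between `4 * x₁` and `5 * x₁`, and the
second applies. In the first two configurations the balance is `2 * s + 3` times the largest
logarithm, which vanishes at s = -3/2. -/
theorem strongBound_of_high_of_input (h₁ : 4 * x₁ - 40 ≤ l₁) (h₂ : l₂ ≤ 4 * x₂ + 40)
    (h₃ : e - 2 ≤ l₁) (h₄ : l₁ ≤ e + 2) : StrongBound 1000 s z z₁ z₂ x x₁ x₂ l l₁ l₂ := by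
  have geo := h.high
  obtain ⟨zx, zx₁, zx₂, x0, x0₁, x0₂, xz, xz₁, xz₂, l0, l0₁, l0₂, tri, tri₁, tri₂, le_e, e_le,
    e_max, l₁_max, l₂_max⟩ := h
  rw [max_eq_left hz] at xz
  rw [max_eq_left hz₁] at xz₁
  rw [max_eq_left hz₂] at xz₂
  have w₂ := le_logWeight_of_le hs₁ hs₂ h₂
  have wB := le_logWeight_of_ge_left hs₁ hs₂ x0₁ h₁
  have wC := le_logWeight_of_ge_right hs₁ hs₂ x0₁ h₁
  refine Or.inr (Or.inl ⟨hz₁, ?_⟩)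
  rcases geo with geo | geo | geo <;> obtain ⟨g₁, g₂, g₃, g₄, g₅, g₆⟩ := geo
  · suffices z + s * x - l / 4 ≤ 1000 - l / 4 - 3 / 4 * l₂ +
      ((-3 * s - 1) * x₁ + (s + 1) * l₁ - 50) +
      (s * x₂ + 3 / 4 * l₂ - 50) by linarith
    apply le_of_affine hs₁ hs₂ <;> [(intro; ring); linarith; linarith]
  · suffices z + s * x - l / 4 ≤ 1000 - l / 4 - 3 / 4 * l₂ +
      ((-s / 2 - 1) * x₁ + (s / 2 + 1) * l₁ - 50) +
      (s * x₂ + 3 / 4 * l₂ - 50) by linarith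
    apply le_of_affine hs₁ hs₂ <;> [(intro; ring); linarith; linarith]
  · suffices z + s * x - l / 4 ≤ 1000 - l / 4 - 3 / 4 * l₂ +
      ((-3 * s - 1) * x₁ + (s + 1) * l₁ - 50) +
      (s * x₂ + 3 / 4 * l₂ - 50) by linarith
    apply le_of_affine hs₁ hs₂ <;> [(intro; ring); linarith; linarith]

/-- With the second branch the X weight of the output is |k|^{-3s}⟨L⟩^s. Inserting ⟨L⟩ ≳ |H| gives
at most |k₁|^s|k₂|^s, and the powers agree exactly when k is one of the two comparable large
frequencies. -/
theorem weakBound_of_high (h₁ : l₁ ≤ 4 * x₁ + 40) (h₂ : l₂ ≤ 4 * x₂ + 40) (h₃ : e - 2 ≤ l) :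
    WeakBound 1000 s z z₁ z₂ x x₁ x₂ l l₁ l₂ := by
  have geo := h.high
  obtain ⟨zx, zx₁, zx₂, x0, x0₁, x0₂, xz, xz₁, xz₂, l0, l0₁, l0₂, tri, tri₁, tri₂, le_e, e_le,
    e_max, l₁_max, l₂_max⟩ := h
  rw [max_eq_left hz] at xz
  rw [max_eq_left hz₁] at xz₁
  rw [max_eq_left hz₂] at xz₂
  have w₁ := le_logWeight_of_le hs₁ hs₂ h₁
  have w₂ := le_logWeight_of_le hs₁ hs₂ h₂
  constructor
  · refine Or.inr ⟨hz, ?_⟩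
    suffices z - l + max ((-3 * s - 1) * x + (s + 1) * l) ((-s / 2 - 1) * x + (s / 2 + 1) * l) ≤
        1000 - 3 / 4 * l₁ - 3 / 4 * l₂ + (s * x₁ + 3 / 4 * l₁ - 50) +
          (s * x₂ + 3 / 4 * l₂ - 50) by
      have : logWeight s x l ≤ _ := min_le_right _ _
      linarith
    rw [← le_sub_iff_add_le']
    rcases geo with geo | geo | geo <;> obtain ⟨g₁, g₂, g₃, g₄, g₅, g₆⟩ := geo <;>
      refine max_le ?_ ?_
    all_goals apply le_of_affine hs₁ hs₂ <;> [(intro; ring); linarith; linarith]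
  · rcases geo with geo | geo | geo <;> obtain ⟨g₁, g₂, g₃, g₄, g₅, g₆⟩ := geo
    · refine ⟨_, Or.inl rfl, ?_⟩
      unfold logRho
      apply le_of_affine hs₁ hs₂ <;> [(intro; ring); linarith; linarith]
    · refine ⟨_, Or.inr (Or.inl rfl), ?_⟩
      unfold logRho
      apply le_of_affine hs₁ hs₂ <;> [(intro; ring); linarith; linarith]
    · refine ⟨_, Or.inr (Or.inr rfl), ?_⟩
      unfold logRho
      apply le_of_affine hs₁ hs₂ <;> [(intro; ring); linarith; linarith]

theorem bound_of_high :
    StrongBound 1000 s z z₁ z₂ x x₁ x₂ l l₁ l₂ ∨ WeakBound 1000 s z z₁ z₂ x x₁ x₂ l l₁ l₂ := by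
  have xz := h.xz
  have xz₁ := h.xz₁
  have xz₂ := h.xz₂
  rw [max_eq_left hz] at xz
  rw [max_eq_left hz₁] at xz₁
  rw [max_eq_left hz₂] at xz₂
  rcases le_or_gt (e - 2) l with c | c
  · rcases le_total (4 * x₁ - 20) l₁ with c₁ | c₁
    · exact Or.inl (strongBound_of_high_of_output hs₁ hs₂ h hz hz₁ hz₂ (by linarith) c)
    rcases le_total (4 * x₂ - 20) l₂ with c₂ | c₂
    · exact Or.inl (strongBound_of_high_of_output hs₁ hs₂ h.swap hz hz₂ hz₁ (by linarith) c).swap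
    · exact Or.inr (weakBound_of_high hs₁ hs₂ h hz hz₁ hz₂ (by linarith) (by linarith) c)
  -- These bounds force a dominant input to lie above the D₁ threshold, which rules out the last of
  -- the four cases below.
  have he₁ : 4 * z₁ - 20 ≤ e := by rcases h.high with g | g | g <;> linarith
  have he₂ : 4 * z₂ - 20 ≤ e := by rcases h.high with g | g | g <;> linarith
  have he : e - 2 ≤ max l₁ l₂ := by
    rcases le_max_iff.1 (show e - 2 ≤ max l (max l₁ l₂) by linarith [h.e_max]) with hc | hc
    · linarith
    · exact hc
  left
  rcases le_total (4 * x₁ - 30) l₁ with c₁ | c₁ <;> rcases le_total (4 * x₂ - 30) l₂ with c₂ | c₂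
  · exact strongBound_of_high_of_inputs hs₁ hs₂ h hz hz₁ hz₂ (by linarith) (by linarith) c.le
  · have c₃ : e - 2 ≤ l₁ := by rcases le_max_iff.1 he with hc | hc <;> linarith
    refine strongBound_of_high_of_input hs₁ hs₂ h hz hz₁ hz₂ (by linarith) (by linarith) c₃ ?_
    have : max (max e 0) (max l l₂) ≤ e :=
      max_le (max_le le_rfl (by linarith [h.l0])) (max_le (by linarith) (by linarith))
    linarith [h.l₁_max]
  · have c₃ : e - 2 ≤ l₂ := by rcases le_max_iff.1 he with hc | hc <;> linarith
    refine (strongBound_of_high_of_input hs₁ hs₂ h.swap hz hz₂ hz₁ (by linarith) (by linarith)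
      c₃ ?_).swap
    have : max (max e 0) (max l l₁) ≤ e :=
      max_le (max_le le_rfl (by linarith [h.l0])) (max_le (by linarith) (by linarith))
    linarith [h.l₂_max]
  · rcases le_max_iff.1 he with hc | hc <;> linarith

omit hz hz₁ hz₂ in
/-- The pointwise bound for the output weights, in logarithmic form. -/
theorem strongBound_or_weakBound :
    StrongBound 1000 s z z₁ z₂ x x₁ x₂ l l₁ l₂ ∨ WeakBound 1000 s z z₁ z₂ x x₁ x₂ l l₁ l₂ := by
  rcases le_total z₁ 0 with h₁ | h₁
  · exact Or.inl (strongBound_of_low_input hs₁ hs₂ h h₁)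
  rcases le_total z₂ 0 with h₂ | h₂
  · exact Or.inl (strongBound_of_low_input hs₁ hs₂ h.swap h₂).swap
  rcases le_total z 0 with h₀ | h₀
  · exact bound_of_low_output hs₁ hs₂ h h₀ h₁ h₂
  · exact bound_of_high hs₁ hs₂ h h₀ h₁ h₂

end

/-! ### Japanese brackets, the weights and the resonance function. -/

theorem one_le_jb (x : ℝ) : 1 ≤ jb x := by
  rw [jb, Real.one_le_sqrt]; nlinarith [sq_nonneg x]

theorem jb_pos (x : ℝ) : 0 < jb x := one_pos.trans_le (one_le_jb x)

theorem abs_le_jb (x : ℝ) : |x| ≤ jb x := Real.abs_le_sqrt (by linarith)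

theorem jb_le (x : ℝ) : jb x ≤ 1 + |x| := by
  rw [jb, Real.sqrt_le_left (by positivity)]
  nlinarith [abs_nonneg x, sq_abs x]

theorem jb_neg (x : ℝ) : jb (-x) = jb x := by simp [jb]

theorem jb_le_add (x y : ℝ) : jb (x + y) ≤ jb x + jb y := by
  have hx := abs_le_jb x
  have hy := abs_le_jb y
  have h1 := one_le_jb x
  have h2 := one_le_jb y
  have ex : jb x ^ 2 = 1 + x ^ 2 := Real.sq_sqrt (by positivity)
  have ey : jb y ^ 2 = 1 + y ^ 2 := Real.sq_sqrt (by positivity)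
  rw [jb, Real.sqrt_le_left (by positivity)]
  have : x * y ≤ jb x * jb y :=
    (le_abs_self _).trans (by rw [abs_mul]; gcongr)
  nlinarith

theorem continuous_jb : Continuous jb := by
  unfold jb; fun_prop

theorem measurable_jb : Measurable jb := continuous_jb.measurable

theorem jb_rpow_eq (x a : ℝ) : jb x ^ a = Real.exp (a * Real.log (jb x)) := by
  rw [Real.rpow_def_of_pos (jb_pos x), mul_comm]

theorem jb_rpow_pos (x a : ℝ) : 0 < jb x ^ a := Real.rpow_pos_of_pos (jb_pos x) a

theorem freq_add (lam : ℝ) (n m : ℤ) : freq lam n = freq lam m + freq lam (n - m) := by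
  simp only [freq]; push_cast; ring

theorem freq_ne_zero {lam : ℝ} (hlam : 0 < lam) {n : ℤ} (hn : n ≠ 0) : freq lam n ≠ 0 :=
  div_ne_zero (Int.cast_ne_zero.2 hn) hlam.ne'

/-- The weight of the `Z^s` norm, up to constants. -/
def weight (s k L : ℝ) : ℝ :=
  min (jb k ^ s * jb L ^ (3 / 4 : ℝ))
    (max (jb k ^ (-3 * s - 1) * jb L ^ (s + 1)) (jb k ^ (-s / 2 - 1) * jb L ^ (s / 2 + 1)))

theorem weight_eq (s k L : ℝ) :
    weight s k L = Real.exp (logWeight s (Real.log (jb k)) (Real.log (jb L))) := by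
  simp only [weight, logWeight, jb_rpow_eq, ← Real.exp_add, Real.exp_monotone.map_min,
    Real.exp_monotone.map_max]

theorem weight_pos (s k L : ℝ) : 0 < weight s k L := by
  rw [weight_eq]; exact Real.exp_pos _

/-- The kernel `|k|^{-(s/2+1)} ⟨k⟩^{-3/8}`. -/
def rho (s k : ℝ) : ℝ := |k| ^ (-(s / 2 + 1)) * jb k ^ (-(3 / 8) : ℝ)

theorem rho_nonneg (s k : ℝ) : 0 ≤ rho s k :=
  mul_nonneg (Real.rpow_nonneg (abs_nonneg _) _) (jb_rpow_pos _ _).le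

theorem rho_eq (s : ℝ) {k : ℝ} (hk : k ≠ 0) :
    rho s k = Real.exp (logRho s (Real.log |k|) (Real.log (jb k))) := by
  rw [rho, logRho, jb_rpow_eq, Real.rpow_def_of_pos (abs_pos.2 hk), ← Real.exp_add]
  ring_nf

/-- The resonance function. -/
def resonance (lam β k₁ k₂ : ℝ) : ℝ :=
  (k₁ + k₂) * k₁ * k₂ * (5 * (k₁ ^ 2 + k₁ * k₂ + k₂ ^ 2) + 3 * (β * (lam ^ 2)⁻¹))

theorem disp_add (lam β k₁ k₂ : ℝ) :
    disp lam β (k₁ + k₂) = disp lam β k₁ + disp lam β k₂ + resonance lam β k₁ k₂ := by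
  simp only [disp, resonance]; ring

/-- In the integer labels the quadratic form is positive definite, so its value is a positive
integer. This is how the lattice spacing tames the β term. -/
theorem inv_sq_le_freq (lam : ℝ) {m j : ℤ} (hm : m ≠ 0) :
    (lam ^ 2)⁻¹ ≤ freq lam m ^ 2 + freq lam m * freq lam j + freq lam j ^ 2 := by
  have h : 1 ≤ m ^ 2 + m * j + j ^ 2 := by
    have h0 : 0 < m ^ 2 := by positivity
    nlinarith [sq_nonneg (m + 2 * j)]
  have h' : (1 : ℝ) ≤ (m : ℝ) ^ 2 + m * j + (j : ℝ) ^ 2 := by exact_mod_cast h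
  have e : freq lam m ^ 2 + freq lam m * freq lam j + freq lam j ^ 2 =
      ((m : ℝ) ^ 2 + m * j + (j : ℝ) ^ 2) * (lam ^ 2)⁻¹ := by
    simp only [freq, div_eq_mul_inv]; ring
  rw [e]
  exact le_mul_of_one_le_left (by positivity) h'

section

variable {lam β k₁ k₂ : ℝ} (hβ : |β| ≤ 1)
  (hQ : (lam ^ 2)⁻¹ ≤ k₁ ^ 2 + k₁ * k₂ + k₂ ^ 2)

include hβ hQ

/-- The lower-order term is at most 3Q in absolute value, with Q = k₁² + k₁k₂ + k₂², so the last
factor of H stays between 2Q and 8Q. -/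
theorem abs_resonance_bounds :
    |k₁ + k₂| * |k₁| * |k₂| * (2 * (k₁ ^ 2 + k₁ * k₂ + k₂ ^ 2)) ≤ |resonance lam β k₁ k₂| ∧
    |resonance lam β k₁ k₂| ≤ |k₁ + k₂| * |k₁| * |k₂| * (8 * (k₁ ^ 2 + k₁ * k₂ + k₂ ^ 2)) := by
  have h0 : 0 ≤ (lam ^ 2)⁻¹ := by positivity
  have hb : |β * (lam ^ 2)⁻¹| ≤ k₁ ^ 2 + k₁ * k₂ + k₂ ^ 2 := by
    rw [abs_mul, abs_of_nonneg h0]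
    nlinarith
  obtain ⟨hb1, hb2⟩ := abs_le.1 hb
  rw [resonance, abs_mul, abs_mul, abs_mul,
    abs_of_nonneg (a := 5 * (k₁ ^ 2 + k₁ * k₂ + k₂ ^ 2) + 3 * (β * (lam ^ 2)⁻¹)) (by linarith)]
  constructor <;> gcongr <;> linarith

end

/-- A sum of two terms is at most twice the larger one, and 2 < e. -/
theorem log_le_max_add_one {a u v : ℝ} (ha : 0 < a) (h : a ≤ Real.exp u + Real.exp v) :
    Real.log a ≤ max u v + 1 := by
  rw [Real.log_le_iff_le_exp ha, Real.exp_add]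
  have h1 : Real.exp u ≤ Real.exp (max u v) := Real.exp_le_exp.2 (le_max_left _ _)
  have h2 : Real.exp v ≤ Real.exp (max u v) := Real.exp_le_exp.2 (le_max_right _ _)
  have := Real.exp_one_gt_d9
  nlinarith [Real.exp_pos (max u v)]

theorem log_le_max_add_two {a u v w : ℝ} (ha : 0 < a)
    (h : a ≤ Real.exp u + (Real.exp v + Real.exp w)) :
    Real.log a ≤ max u (max v w) + 2 := by
  have h1 : Real.exp v + Real.exp w ≤ Real.exp (max v w + 1) := by
    rw [← Real.log_le_iff_le_exp (by positivity)]
    exact log_le_max_add_one (by positivity) le_rfl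
  have h2 := log_le_max_add_one ha (h.trans (add_le_add_right h1 _))
  have : max u (max v w + 1) ≤ max u (max v w) + 1 :=
    max_le ((le_max_left _ _).trans (by linarith)) (by linarith [le_max_right u (max v w)])
  linarith

theorem log_le_max_add_two' {a t u v w : ℝ} (ha : 0 < a)
    (h : a ≤ Real.exp t + Real.exp u + (Real.exp v + Real.exp w)) :
    Real.log a ≤ max (max t u) (max v w) + 2 := by
  have h1 : Real.exp v + Real.exp w ≤ Real.exp (max v w + 1) := by
    rw [← Real.log_le_iff_le_exp (by positivity)]
    exact log_le_max_add_one (by positivity) le_rfl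
  have h2 : Real.exp t + Real.exp u ≤ Real.exp (max t u + 1) := by
    rw [← Real.log_le_iff_le_exp (by positivity)]
    exact log_le_max_add_one (by positivity) le_rfl
  have h3 := log_le_max_add_one ha (h.trans (add_le_add h2 h1))
  rw [max_add_add_right] at h3
  linarith

/-- Triangle inequalities for the frequencies and for L = L₁ + L₂ - H, together with Q ≥ 3/4 times
the square of each of the three frequencies. -/
theorem logConfig {lam β k₁ k₂ L L₁ L₂ : ℝ} (hβ : |β| ≤ 1)
    (hQ : (lam ^ 2)⁻¹ ≤ k₁ ^ 2 + k₁ * k₂ + k₂ ^ 2) (h₁ : k₁ ≠ 0) (h₂ : k₂ ≠ 0)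
    (h₀ : k₁ + k₂ ≠ 0) (hlam : 0 < lam) (hL : L = L₁ + L₂ - resonance lam β k₁ k₂) :
    LogConfig (Real.log |k₁ + k₂|) (Real.log |k₁|) (Real.log |k₂|) (Real.log (jb (k₁ + k₂)))
      (Real.log (jb k₁)) (Real.log (jb k₂)) (Real.log (jb L)) (Real.log (jb L₁))
      (Real.log (jb L₂)) (Real.log |resonance lam β k₁ k₂|) := by
  have p₀ := abs_pos.2 h₀
  have p₁ := abs_pos.2 h₁
  have p₂ := abs_pos.2 h₂
  obtain ⟨hr1, hr2⟩ := abs_resonance_bounds hβ hQ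
  have hlam' : 0 < (lam ^ 2)⁻¹ := by positivity
  have hQ0 := hlam'.trans_le hQ
  have pH : 0 < |resonance lam β k₁ k₂| := lt_of_lt_of_le (by positivity) hr1
  have zx (k : ℝ) (hk : k ≠ 0) : Real.log |k| ≤ Real.log (jb k) :=
    Real.log_le_log (abs_pos.2 hk) (abs_le_jb k)
  have x0 (k : ℝ) : 0 ≤ Real.log (jb k) := Real.log_nonneg (one_le_jb k)
  have xz (k : ℝ) (hk : k ≠ 0) : Real.log (jb k) ≤ max (Real.log |k|) 0 + 1 :=
    log_le_max_add_one (jb_pos k) (by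
      rw [Real.exp_log (abs_pos.2 hk), Real.exp_zero, add_comm]; exact jb_le k)
  have q1 : 3 / 4 * k₁ ^ 2 ≤ k₁ ^ 2 + k₁ * k₂ + k₂ ^ 2 := by nlinarith [sq_nonneg (k₁ + 2 * k₂)]
  have q2 : 3 / 4 * k₂ ^ 2 ≤ k₁ ^ 2 + k₁ * k₂ + k₂ ^ 2 := by nlinarith [sq_nonneg (2 * k₁ + k₂)]
  have q0 : 3 / 4 * (k₁ + k₂) ^ 2 ≤ k₁ ^ 2 + k₁ * k₂ + k₂ ^ 2 := by
    nlinarith [sq_nonneg (k₁ - k₂)]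
  have low (k : ℝ) (hk : k ≠ 0) (q : 3 / 4 * k ^ 2 ≤ k₁ ^ 2 + k₁ * k₂ + k₂ ^ 2) :
      Real.log |k₁ + k₂| + Real.log |k₁| + Real.log |k₂| + 2 * Real.log |k| ≤
        Real.log |resonance lam β k₁ k₂| := by
    rw [← Real.log_mul p₀.ne' p₁.ne', ← Real.log_mul (by positivity) p₂.ne',
      show 2 * Real.log |k| = Real.log (|k| ^ 2) by rw [Real.log_pow]; norm_num,
      ← Real.log_mul (by positivity) (by positivity)]
    refine Real.log_le_log (by positivity) (le_trans ?_ hr1)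
    rw [sq_abs]
    gcongr
    nlinarith
  have up : Real.log |resonance lam β k₁ k₂| ≤ Real.log |k₁ + k₂| + Real.log |k₁| +
      Real.log |k₂| + 2 * max (Real.log |k₁|) (Real.log |k₂|) + 4 := by
    rw [Real.log_le_iff_le_exp pH]
    refine hr2.trans ?_
    rw [Real.exp_add, Real.exp_add, Real.exp_add, Real.exp_add, Real.exp_log p₀, Real.exp_log p₁,
      Real.exp_log p₂, mul_assoc (|k₁ + k₂| * |k₁| * |k₂|)]
    refine mul_le_mul_of_nonneg_left ?_ (by positivity)
    have e1 : |k₁| ≤ Real.exp (max (Real.log |k₁|) (Real.log |k₂|)) := by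
      rw [← Real.log_le_iff_le_exp p₁]; exact le_max_left _ _
    have e2 : |k₂| ≤ Real.exp (max (Real.log |k₁|) (Real.log |k₂|)) := by
      rw [← Real.log_le_iff_le_exp p₂]; exact le_max_right _ _
    -- 24 = 8 · 3, since Q is at most three times the square of the larger input frequency.
    have e3 : (24 : ℝ) ≤ Real.exp 4 := by
      have := Real.exp_one_gt_d9
      rw [show (4 : ℝ) = (4 : ℕ) * 1 by norm_num, Real.exp_nat_mul]
      calc (24 : ℝ) ≤ 2.7 ^ 4 := by norm_num
        _ ≤ _ := by gcongr; linarith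
    rw [show ∀ t : ℝ, Real.exp (2 * t) = Real.exp t ^ 2 by
      intro t; rw [← Real.exp_nat_mul]; norm_num]
    set E := Real.exp (max (Real.log |k₁|) (Real.log |k₂|))
    have e4 : k₁ ^ 2 ≤ E ^ 2 := by rw [← sq_abs k₁]; gcongr
    have e5 : k₂ ^ 2 ≤ E ^ 2 := by rw [← sq_abs k₂]; gcongr
    have e6 : 8 * (k₁ ^ 2 + k₁ * k₂ + k₂ ^ 2) ≤ E ^ 2 * 24 := by nlinarith [sq_nonneg (k₁ - k₂)]
    exact e6.trans (by gcongr)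
  refine ⟨zx _ h₀, zx _ h₁, zx _ h₂, x0 _, x0 _, x0 _, xz _ h₀, xz _ h₁, xz _ h₂, x0 _, x0 _,
    x0 _, ?_, ?_, ?_, ?_, ?_, ?_, ?_, ?_⟩
  · refine log_le_max_add_one p₀ ?_
    rw [Real.exp_log p₁, Real.exp_log p₂]
    exact abs_add_le _ _
  · refine log_le_max_add_one p₁ ?_
    rw [Real.exp_log p₀, Real.exp_log p₂]
    simpa using abs_sub (k₁ + k₂) k₂
  · refine log_le_max_add_one p₂ ?_
    rw [Real.exp_log p₀, Real.exp_log p₁]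
    simpa using abs_sub (k₁ + k₂) k₁
  · have l0 := low _ h₀ q0
    have l1 := low _ h₁ q1
    have l2 := low _ h₂ q2
    rcases max_choice (Real.log |k₁|) (Real.log |k₂|) with c | c <;> rw [c]
    · rcases max_choice (Real.log |k₁ + k₂|) (Real.log |k₁|) with c | c <;> rw [c] <;> linarith
    · rcases max_choice (Real.log |k₁ + k₂|) (Real.log |k₂|) with c | c <;> rw [c] <;> linarith
  · have := le_max_right (Real.log |k₁ + k₂|) (max (Real.log |k₁|) (Real.log |k₂|))
    linarith
  · refine log_le_max_add_two pH ?_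
    rw [Real.exp_log (jb_pos _), Real.exp_log (jb_pos _), Real.exp_log (jb_pos _)]
    have : resonance lam β k₁ k₂ = -L + (L₁ + L₂) := by linarith
    rw [this]
    refine (abs_add_le _ _).trans (add_le_add ?_ ((abs_add_le _ _).trans (add_le_add ?_ ?_)))
    · rw [abs_neg]; exact abs_le_jb L
    · exact abs_le_jb L₁
    · exact abs_le_jb L₂
  · refine log_le_max_add_two' (jb_pos _) ?_
    rw [Real.exp_log (jb_pos _), Real.exp_log (jb_pos _), Real.exp_log pH, Real.exp_zero]
    have : L₁ = resonance lam β k₁ k₂ + (L + -L₂) := by linarith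
    have h1 := abs_add_le (resonance lam β k₁ k₂) (L + -L₂)
    have h2 := abs_add_le L (-L₂)
    rw [← this] at h1
    rw [abs_neg] at h2
    linarith [jb_le L₁, abs_le_jb L, abs_le_jb L₂]
  · refine log_le_max_add_two' (jb_pos _) ?_
    rw [Real.exp_log (jb_pos _), Real.exp_log (jb_pos _), Real.exp_log pH, Real.exp_zero]
    have : L₂ = resonance lam β k₁ k₂ + (L + -L₁) := by linarith
    have h1 := abs_add_le (resonance lam β k₁ k₂) (L + -L₁)
    have h2 := abs_add_le L (-L₁)
    rw [← this] at h1
    rw [abs_neg] at h2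
    linarith [jb_le L₂, abs_le_jb L, abs_le_jb L₁]

/-! ### The pointwise kernel bounds for the output weights. -/

/-- The indicator function of `|k| ≥ 1`. -/
def highFreq (k : ℝ) : ℝ := if 1 ≤ |k| then 1 else 0

theorem highFreq_nonneg (k : ℝ) : 0 ≤ highFreq k := by
  unfold highFreq; split_ifs <;> norm_num

theorem highFreq_of_log_nonneg {k : ℝ} (hk : k ≠ 0) (h : 0 ≤ Real.log |k|) : highFreq k = 1 :=
  if_pos ((Real.log_nonneg_iff (abs_pos.2 hk)).1 h)

/-- The kernels controlling the output when its modulation is not dominant. -/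
def strongSum (s k k₁ k₂ L L₁ L₂ : ℝ) : ℝ :=
  (rho s k + rho s k₁ + rho s k₂) * (weight s k₁ L₁ * jb k₂ ^ s) +
  (rho s k + rho s k₁ + rho s k₂) * (jb k₁ ^ s * weight s k₂ L₂) +
  jb L ^ (-(9 / 16) : ℝ) * ((rho s k + rho s k₁ + rho s k₂) * (weight s k₁ L₁ * weight s k₂ L₂)) +
  highFreq k₁ * (jb L ^ (-(1 / 4) : ℝ) * jb L₂ ^ (-(3 / 4) : ℝ)) *
    (weight s k₁ L₁ * weight s k₂ L₂) +
  highFreq k₂ * (jb L ^ (-(1 / 4) : ℝ) * jb L₁ ^ (-(3 / 4) : ℝ)) *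
    (weight s k₁ L₁ * weight s k₂ L₂)

section

variable {s k k₁ k₂ L L₁ L₂ : ℝ}

theorem strongSum_nonneg : 0 ≤ strongSum s k k₁ k₂ L L₁ L₂ := by
  have := rho_nonneg s k
  have := rho_nonneg s k₁
  have := rho_nonneg s k₂
  have := highFreq_nonneg k₁
  have := highFreq_nonneg k₂
  have := weight_pos s k₁ L₁
  have := weight_pos s k₂ L₂
  have := jb_pos L
  have := jb_pos L₁
  have := jb_pos L₂
  have := jb_pos k₁
  have := jb_pos k₂
  unfold strongSum
  positivity

theorem exists_rho_eq (hk : k ≠ 0) (h₁ : k₁ ≠ 0) (h₂ : k₂ ≠ 0) {r : ℝ}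
    (hr : r = logRho s (Real.log |k|) (Real.log (jb k)) ∨
      r = logRho s (Real.log |k₁|) (Real.log (jb k₁)) ∨
      r = logRho s (Real.log |k₂|) (Real.log (jb k₂))) :
    Real.exp r ≤ rho s k + rho s k₁ + rho s k₂ := by
  have := rho_nonneg s k
  have := rho_nonneg s k₁
  have := rho_nonneg s k₂
  rcases hr with rfl | rfl | rfl
  · rw [← rho_eq s hk]; linarith
  · rw [← rho_eq s h₁]; linarith
  · rw [← rho_eq s h₂]; linarith

/-- Each of the five alternatives of `StrongBound` exponentiates to one summand of `strongSum`; the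
others are nonnegative. -/
theorem strongSum_ge (hk : k ≠ 0) (h₁ : k₁ ≠ 0) (h₂ : k₂ ≠ 0) {D : ℝ}
    (h : StrongBound D s (Real.log |k|) (Real.log |k₁|) (Real.log |k₂|) (Real.log (jb k))
      (Real.log (jb k₁)) (Real.log (jb k₂)) (Real.log (jb L)) (Real.log (jb L₁))
      (Real.log (jb L₂))) :
    |k| * jb k ^ s * jb L ^ (-(1 / 4) : ℝ) ≤ Real.exp D * strongSum s k k₁ k₂ L L₁ L₂ := by
  have e : |k| * jb k ^ s * jb L ^ (-(1 / 4) : ℝ) =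
      Real.exp (Real.log |k| + s * Real.log (jb k) - Real.log (jb L) / 4) := by
    conv_lhs => rw [← Real.exp_log (abs_pos.2 hk), jb_rpow_eq, jb_rpow_eq, ← Real.exp_add,
      ← Real.exp_add]
    ring_nf
  rw [e, strongSum]
  have := rho_nonneg s k
  have := rho_nonneg s k₁
  have := rho_nonneg s k₂
  have := highFreq_nonneg k₁
  have := highFreq_nonneg k₂
  have := weight_pos s k₁ L₁
  have := weight_pos s k₂ L₂
  have := jb_rpow_pos L (-(9 / 16))
  have := jb_rpow_pos L (-(1 / 4))
  have := jb_rpow_pos L₁ (-(3 / 4))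
  have := jb_rpow_pos L₂ (-(3 / 4))
  have := jb_rpow_pos k₁ s
  have := jb_rpow_pos k₂ s
  have n₁ : 0 ≤ (rho s k + rho s k₁ + rho s k₂) * (weight s k₁ L₁ * jb k₂ ^ s) := by positivity
  have n₂ : 0 ≤ (rho s k + rho s k₁ + rho s k₂) * (jb k₁ ^ s * weight s k₂ L₂) := by positivity
  have n₃ : 0 ≤ jb L ^ (-(9 / 16) : ℝ) *
    ((rho s k + rho s k₁ + rho s k₂) * (weight s k₁ L₁ * weight s k₂ L₂)) := by positivity
  have n₄ : 0 ≤ highFreq k₁ * (jb L ^ (-(1 / 4) : ℝ) * jb L₂ ^ (-(3 / 4) : ℝ)) *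
    (weight s k₁ L₁ * weight s k₂ L₂) := by positivity
  have n₅ : 0 ≤ highFreq k₂ * (jb L ^ (-(1 / 4) : ℝ) * jb L₁ ^ (-(3 / 4) : ℝ)) *
    (weight s k₁ L₁ * weight s k₂ L₂) := by positivity
  have hD := Real.exp_pos D
  rcases h with ⟨r, hr, h | h | h⟩ | ⟨h0, h⟩ | ⟨h0, h⟩ <;>
    refine (Real.exp_le_exp.2 h).trans ?_
  · have hr := exists_rho_eq hk h₁ h₂ hr
    rw [add_assoc, add_assoc D, Real.exp_add, Real.exp_add, Real.exp_add, ← weight_eq, ← jb_rpow_eq]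
    refine mul_le_mul_of_nonneg_left (le_trans (mul_le_mul_of_nonneg_right hr (by positivity)) ?_)
      hD.le
    linarith
  · have hr := exists_rho_eq hk h₁ h₂ hr
    rw [add_assoc, add_assoc D, Real.exp_add, Real.exp_add, Real.exp_add, ← weight_eq, ← jb_rpow_eq]
    refine mul_le_mul_of_nonneg_left (le_trans (mul_le_mul_of_nonneg_right hr (by positivity)) ?_)
      hD.le
    linarith
  · have hr := exists_rho_eq hk h₁ h₂ hr
    rw [show ∀ a b c d f : ℝ, a + b - 9 / 16 * c + d + f = a + (-(9 / 16) * c + (b + (d + f))) by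
      intros; ring, Real.exp_add, Real.exp_add, Real.exp_add, Real.exp_add, ← weight_eq,
      ← weight_eq, ← jb_rpow_eq]
    refine mul_le_mul_of_nonneg_left (le_trans (mul_le_mul_of_nonneg_left
      (mul_le_mul_of_nonneg_right hr (by positivity)) (by positivity)) ?_) hD.le
    linarith
  · rw [highFreq_of_log_nonneg h₁ h0] at n₄ ⊢
    rw [show ∀ a b c d f : ℝ, a - b / 4 - 3 / 4 * c + d + f =
      a + ((-(1 / 4) * b + -(3 / 4) * c) + (d + f)) by intros; ring, Real.exp_add, Real.exp_add,
      Real.exp_add, Real.exp_add, ← weight_eq, ← weight_eq, ← jb_rpow_eq, ← jb_rpow_eq]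
    refine mul_le_mul_of_nonneg_left ?_ hD.le
    linarith
  · rw [highFreq_of_log_nonneg h₂ h0] at n₅ ⊢
    rw [show ∀ a b c d f : ℝ, a - b / 4 - 3 / 4 * c + d + f =
      a + ((-(1 / 4) * b + -(3 / 4) * c) + (d + f)) by intros; ring, Real.exp_add, Real.exp_add,
      Real.exp_add, Real.exp_add, ← weight_eq, ← weight_eq, ← jb_rpow_eq, ← jb_rpow_eq]
    refine mul_le_mul_of_nonneg_left ?_ hD.le
    linarith

/-- The pointwise bounds for the two output weights. -/
theorem output_weight_bounds {lam β : ℝ} (hs₁ : -3 / 2 ≤ s) (hs₂ : s ≤ -1) (hβ : |β| ≤ 1)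
    (hQ : (lam ^ 2)⁻¹ ≤ k₁ ^ 2 + k₁ * k₂ + k₂ ^ 2) (h₁ : k₁ ≠ 0) (h₂ : k₂ ≠ 0)
    (hk : k ≠ 0) (hadd : k = k₁ + k₂) (hlam : 0 < lam)
    (hL : L = L₁ + L₂ - resonance lam β k₁ k₂) :
    |k| * jb L ^ (-1 : ℝ) * weight s k L ≤ Real.exp 1000 * (strongSum s k k₁ k₂ L L₁ L₂ +
      highFreq k * (jb L₁ ^ (-(3 / 4) : ℝ) * jb L₂ ^ (-(3 / 4) : ℝ)) *
        (weight s k₁ L₁ * weight s k₂ L₂)) ∧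
    |k| * jb L ^ (-1 : ℝ) * jb k ^ s ≤ Real.exp 1000 *
      (jb L ^ (-(3 / 4) : ℝ) * strongSum s k k₁ k₂ L L₁ L₂ +
        (rho s k + rho s k₁ + rho s k₂) * (jb k₁ ^ s * jb k₂ ^ s)) := by
  have hcfg := logConfig hβ hQ h₁ h₂ (hadd ▸ hk) hlam hL
  rw [← hadd] at hcfg
  have r₀ := rho_nonneg s k
  have r₁ := rho_nonneg s k₁
  have r₂ := rho_nonneg s k₂
  have c₀ := highFreq_nonneg k
  have := weight_pos s k₁ L₁
  have := weight_pos s k₂ L₂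
  have := jb_rpow_pos L (-(3 / 4))
  have := jb_rpow_pos L₁ (-(3 / 4))
  have := jb_rpow_pos L₂ (-(3 / 4))
  have := jb_rpow_pos k₁ s
  have := jb_rpow_pos k₂ s
  have hS := strongSum_nonneg (s := s) (k := k) (k₁ := k₁) (k₂ := k₂) (L := L) (L₁ := L₁) (L₂ := L₂)
  have n₁ : 0 ≤ highFreq k * (jb L₁ ^ (-(3 / 4) : ℝ) * jb L₂ ^ (-(3 / 4) : ℝ)) *
        (weight s k₁ L₁ * weight s k₂ L₂) := by positivity
  have n₂ : 0 ≤ (rho s k + rho s k₁ + rho s k₂) * (jb k₁ ^ s * jb k₂ ^ s) := by positivity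
  have hD := Real.exp_pos 1000
  have ea : |k| * jb L ^ (-1 : ℝ) * weight s k L = Real.exp (Real.log |k| - Real.log (jb L) +
      logWeight s (Real.log (jb k)) (Real.log (jb L))) := by
    conv_lhs => rw [← Real.exp_log (abs_pos.2 hk), jb_rpow_eq, weight_eq, ← Real.exp_add,
      ← Real.exp_add]
    ring_nf
  rcases strongBound_or_weakBound hs₁ hs₂ hcfg with h | h
  · have h := strongSum_ge hk h₁ h₂ h
    constructor
    -- The first branch of the weight already turns the left side into the quantity of the strong
    -- bound.
    · have hw : |k| * jb L ^ (-1 : ℝ) * weight s k L ≤ |k| * jb k ^ s * jb L ^ (-(1 / 4) : ℝ) := by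
        calc |k| * jb L ^ (-1 : ℝ) * weight s k L
            ≤ |k| * jb L ^ (-1 : ℝ) * (jb k ^ s * jb L ^ (3 / 4 : ℝ)) := by
              have := jb_rpow_pos L (-1)
              gcongr
              exact min_le_left _ _
          _ = |k| * jb k ^ s * (jb L ^ (-1 : ℝ) * jb L ^ (3 / 4 : ℝ)) := by ring
          _ = _ := by rw [← Real.rpow_add (jb_pos L)]; norm_num
      refine (hw.trans h).trans ?_
      gcongr
      linarith
    -- The spare factor ⟨L⟩^{-3/4} is square integrable and later takes L² in τ to L¹.
    · have hw : |k| * jb L ^ (-1 : ℝ) * jb k ^ s =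
          jb L ^ (-(3 / 4) : ℝ) * (|k| * jb k ^ s * jb L ^ (-(1 / 4) : ℝ)) := by
        rw [show (-1 : ℝ) = -(3 / 4) + -(1 / 4) by norm_num, Real.rpow_add (jb_pos L)]; ring
      rw [hw, mul_add, mul_left_comm]
      have := mul_le_mul_of_nonneg_left h (jb_rpow_pos L (-(3 / 4))).le
      have := mul_nonneg hD.le n₂
      linarith
  · obtain ⟨ha, r, hr, hb⟩ := h
    constructor
    · rw [ea, mul_add]
      rcases ha with ha | ⟨h0, ha⟩
      · refine (Real.exp_le_exp.2 ha).trans ?_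
        have hr : Real.exp (logRho s (Real.log |k|) (Real.log (jb k))) ≤
            rho s k + rho s k₁ + rho s k₂ := exists_rho_eq hk h₁ h₂ (Or.inl rfl)
        rw [add_assoc, add_assoc, Real.exp_add, Real.exp_add, Real.exp_add, ← weight_eq,
          ← jb_rpow_eq]
        refine le_add_of_le_of_nonneg (mul_le_mul_of_nonneg_left (le_trans
          (mul_le_mul_of_nonneg_right hr (by positivity)) ?_) hD.le) (by positivity)
        have := highFreq_nonneg k₁
        have := highFreq_nonneg k₂
        have := jb_pos L
        have := jb_pos L₁
        have := jb_pos L₂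
        have := jb_pos k₁
        unfold strongSum
        refine le_add_of_le_of_nonneg (le_add_of_le_of_nonneg (le_add_of_le_of_nonneg
          (le_add_of_le_of_nonneg le_rfl ?_) ?_) ?_) ?_ <;> positivity
      · refine (Real.exp_le_exp.2 ha).trans ?_
        rw [highFreq_of_log_nonneg hk h0]
        rw [show ∀ a b c d f : ℝ, a - 3 / 4 * b - 3 / 4 * c + d + f =
          a + ((-(3 / 4) * b + -(3 / 4) * c) + (d + f)) by intros; ring, Real.exp_add, Real.exp_add,
          Real.exp_add, Real.exp_add, ← weight_eq, ← weight_eq, ← jb_rpow_eq, ← jb_rpow_eq, one_mul]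
        exact le_add_of_nonneg_left (by positivity)
    · have hr := exists_rho_eq hk h₁ h₂ hr
      have eb : |k| * jb L ^ (-1 : ℝ) * jb k ^ s =
          Real.exp (Real.log |k| + s * Real.log (jb k) - Real.log (jb L)) := by
        conv_lhs => rw [← Real.exp_log (abs_pos.2 hk), jb_rpow_eq, jb_rpow_eq, ← Real.exp_add,
          ← Real.exp_add]
        ring_nf
      rw [eb, mul_add]
      refine (Real.exp_le_exp.2 hb).trans ?_
      rw [add_assoc, add_assoc, Real.exp_add, Real.exp_add, Real.exp_add, ← jb_rpow_eq,
        ← jb_rpow_eq]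
      have := jb_pos L
      refine le_add_of_nonneg_of_le ?_ (mul_le_mul_of_nonneg_left
        (mul_le_mul_of_nonneg_right hr (by positivity)) hD.le)
      positivity

end

/-! ### Cauchy-Schwarz, Young and Minkowski inequalities for nonnegative functions. -/

theorem lintegral_mul_le_sqrt {α : Type*} [MeasurableSpace α] {μ : Measure α} {f g : α → ℝ≥0∞}
    (hf : AEMeasurable f μ) (hg : AEMeasurable g μ) :
    ∫⁻ a, f a * g a ∂μ ≤ (∫⁻ a, f a ^ 2 ∂μ) ^ (1 / 2 : ℝ) * (∫⁻ a, g a ^ 2 ∂μ) ^ (1 / 2 : ℝ) := by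
  have := ENNReal.lintegral_mul_le_Lp_mul_Lq μ Real.HolderConjugate.two_two hf hg
  simpa using this

theorem rpow_half_sq (x : ℝ≥0∞) : (x ^ (1 / 2 : ℝ)) ^ 2 = x := by
  rw [← ENNReal.rpow_natCast, ← ENNReal.rpow_mul]; norm_num

theorem sq_rpow_half (x : ℝ≥0∞) : (x ^ 2) ^ (1 / 2 : ℝ) = x := by
  rw [← ENNReal.rpow_natCast, ← ENNReal.rpow_mul]; norm_num

theorem sq_lintegral_mul_le {α : Type*} [MeasurableSpace α] {μ : Measure α} {f g : α → ℝ≥0∞}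
    (hf : AEMeasurable f μ) (hg : AEMeasurable g μ) :
    (∫⁻ a, f a * g a ∂μ) ^ 2 ≤ (∫⁻ a, f a ^ 2 ∂μ) * (∫⁻ a, g a ^ 2 ∂μ) := by
  have := pow_le_pow_left' (lintegral_mul_le_sqrt hf hg) 2
  rwa [mul_pow, rpow_half_sq, rpow_half_sq] at this

section Group

variable {G : Type*} [AddCommGroup G] [MeasurableSpace G] [MeasurableAdd₂ G] [MeasurableNeg G]
  {μ : Measure G} [SFinite μ] [μ.IsAddLeftInvariant] [μ.IsNegInvariant]
  {K : G → G → ℝ≥0∞} {f g : G → ℝ≥0∞} {A : ℝ≥0∞}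

omit [μ.IsNegInvariant] in
-- Cauchy-Schwarz in `y` at a fixed output point, with the kernel alone in one factor; Tonelli and
-- translation invariance finish.
theorem lintegral_sq_kernel_le_of_output (hK : Measurable (Function.uncurry K)) (hf : Measurable f)
    (hg : Measurable g) (hA : ∀ x, ∫⁻ y, K x y ^ 2 ∂μ ≤ A) :
    ∫⁻ x, (∫⁻ y, K x y * (f y * g (x - y)) ∂μ) ^ 2 ∂μ ≤
      A * ((∫⁻ y, f y ^ 2 ∂μ) * ∫⁻ y, g y ^ 2 ∂μ) := by
  have hfg : Measurable fun p : G × G => (f p.2 * g (p.1 - p.2)) ^ 2 := by fun_prop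
  calc ∫⁻ x, (∫⁻ y, K x y * (f y * g (x - y)) ∂μ) ^ 2 ∂μ
      ≤ ∫⁻ x, A * ∫⁻ y, (f y * g (x - y)) ^ 2 ∂μ ∂μ := by
        refine lintegral_mono fun x => ?_
        refine (sq_lintegral_mul_le (hK.of_uncurry_left).aemeasurable ?_).trans ?_
        · exact Measurable.aemeasurable (by fun_prop)
        · gcongr; exact hA x
    _ = A * ∫⁻ x, ∫⁻ y, (f y * g (x - y)) ^ 2 ∂μ ∂μ :=
        lintegral_const_mul _ hfg.lintegral_prod_right'
    _ = A * ∫⁻ y, ∫⁻ x, (f y * g (x - y)) ^ 2 ∂μ ∂μ := by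
        rw [lintegral_lintegral_swap hfg.aemeasurable]
    _ = A * ((∫⁻ y, f y ^ 2 ∂μ) * ∫⁻ y, g y ^ 2 ∂μ) := by
        congr 1
        rw [← lintegral_mul_const _ (by fun_prop)]
        refine lintegral_congr fun y => ?_
        simp_rw [mul_pow]
        rw [lintegral_const_mul _ (by fun_prop), lintegral_sub_right_eq_self (fun x => g x ^ 2) y]

/-- Here the kernel is grouped with `f` before Cauchy-Schwarz, so that its square is integrated over
the output variable. -/
theorem lintegral_sq_kernel_le_of_left (hK : Measurable (Function.uncurry K)) (hf : Measurable f)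
    (hg : Measurable g) (hA : ∀ y, ∫⁻ x, K x y ^ 2 ∂μ ≤ A) :
    ∫⁻ x, (∫⁻ y, K x y * (f y * g (x - y)) ∂μ) ^ 2 ∂μ ≤
      A * ((∫⁻ y, f y ^ 2 ∂μ) * ∫⁻ y, g y ^ 2 ∂μ) := by
  have hKf : Measurable fun p : G × G => (K p.1 p.2 * f p.2) ^ 2 :=
    (hK.mul (hf.comp measurable_snd)).pow_const 2
  calc ∫⁻ x, (∫⁻ y, K x y * (f y * g (x - y)) ∂μ) ^ 2 ∂μ
      ≤ ∫⁻ x, (∫⁻ y, (K x y * f y) ^ 2 ∂μ) * ∫⁻ y, g y ^ 2 ∂μ ∂μ := by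
        refine lintegral_mono fun x => ?_
        simp_rw [← mul_assoc]
        refine (sq_lintegral_mul_le (hK.of_uncurry_left.mul hf).aemeasurable
          (Measurable.aemeasurable (by fun_prop))).trans ?_
        rw [lintegral_sub_left_eq_self (fun x => g x ^ 2) x]
        rfl
    _ = (∫⁻ x, ∫⁻ y, (K x y * f y) ^ 2 ∂μ ∂μ) * ∫⁻ y, g y ^ 2 ∂μ :=
        lintegral_mul_const _ hKf.lintegral_prod_right'
    _ = (∫⁻ y, ∫⁻ x, (K x y * f y) ^ 2 ∂μ ∂μ) * ∫⁻ y, g y ^ 2 ∂μ := by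
        rw [lintegral_lintegral_swap hKf.aemeasurable]
    _ ≤ (∫⁻ y, A * f y ^ 2 ∂μ) * ∫⁻ y, g y ^ 2 ∂μ := by
        gcongr with y
        simp_rw [mul_pow]
        rw [lintegral_mul_const _ (hK.of_uncurry_right.pow_const 2)]
        gcongr
        exact hA y
    _ = _ := by rw [lintegral_const_mul _ (by fun_prop), mul_assoc]

omit [SFinite μ] in
theorem lintegral_kernel_swap (K : G → G → ℝ≥0∞) (f g : G → ℝ≥0∞) (x : G) :
    ∫⁻ y, K x y * (f y * g (x - y)) ∂μ = ∫⁻ y, K x (x - y) * (g y * f (x - y)) ∂μ := by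
  rw [← lintegral_sub_left_eq_self _ x]
  refine lintegral_congr fun y => ?_
  rw [sub_sub_cancel, mul_comm (f _)]

theorem lintegral_sq_kernel_le_of_right (hK : Measurable (Function.uncurry K)) (hf : Measurable f)
    (hg : Measurable g) (hA : ∀ y, ∫⁻ x, K x (x - y) ^ 2 ∂μ ≤ A) :
    ∫⁻ x, (∫⁻ y, K x y * (f y * g (x - y)) ∂μ) ^ 2 ∂μ ≤
      A * ((∫⁻ y, f y ^ 2 ∂μ) * ∫⁻ y, g y ^ 2 ∂μ) := by
  simp_rw [lintegral_kernel_swap K f g]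
  rw [mul_comm (∫⁻ y, f y ^ 2 ∂μ)]
  refine lintegral_sq_kernel_le_of_left (K := fun x y => K x (x - y)) ?_ hg hf hA
  exact hK.comp (measurable_fst.prodMk (measurable_fst.sub measurable_snd))

/-- Young's inequality `L² * L¹ ⊂ L²`. -/
theorem lintegral_sq_conv_le (hf : Measurable f) (hg : Measurable g) :
    ∫⁻ x, (∫⁻ y, f y * g (x - y) ∂μ) ^ 2 ∂μ ≤ (∫⁻ y, f y ^ 2 ∂μ) * (∫⁻ y, g y ∂μ) ^ 2 := by
  have hfg : Measurable fun p : G × G => f p.2 ^ 2 * g (p.1 - p.2) := by fun_prop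
  have hs (t : ℝ≥0∞) : t = t ^ (1 / 2 : ℝ) * t ^ (1 / 2 : ℝ) := by
    rw [← sq, rpow_half_sq]
  calc ∫⁻ x, (∫⁻ y, f y * g (x - y) ∂μ) ^ 2 ∂μ
      ≤ ∫⁻ x, (∫⁻ y, f y ^ 2 * g (x - y) ∂μ) * ∫⁻ y, g y ∂μ ∂μ := by
        refine lintegral_mono fun x => ?_
        have e : ∀ y, f y * g (x - y) =
            (f y * g (x - y) ^ (1 / 2 : ℝ)) * g (x - y) ^ (1 / 2 : ℝ) := fun y => by
          rw [mul_assoc, ← hs]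
        simp_rw [e]
        refine (sq_lintegral_mul_le (Measurable.aemeasurable (by fun_prop))
          (Measurable.aemeasurable (by fun_prop))).trans ?_
        simp_rw [mul_pow, rpow_half_sq]
        rw [lintegral_sub_left_eq_self g x]
    _ = (∫⁻ x, ∫⁻ y, f y ^ 2 * g (x - y) ∂μ ∂μ) * ∫⁻ y, g y ∂μ :=
        lintegral_mul_const _ hfg.lintegral_prod_right'
    _ = (∫⁻ y, ∫⁻ x, f y ^ 2 * g (x - y) ∂μ ∂μ) * ∫⁻ y, g y ∂μ := by
        rw [lintegral_lintegral_swap hfg.aemeasurable]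
    _ = _ := by
        have e (y : G) : ∫⁻ x, f y ^ 2 * g (x - y) ∂μ = f y ^ 2 * ∫⁻ x, g x ∂μ := by
          rw [lintegral_const_mul _ (by fun_prop), lintegral_sub_right_eq_self g y]
        simp_rw [e]
        rw [lintegral_mul_const _ (by fun_prop), sq, mul_assoc]

omit [SFinite μ] in
theorem lintegral_conv_comm (f g : G → ℝ≥0∞) (x : G) :
    ∫⁻ y, f y * g (x - y) ∂μ = ∫⁻ y, g y * f (x - y) ∂μ := by
  simpa using lintegral_kernel_swap (μ := μ) (fun _ _ => 1) f g x

omit [μ.IsNegInvariant] in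
theorem lintegral_conv (hf : Measurable f) (hg : Measurable g) :
    ∫⁻ x, ∫⁻ y, f y * g (x - y) ∂μ ∂μ = (∫⁻ y, f y ∂μ) * ∫⁻ y, g y ∂μ := by
  rw [lintegral_lintegral_swap (Measurable.aemeasurable (by fun_prop))]
  have e (y : G) : ∫⁻ x, f y * g (x - y) ∂μ = f y * ∫⁻ x, g x ∂μ := by
    rw [lintegral_const_mul _ (by fun_prop), lintegral_sub_right_eq_self g y]
  simp_rw [e]
  rw [lintegral_mul_const _ (by fun_prop)]

omit [SFinite μ] in
theorem sq_conv_le (hf : Measurable f) (hg : Measurable g) (x : G) :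
    (∫⁻ y, f y * g (x - y) ∂μ) ^ 2 ≤ (∫⁻ y, f y ^ 2 ∂μ) * ∫⁻ y, g y ^ 2 ∂μ := by
  refine (sq_lintegral_mul_le hf.aemeasurable (Measurable.aemeasurable (by fun_prop))).trans ?_
  rw [lintegral_sub_left_eq_self (fun x => g x ^ 2) x]

end Group

/-- Minkowski's integral inequality in `L²`. -/
theorem lintegral_sq_lintegral_le {α γ : Type*} [MeasurableSpace α] [MeasurableSpace γ]
    {μ : Measure α} {ν : Measure γ} [SFinite μ] [SFinite ν] {h : γ → α → ℝ≥0∞} {c : γ → ℝ≥0∞}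
    (hh : Measurable (Function.uncurry h)) (hc : Measurable c)
    (hle : ∀ m, ∫⁻ t, h m t ^ 2 ∂μ ≤ c m ^ 2) :
    ∫⁻ t, (∫⁻ m, h m t ∂ν) ^ 2 ∂μ ≤ (∫⁻ m, c m ∂ν) ^ 2 := by
  have hm (t : α) : Measurable fun m => h m t := hh.of_uncurry_right
  have ht (m : γ) : Measurable (h m) := hh.of_uncurry_left
  -- The square is written as a double integral in the parameters, and Cauchy-Schwarz in `t` is
  -- applied to each pair.
  have e (t : α) : (∫⁻ m, h m t ∂ν) ^ 2 = ∫⁻ m, ∫⁻ m', h m t * h m' t ∂ν ∂ν := by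
    rw [sq, ← lintegral_mul_const _ (hm t)]
    exact lintegral_congr fun m => (lintegral_const_mul _ (hm t)).symm
  have h3 : Measurable fun p : (α × γ) × γ => h p.1.2 p.1.1 * h p.2 p.1.1 :=
    (hh.comp ((measurable_snd.comp measurable_fst).prodMk (measurable_fst.comp measurable_fst))).mul
      (hh.comp (measurable_snd.prodMk (measurable_fst.comp measurable_fst)))
  have e2 (m m' : γ) : ∫⁻ t, h m t * h m' t ∂μ ≤ c m * c m' := by
    refine (lintegral_mul_le_sqrt (ht m).aemeasurable (ht m').aemeasurable).trans ?_
    have a := ENNReal.rpow_le_rpow (hle m) (z := 1 / 2) (by norm_num)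
    have b := ENNReal.rpow_le_rpow (hle m') (z := 1 / 2) (by norm_num)
    rw [sq_rpow_half] at a b
    gcongr
  calc ∫⁻ t, (∫⁻ m, h m t ∂ν) ^ 2 ∂μ = ∫⁻ t, ∫⁻ m, ∫⁻ m', h m t * h m' t ∂ν ∂ν ∂μ :=
        lintegral_congr e
    _ = ∫⁻ m, ∫⁻ t, ∫⁻ m', h m t * h m' t ∂ν ∂μ ∂ν :=
        lintegral_lintegral_swap h3.lintegral_prod_right'.aemeasurable
    _ = ∫⁻ m, ∫⁻ m', ∫⁻ t, h m t * h m' t ∂μ ∂ν ∂ν := by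
        refine lintegral_congr fun m => lintegral_lintegral_swap ?_
        exact (h3.comp ((measurable_fst.prodMk measurable_const).prodMk
          measurable_snd)).aemeasurable (f := fun p : α × γ => h m p.1 * h p.2 p.1)
    _ ≤ ∫⁻ m, ∫⁻ m', c m * c m' ∂ν ∂ν := by gcongr with m m'; exact e2 m m'
    _ = _ := by
        rw [sq, ← lintegral_mul_const _ hc]
        exact lintegral_congr fun m => lintegral_const_mul _ hc

/-! ### The frequency lattice and sums bounded uniformly in λ. -/

/-- The measure `(1/lam) ∑ δ_n` on the frequencies. -/
def freqMeasure (lam : ℝ) : Measure ℤ := ENNReal.ofReal lam⁻¹ • Measure.count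

theorem lintegral_freqMeasure (lam : ℝ) (f : ℤ → ℝ≥0∞) :
    ∫⁻ n, f n ∂freqMeasure lam = ENNReal.ofReal lam⁻¹ * ∑' n, f n := by
  rw [freqMeasure, lintegral_smul_measure, lintegral_count, smul_eq_mul]

instance sFinite_freqMeasure (lam : ℝ) : SFinite (freqMeasure lam) := by
  unfold freqMeasure; infer_instance

instance isAddLeftInvariant_freqMeasure (lam : ℝ) : (freqMeasure lam).IsAddLeftInvariant := by
  unfold freqMeasure; infer_instance

instance isNegInvariant_freqMeasure (lam : ℝ) : (freqMeasure lam).IsNegInvariant := by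
  unfold freqMeasure
  refine ⟨?_⟩
  rw [Measure.neg, Measure.map_smul]
  congr 1
  ext s hs
  rw [Measure.map_apply measurable_neg hs, Measure.count_apply hs,
    Measure.count_apply (measurable_neg hs)]
  exact congrArg _ (Set.encard_preimage_of_bijective (Equiv.neg ℤ).bijective s)

instance isNegInvariant_prod {G H : Type*} [AddCommGroup G] [MeasurableSpace G]
    [MeasurableNeg G] [AddCommGroup H] [MeasurableSpace H] [MeasurableNeg H] (μ : Measure G) (ν : Measure H) [SFinite μ] [SFinite ν]
    [μ.IsNegInvariant] [ν.IsNegInvariant] : (μ.prod ν).IsNegInvariant := by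
  refine ⟨?_⟩
  have := Measure.map_prod_map μ ν measurable_neg measurable_neg
  rw [Measure.map_neg_eq_self, Measure.map_neg_eq_self] at this
  exact this.symm

theorem measurable_prod_int {α : Type*} [MeasurableSpace α] {f : ℤ → ℝ → α}
    (hf : ∀ n, Measurable (f n)) : Measurable fun p : ℤ × ℝ => f p.1 p.2 :=
  measurable_from_prod_countable_right hf

/-- A right-endpoint Riemann sum of a decreasing function lies below its integral. -/
theorem tsum_nat_le_lintegral {F : ℝ → ℝ≥0∞} (hF : AntitoneOn F (Set.Ioi 0)) {c : ℝ} (hc : 0 < c) :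
    ENNReal.ofReal c * ∑' n : ℕ, F (c * (n + 1)) ≤ ∫⁻ x in Set.Ioi 0, F x := by
  have key (N : ℕ) : ∑ n ∈ Finset.range N, ENNReal.ofReal c * F (c * (n + 1)) ≤
      ∫⁻ x in Set.Ioc 0 (c * N), F x := by
    induction N with
    | zero => simp
    | succ N ih =>
      have hu : Set.Ioc 0 (c * ((N + 1 : ℕ) : ℝ)) =
          Set.Ioc 0 (c * N) ∪ Set.Ioc (c * N) (c * ((N + 1 : ℕ) : ℝ)) := by
        refine (Set.Ioc_union_Ioc_eq_Ioc (by positivity) ?_).symm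
        gcongr; simp
      rw [Finset.sum_range_succ, hu, lintegral_union measurableSet_Ioc
        (Set.Ioc_disjoint_Ioc_of_le le_rfl)]
      refine add_le_add ih ?_
      calc ENNReal.ofReal c * F (c * (N + 1))
          = ∫⁻ _ in Set.Ioc (c * N) (c * ((N + 1 : ℕ) : ℝ)), F (c * (N + 1)) := by
            rw [setLIntegral_const, Real.volume_Ioc, mul_comm]
            congr 2; push_cast; ring
        _ ≤ _ := by
            refine setLIntegral_mono' measurableSet_Ioc fun x hx => ?_
            have h0 : 0 < x := lt_of_le_of_lt (by positivity) hx.1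
            refine hF h0 (Set.mem_Ioi.2 (by positivity)) ?_
            have := hx.2
            push_cast at this
            exact this
  rw [← ENNReal.tsum_mul_left, ENNReal.tsum_eq_iSup_nat]
  refine iSup_le fun N => (key N).trans ?_
  exact lintegral_mono_set fun x hx => hx.1

/-- The zero frequency has mass 1/λ ≤ 1 and is counted separately. Monotonicity is asked only on the
open half line, so that `F` may blow up at 0. -/
theorem tsum_int_le_lintegral {F : ℝ → ℝ≥0∞} (hF : AntitoneOn F (Set.Ioi 0)) {lam : ℝ}
    (hlam : 1 ≤ lam) :
    ENNReal.ofReal lam⁻¹ * ∑' n : ℤ, F |freq lam n| ≤ F 0 + 2 * ∫⁻ x in Set.Ioi 0, F x := by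
  have h0 : 0 < lam := by linarith
  have hn := tsum_nat_le_lintegral hF (inv_pos.2 h0)
  rw [tsum_of_add_one_of_neg_add_one ENNReal.summable ENNReal.summable, mul_add, mul_add]
  have e1 (n : ℕ) : |freq lam ((n : ℤ) + 1)| = lam⁻¹ * (n + 1) := by
    rw [freq, abs_of_nonneg (by push_cast; positivity)]; push_cast; ring
  have e2 (n : ℕ) : |freq lam (-((n : ℤ) + 1))| = lam⁻¹ * (n + 1) := by
    rw [← e1, freq, freq, Int.cast_neg, neg_div, abs_neg]
  have e3 : |freq lam 0| = 0 := by simp [freq]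
  simp_rw [e1, e2, e3]
  have h1 : ENNReal.ofReal lam⁻¹ * F 0 ≤ F 0 := by
    refine mul_le_of_le_one_left' ?_
    rw [ENNReal.ofReal_le_one]
    exact inv_le_one_of_one_le₀ hlam
  calc _ ≤ (∫⁻ x in Set.Ioi 0, F x) + F 0 + ∫⁻ x in Set.Ioi 0, F x := by gcongr
    _ = _ := by ring

theorem jb_rpow_anti {x y p : ℝ} (h : |x| ≤ |y|) (hp : p ≤ 0) : jb y ^ p ≤ jb x ^ p := by
  refine Real.rpow_le_rpow_of_nonpos (jb_pos x) ?_ hp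
  exact Real.sqrt_le_sqrt (by have := sq_le_sq.2 h; linarith)

/-- The integral `∫ ⟨x⟩^{-p} dx`. -/
def jbIntegral (p : ℝ) : ℝ≥0∞ := ∫⁻ x : ℝ, ENNReal.ofReal (jb x ^ (-p))

theorem jbIntegral_lt_top {p : ℝ} (hp : 1 < p) : jbIntegral p < ∞ := by
  have h := integrable_rpow_neg_one_add_norm_sq (E := ℝ) (μ := volume) (r := p) (by simpa using hp)
  have e : (fun x : ℝ => (1 + ‖x‖ ^ 2) ^ (-p / 2)) = fun x => jb x ^ (-p) := by
    ext x
    rw [jb, Real.sqrt_eq_rpow, ← Real.rpow_mul (by positivity), Real.norm_eq_abs, sq_abs]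
    ring_nf
  rw [e] at h
  exact h.lintegral_lt_top

theorem tsum_jb_le {lam p : ℝ} (hlam : 1 ≤ lam) (hp : 0 ≤ p) :
    ENNReal.ofReal lam⁻¹ * ∑' n : ℤ, ENNReal.ofReal (jb (freq lam n) ^ (-p)) ≤
      1 + 2 * jbIntegral p := by
  have hF : AntitoneOn (fun x : ℝ => ENNReal.ofReal (jb x ^ (-p))) (Set.Ioi 0) := by
    intro x hx y hy hxy
    refine ENNReal.ofReal_le_ofReal (jb_rpow_anti ?_ (by linarith))
    rwa [abs_of_pos hx, abs_of_pos hy]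
  have h := tsum_int_le_lintegral hF hlam
  have e (x : ℝ) : jb |x| = jb x := by simp [jb]
  simp only [e] at h
  refine h.trans (add_le_add ?_ ?_)
  · simp [jb]
  · gcongr
    exact setLIntegral_le_lintegral _ _

theorem tsum_jb_two_mul_sub_le {lam p : ℝ} (hlam : 1 ≤ lam) (hp : 0 ≤ p) (n : ℤ) :
    ENNReal.ofReal lam⁻¹ * ∑' m : ℤ, ENNReal.ofReal (jb (freq lam (2 * m - n)) ^ (-p)) ≤
      1 + 2 * jbIntegral p := by
  refine le_trans (mul_le_mul' le_rfl ?_) (tsum_jb_le hlam hp)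
  refine ENNReal.tsum_comp_le_tsum_of_injective (f := fun m : ℤ => 2 * m - n) ?_
    (fun m => ENNReal.ofReal (jb (freq lam m) ^ (-p)))
  intro x y hxy
  simp only at hxy
  omega

/-- ρ² is |k|^{-(s+2)}⟨k⟩^{-3/4}, even and decreasing in |k|, so its lattice sums are controlled by
an integral independent of λ. -/
theorem exists_tsum_sq_rho_le {s : ℝ} (hs₁ : -3 / 2 ≤ s) (hs₂ : s < -1) :
    ∃ A : ℝ≥0∞, A < ∞ ∧ ∀ lam : ℝ, 1 ≤ lam →
      ∫⁻ n, ENNReal.ofReal (rho s (freq lam n)) ^ 2 ∂freqMeasure lam ≤ A := by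
  set F : ℝ → ℝ≥0∞ := fun x => ENNReal.ofReal (rho s x) ^ 2 with hFdef
  have hr (x : ℝ) (hx : 0 < x) : rho s x = x ^ (-(s / 2 + 1)) * jb x ^ (-(3 / 8) : ℝ) := by
    rw [rho, abs_of_pos hx]
  have hF : AntitoneOn F (Set.Ioi 0) := by
    intro x hx y hy hxy
    rw [Set.mem_Ioi] at hx hy
    have h1 := Real.rpow_le_rpow_of_nonpos hx hxy (show -(s / 2 + 1) ≤ 0 by linarith)
    have h2 : jb y ^ (-(3 / 8) : ℝ) ≤ jb x ^ (-(3 / 8) : ℝ) :=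
      jb_rpow_anti (by rwa [abs_of_pos hx, abs_of_pos hy]) (by norm_num)
    have h3 := jb_rpow_pos y (-(3 / 8))
    have h4 := Real.rpow_nonneg hx.le (-(s / 2 + 1))
    simp only [hFdef, hr x hx, hr y hy]
    gcongr
  -- The value at 0 is finite because real powers are total; the singularity is seen only by the
  -- integral.
  have hF0 : F 0 < ∞ := by simp [hFdef, ENNReal.ofReal_lt_top]
  have hsq (x : ℝ) (hx : 0 < x) :
      F x = ENNReal.ofReal (x ^ (-(s + 2)) * jb x ^ (-(3 / 4) : ℝ)) := by
    rw [hFdef]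
    simp only
    rw [← ENNReal.ofReal_pow (rho_nonneg s x), hr x hx, mul_pow, ← Real.rpow_natCast (x ^ _),
      ← Real.rpow_mul hx.le, ← Real.rpow_natCast (jb x ^ _), ← Real.rpow_mul (jb_pos x).le]
    ring_nf
  have hI1 : ∫⁻ x in Set.Ioo (0 : ℝ) 2, F x < ∞ := by
    -- Integrability at 0 means -(s + 2) > -1. This is where the strict inequality s < -1 is needed.
    have h := (intervalIntegral.integrableOn_Ioo_rpow_iff (s := -(s + 2)) two_pos).2 (by linarith)
    refine lt_of_le_of_lt (setLIntegral_mono' measurableSet_Ioo fun x hx => ?_) h.lintegral_lt_top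
    rw [hsq x hx.1]
    refine ENNReal.ofReal_le_ofReal (mul_le_of_le_one_right (Real.rpow_nonneg hx.1.le _) ?_)
    exact Real.rpow_le_one_of_one_le_of_nonpos (one_le_jb x) (by norm_num)
  have hI2 : ∫⁻ x in Set.Ioi (1 : ℝ), F x < ∞ := by
    -- Decay at infinity needs s > -7/4, which s ≥ -3/2 guarantees.
    have h := integrableOn_Ioi_rpow_of_lt (a := -(s + 2) + -(3 / 4)) (by linarith) one_pos
    refine lt_of_le_of_lt (setLIntegral_mono' measurableSet_Ioi fun x hx => ?_) h.lintegral_lt_top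
    have hx0 : 0 < x := one_pos.trans hx
    rw [hsq x hx0, Real.rpow_add hx0]
    refine ENNReal.ofReal_le_ofReal (mul_le_mul_of_nonneg_left ?_ (Real.rpow_nonneg hx0.le _))
    exact Real.rpow_le_rpow_of_nonpos hx0 ((le_abs_self x).trans (abs_le_jb x)) (by norm_num)
  refine ⟨F 0 + 2 * ∫⁻ x in Set.Ioi 0, F x, ?_, fun lam hlam => ?_⟩
  · have hI : ∫⁻ x in Set.Ioi 0, F x < ∞ := by
      refine lt_of_le_of_lt ((lintegral_mono_set (t := Set.Ioo (0 : ℝ) 2 ∪ Set.Ioi 1)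
        fun x hx => ?_).trans (lintegral_union_le _ _ _)) (ENNReal.add_lt_top.2 ⟨hI1, hI2⟩)
      rcases lt_or_ge 1 x with h | h
      · exact Or.inr h
      · exact Or.inl ⟨hx, by linarith⟩
    exact ENNReal.add_lt_top.2 ⟨hF0, ENNReal.mul_lt_top (by simp) hI⟩
  · rw [lintegral_freqMeasure]
    have h := tsum_int_le_lintegral hF hlam
    have e (x : ℝ) : F |x| = F x := by simp [hFdef, rho, jb]
    simp only [e] at h
    exact h

/-! ### Counting frequencies near a level set of a difference of the dispersion relation. -/

/-- The difference of the dispersion relation at two points `(y ± κ) / 2`. -/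
def dispDiff (lam β κ y : ℝ) : ℝ := disp lam β ((y + κ) / 2) - disp lam β ((y - κ) / 2)

theorem dispDiff_neg (lam β κ y : ℝ) : dispDiff lam β κ (-y) = dispDiff lam β κ y := by
  simp only [dispDiff, disp]; ring

theorem disp_neg (lam β k : ℝ) : disp lam β (-k) = -disp lam β k := by
  simp only [disp]; ring

/-- The difference factors through κ(y - y')(y + y') times a quadratic form. The β term is absorbed
by the positive terms in κ² and y'², which are at least 1. -/
theorem abs_dispDiff_sub_ge {lam β κ y y' : ℝ} (hlam : 1 ≤ lam) (hβ : |β| ≤ 1) (hκ : 1 ≤ |κ|)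
    (hy : 1 ≤ y) (hy' : 1 ≤ y') :
    |y - y'| * y ^ 3 / 8 ≤ |dispDiff lam β κ y - dispDiff lam β κ y'| := by
  have hb : |β * (lam ^ 2)⁻¹| ≤ 1 := by
    rw [abs_mul, abs_of_nonneg (by positivity : 0 ≤ (lam ^ 2)⁻¹)]
    exact mul_le_one₀ hβ (by positivity) (inv_le_one_of_one_le₀ (one_le_pow₀ hlam))
  set b := β * (lam ^ 2)⁻¹ with hbdef
  have hκ2 : 1 ≤ κ ^ 2 := by rw [← sq_abs]; exact one_le_pow₀ hκ
  have e : dispDiff lam β κ y - dispDiff lam β κ y' =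
      κ * (y - y') * ((y + y') * ((5 * (y ^ 2 + y' ^ 2) + 10 * κ ^ 2) / 16 + 3 * b / 4)) := by
    simp only [dispDiff, disp, ← hbdef]; ring
  obtain ⟨hb1, hb2⟩ := abs_le.1 hb
  have h1 : y ^ 2 / 8 ≤ (5 * (y ^ 2 + y' ^ 2) + 10 * κ ^ 2) / 16 + 3 * b / 4 := by nlinarith
  have h2 : y * (y ^ 2 / 8) ≤
      (y + y') * ((5 * (y ^ 2 + y' ^ 2) + 10 * κ ^ 2) / 16 + 3 * b / 4) :=
    mul_le_mul (by linarith) h1 (by positivity) (by linarith)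
  have h3 : 0 ≤ y * (y ^ 2 / 8) := by positivity
  rw [e, abs_mul, abs_mul, abs_of_nonneg (h3.trans h2)]
  calc |y - y'| * y ^ 3 / 8 = 1 * |y - y'| * (y * (y ^ 2 / 8)) := by ring
    _ ≤ _ := by gcongr

/-- If y' comes closest to the level a, the distance from a at y is at least half the gap between
the two values, hence at least |y - y'|y³/16. For |y - y'| ≥ 1 this gives y^{-3/2}; otherwise the
trivial bound 1 is absorbed by ⟨y - y'⟩^{-3/2}. -/
theorem jb_rpow_le_of_closest {lam β κ y y' a : ℝ} (hlam : 1 ≤ lam) (hβ : |β| ≤ 1)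
    (hκ : 1 ≤ |κ|) (hy : 1 ≤ y) (hy' : 1 ≤ y')
    (h : |a - dispDiff lam β κ y'| ≤ |a - dispDiff lam β κ y|) :
    jb (a - dispDiff lam β κ y) ^ (-(1 / 2) : ℝ) ≤
      16 * (jb (y - y') ^ (-(3 / 2) : ℝ) + jb y ^ (-(3 / 2) : ℝ)) := by
  have n1 := jb_rpow_pos (y - y') (-(3 / 2))
  have n2 := jb_rpow_pos y (-(3 / 2))
  have c2 : (1 / 4 : ℝ) ≤ 2 ^ (-(3 / 2) : ℝ) := by
    calc (1 / 4 : ℝ) = 2 ^ (-2 : ℝ) := by rw [Real.rpow_neg two_pos.le]; norm_num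
      _ ≤ _ := Real.rpow_le_rpow_of_exponent_le one_le_two (by norm_num)
  rcases le_total |y - y'| 1 with hc | hc
  · have h1 : jb (a - dispDiff lam β κ y) ^ (-(1 / 2) : ℝ) ≤ 1 :=
      Real.rpow_le_one_of_one_le_of_nonpos (one_le_jb _) (by norm_num)
    have h2 : (2 : ℝ) ^ (-(3 / 2) : ℝ) ≤ jb (y - y') ^ (-(3 / 2) : ℝ) :=
      Real.rpow_le_rpow_of_nonpos (jb_pos _) (by linarith [jb_le (y - y')]) (by norm_num)
    linarith
  · have h1 := abs_dispDiff_sub_ge hlam hβ hκ hy hy'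
    have h2 : |dispDiff lam β κ y - dispDiff lam β κ y'| ≤ 2 * |a - dispDiff lam β κ y| := by
      have := abs_sub (a - dispDiff lam β κ y') (a - dispDiff lam β κ y)
      rw [sub_sub_sub_cancel_left] at this
      linarith
    have h3 : y ^ 3 / 16 ≤ jb (a - dispDiff lam β κ y) := by
      refine le_trans ?_ (abs_le_jb _)
      have : 1 * y ^ 3 ≤ |y - y'| * y ^ 3 := by gcongr
      linarith
    have hy0 : 0 < y := by linarith
    have h4 : jb (a - dispDiff lam β κ y) ^ (-(1 / 2) : ℝ) ≤ 4 * y ^ (-(3 / 2) : ℝ) := by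
      refine (Real.rpow_le_rpow_of_nonpos (by positivity) h3 (by norm_num)).trans_eq ?_
      rw [Real.div_rpow (by positivity) (by norm_num), ← Real.rpow_natCast, ← Real.rpow_mul hy0.le,
        show (16 : ℝ) = 4 ^ (2 : ℝ) by norm_num, ← Real.rpow_mul (by norm_num)]
      norm_num
      ring
    have h5 : (2 * y) ^ (-(3 / 2) : ℝ) ≤ jb y ^ (-(3 / 2) : ℝ) := by
      refine Real.rpow_le_rpow_of_nonpos (jb_pos _) ?_ (by norm_num)
      have := jb_le y
      rw [abs_of_pos hy0] at this
      linarith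
    rw [Real.mul_rpow two_pos.le hy0.le] at h5
    have h6 := Real.rpow_pos_of_pos hy0 (-(3 / 2))
    nlinarith

/-- A closest point exists in each finite set of frequencies, so the bound is proved for finite sums
and passed to the supremum. -/
theorem tsum_jb_dispDiff_pos_le {lam β : ℝ} (hlam : 1 ≤ lam) (hβ : |β| ≤ 1) {n : ℤ}
    (hn : 1 ≤ |freq lam n|) (a : ℝ) (S : Set ℤ) (hS : ∀ m ∈ S, 1 ≤ freq lam (2 * m - n)) :
    ENNReal.ofReal lam⁻¹ * ∑' m : ℤ, S.indicator (fun m => ENNReal.ofReal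
      (jb (a - dispDiff lam β (freq lam n) (freq lam (2 * m - n))) ^ (-(1 / 2) : ℝ))) m ≤
      32 * (1 + 2 * jbIntegral (3 / 2)) := by
  have h0 : 0 < lam := by linarith
  classical
  rw [ENNReal.tsum_eq_iSup_sum, ENNReal.mul_iSup]
  refine iSup_le fun T => ?_
  simp only [Set.indicator_apply, ← Finset.sum_filter]
  set T' := T.filter (· ∈ S)
  rcases T'.eq_empty_or_nonempty with hT | hT
  · simp [hT]
  obtain ⟨m₀, hm₀, hmin⟩ := T'.exists_min_image
    (fun m => |a - dispDiff lam β (freq lam n) (freq lam (2 * m - n))|) hT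
  have hS₀ := hS m₀ (Finset.mem_filter.1 hm₀).2
  calc ENNReal.ofReal lam⁻¹ * ∑ m ∈ T', ENNReal.ofReal
        (jb (a - dispDiff lam β (freq lam n) (freq lam (2 * m - n))) ^ (-(1 / 2) : ℝ))
      ≤ ENNReal.ofReal lam⁻¹ * ∑ m ∈ T', 16 *
        (ENNReal.ofReal (jb (freq lam (m - m₀)) ^ (-(3 / 2) : ℝ)) +
          ENNReal.ofReal (jb (freq lam (2 * m - n)) ^ (-(3 / 2) : ℝ))) := by
        gcongr with m hm
        have := jb_rpow_le_of_closest hlam hβ hn (hS m (Finset.mem_filter.1 hm).2) hS₀ (hmin m hm)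
        rw [← ENNReal.ofReal_add (jb_rpow_pos _ _).le (jb_rpow_pos _ _).le,
          show (16 : ℝ≥0∞) = ENNReal.ofReal 16 by norm_num, ← ENNReal.ofReal_mul (by norm_num)]
        refine ENNReal.ofReal_le_ofReal (this.trans ?_)
        refine mul_le_mul_of_nonneg_left (add_le_add_left ?_ _) (by norm_num)
        refine jb_rpow_anti ?_ (by norm_num)
        have e : freq lam (2 * m - n) - freq lam (2 * m₀ - n) = 2 * freq lam (m - m₀) := by
          simp only [freq]; push_cast; ring
        rw [e, abs_mul, abs_two]
        linarith [abs_nonneg (freq lam (m - m₀))]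
    _ ≤ ENNReal.ofReal lam⁻¹ * ∑' m, 16 *
        (ENNReal.ofReal (jb (freq lam (m - m₀)) ^ (-(3 / 2) : ℝ)) +
          ENNReal.ofReal (jb (freq lam (2 * m - n)) ^ (-(3 / 2) : ℝ))) := by
        gcongr
        exact ENNReal.sum_le_tsum _
    _ = 16 * (ENNReal.ofReal lam⁻¹ * ∑' m, ENNReal.ofReal (jb (freq lam (m - m₀)) ^ (-(3 / 2) : ℝ))
        + ENNReal.ofReal lam⁻¹ *
          ∑' m, ENNReal.ofReal (jb (freq lam (2 * m - n)) ^ (-(3 / 2) : ℝ))) := by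
        rw [ENNReal.tsum_mul_left, ENNReal.tsum_add]; ring
    _ ≤ 16 * ((1 + 2 * jbIntegral (3 / 2)) + (1 + 2 * jbIntegral (3 / 2))) := by
        have h := tsum_jb_le (lam := lam) (p := 3 / 2) hlam (by norm_num)
        gcongr
        · refine le_trans (le_of_eq ?_) h
          congr 1
          exact (Equiv.subRight m₀).tsum_eq
            (fun m => ENNReal.ofReal (jb (freq lam m) ^ (-(3 / 2) : ℝ)))
        · exact tsum_jb_two_mul_sub_le hlam (by norm_num) n
    _ = _ := by ring

/-- The number of frequencies at which a resonance level is attained is bounded in average. -/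
theorem tsum_jb_dispDiff_le {lam β : ℝ} (hlam : 1 ≤ lam) (hβ : |β| ≤ 1) {n : ℤ}
    (hn : 1 ≤ |freq lam n|) (a : ℝ) :
    ENNReal.ofReal lam⁻¹ * ∑' m : ℤ, ENNReal.ofReal
      (jb (a - dispDiff lam β (freq lam n) (freq lam (2 * m - n))) ^ (-(1 / 2) : ℝ)) ≤
      68 * (1 + 2 * jbIntegral (3 / 2)) := by
  set f : ℤ → ℝ≥0∞ := fun m => ENNReal.ofReal
      (jb (a - dispDiff lam β (freq lam n) (freq lam (2 * m - n))) ^ (-(1 / 2) : ℝ)) with hf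
  set S : Set ℤ := {m | 1 ≤ freq lam (2 * m - n)}
  have hneg (m : ℤ) : freq lam (2 * (n - m) - n) = -freq lam (2 * m - n) := by
    simp only [freq]; push_cast; ring
  have hfs (m : ℤ) : f (n - m) = f m := by
    simp only [hf, hneg, dispDiff_neg]
  have hpos := tsum_jb_dispDiff_pos_le hlam hβ hn a S fun m hm => hm
  -- Points with y ≥ 1 are counted directly, points with y ≤ -1 by the reflection `m ↦ n - m`, and
  -- for |y| < 1 the term is at most 1. The constant 68 is 32 + 32 + 4.
  have hle (m : ℤ) : f m ≤ (S.indicator f m + S.indicator f (n - m)) +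
      4 * ENNReal.ofReal (jb (freq lam (2 * m - n)) ^ (-(3 / 2) : ℝ)) := by
    by_cases h1 : m ∈ S
    · rw [Set.indicator_of_mem h1, add_assoc]; exact le_self_add
    by_cases h2 : n - m ∈ S
    · rw [Set.indicator_of_mem h2, hfs, add_right_comm]; exact le_add_self
    have h1' : freq lam (2 * m - n) < 1 := not_le.1 h1
    have h2' : -freq lam (2 * m - n) < 1 := by rw [← hneg]; exact not_le.1 h2
    refine le_trans ?_ le_add_self
    have h3 : |freq lam (2 * m - n)| ≤ 1 := abs_le.2 ⟨by linarith, h1'.le⟩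
    have c2 : (1 / 4 : ℝ) ≤ 2 ^ (-(3 / 2) : ℝ) := by
      calc (1 / 4 : ℝ) = 2 ^ (-2 : ℝ) := by rw [Real.rpow_neg two_pos.le]; norm_num
        _ ≤ _ := Real.rpow_le_rpow_of_exponent_le one_le_two (by norm_num)
    have h4 : (2 : ℝ) ^ (-(3 / 2) : ℝ) ≤ jb (freq lam (2 * m - n)) ^ (-(3 / 2) : ℝ) :=
      Real.rpow_le_rpow_of_nonpos (jb_pos _) (by linarith [jb_le (freq lam (2 * m - n))])
        (by norm_num)
    rw [show (4 : ℝ≥0∞) = ENNReal.ofReal 4 by norm_num, ← ENNReal.ofReal_mul (by norm_num)]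
    refine ENNReal.ofReal_le_ofReal (le_trans (Real.rpow_le_one_of_one_le_of_nonpos (one_le_jb _)
      (by norm_num)) ?_)
    linarith
  calc ENNReal.ofReal lam⁻¹ * ∑' m, f m
      ≤ ENNReal.ofReal lam⁻¹ * ∑' m, ((S.indicator f m + S.indicator f (n - m)) +
      4 * ENNReal.ofReal (jb (freq lam (2 * m - n)) ^ (-(3 / 2) : ℝ))) := by
        gcongr with m; exact hle m
    _ = ENNReal.ofReal lam⁻¹ * ∑' m, S.indicator f m +
        ENNReal.ofReal lam⁻¹ * ∑' m, S.indicator f (n - m) + 4 * (ENNReal.ofReal lam⁻¹ *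
          ∑' m, ENNReal.ofReal (jb (freq lam (2 * m - n)) ^ (-(3 / 2) : ℝ))) := by
        rw [ENNReal.tsum_add, ENNReal.tsum_add, ENNReal.tsum_mul_left]; ring
    _ ≤ 32 * (1 + 2 * jbIntegral (3 / 2)) + 32 * (1 + 2 * jbIntegral (3 / 2)) +
        4 * (1 + 2 * jbIntegral (3 / 2)) := by
        refine add_le_add (add_le_add hpos ?_) ?_
        · exact (congrArg _ ((Equiv.subLeft n).tsum_eq (S.indicator f))).trans_le hpos
        · exact mul_le_mul' le_rfl (tsum_jb_two_mul_sub_le hlam (by norm_num) n)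
    _ = _ := by ring

/-! ### Bilinear estimates with the kernel ρ. -/

theorem add_sq_le_four_mul (x y : ℝ≥0∞) : (x + y) ^ 2 ≤ 4 * (x ^ 2 + y ^ 2) := by
  wlog h : x ≤ y generalizing x y
  · rw [add_comm x, add_comm (x ^ 2)]
    exact this y x (le_of_not_ge h)
  calc (x + y) ^ 2 ≤ (y + y) ^ 2 := by gcongr
    _ = 4 * y ^ 2 := by ring
    _ ≤ _ := by gcongr; exact le_add_self

/-- The squared norm of `L²` in frequency and time frequency. -/
def sqL2 (lam : ℝ) (f : ℤ → ℝ → ℝ≥0∞) : ℝ≥0∞ := ∫⁻ n, (∫⁻ τ, f n τ ^ 2) ∂freqMeasure lam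

/-- The squared norm of `L²` in frequency with values in `L¹` in time frequency. -/
def sqL1 (lam : ℝ) (f : ℤ → ℝ → ℝ≥0∞) : ℝ≥0∞ := ∫⁻ n, (∫⁻ τ, f n τ) ^ 2 ∂freqMeasure lam

/-- The kernel `ρ(k) + ρ(k₁) + ρ(k₂)`. -/
def rhoKernel (s lam : ℝ) (n m : ℤ) : ℝ≥0∞ :=
  ENNReal.ofReal (rho s (freq lam n)) + ENNReal.ofReal (rho s (freq lam m)) +
    ENNReal.ofReal (rho s (freq lam (n - m)))

theorem ofReal_rho_add (s lam : ℝ) (n m : ℤ) :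
    ENNReal.ofReal (rho s (freq lam n) + rho s (freq lam m) + rho s (freq lam (n - m))) =
      rhoKernel s lam n m := by
  rw [rhoKernel, ENNReal.ofReal_add (add_nonneg (rho_nonneg _ _) (rho_nonneg _ _))
    (rho_nonneg _ _), ENNReal.ofReal_add (rho_nonneg _ _) (rho_nonneg _ _)]

section

variable {s lam : ℝ} {A : ℝ≥0∞}
  (hA : ∫⁻ n, ENNReal.ofReal (rho s (freq lam n)) ^ 2 ∂freqMeasure lam ≤ A)

include hA

/-- Each summand depends on one frequency only: ρ(k) is summed over the output, ρ(k₁) and ρ(k₂) over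
the inner variable. The constant 36 is 4(4 · 2 + 1). -/
theorem lintegral_sq_rhoKernel_le (a b : ℤ → ℝ≥0∞) :
    ∫⁻ n, (∫⁻ m, rhoKernel s lam n m * (a m * b (n - m)) ∂freqMeasure lam) ^ 2 ∂freqMeasure lam ≤
      36 * A * ((∫⁻ n, a n ^ 2 ∂freqMeasure lam) * ∫⁻ n, b n ^ 2 ∂freqMeasure lam) := by
  set r : ℤ → ℝ≥0∞ := fun n => ENNReal.ofReal (rho s (freq lam n)) with hr
  have e (n : ℤ) : ∫⁻ m, rhoKernel s lam n m * (a m * b (n - m)) ∂freqMeasure lam =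
      ∫⁻ m, r n * (a m * b (n - m)) ∂freqMeasure lam +
      ∫⁻ m, r m * (a m * b (n - m)) ∂freqMeasure lam +
      ∫⁻ m, r (n - m) * (a m * b (n - m)) ∂freqMeasure lam := by
    simp only [rhoKernel, add_mul]
    rw [lintegral_add_left (by fun_prop), lintegral_add_left (by fun_prop)]
  have h1 := lintegral_sq_kernel_le_of_left (μ := freqMeasure lam) (K := fun n _ => r n)
    (f := a) (g := b) (by fun_prop) (by fun_prop) (by fun_prop) fun _ => hA
  have h2 := lintegral_sq_kernel_le_of_output (μ := freqMeasure lam) (K := fun _ m => r m)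
    (f := a) (g := b) (by fun_prop) (by fun_prop) (by fun_prop) fun _ => hA
  have h3 := lintegral_sq_kernel_le_of_output (μ := freqMeasure lam) (K := fun n m => r (n - m))
    (f := a) (g := b) (by fun_prop) (by fun_prop) (by fun_prop) (A := A) fun n => by
      rw [lintegral_sub_left_eq_self (fun x => r x ^ 2) n]; exact hA
  set N := (∫⁻ n, a n ^ 2 ∂freqMeasure lam) * ∫⁻ n, b n ^ 2 ∂freqMeasure lam
  calc _ ≤ ∫⁻ n, 4 * (4 * ((∫⁻ m, r n * (a m * b (n - m)) ∂freqMeasure lam) ^ 2 +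
        (∫⁻ m, r m * (a m * b (n - m)) ∂freqMeasure lam) ^ 2) +
        (∫⁻ m, r (n - m) * (a m * b (n - m)) ∂freqMeasure lam) ^ 2) ∂freqMeasure lam := by
        refine lintegral_mono fun n => ?_
        simp only [e]
        exact (add_sq_le_four_mul _ _).trans (by gcongr; exact add_sq_le_four_mul _ _)
    _ ≤ 4 * (4 * (A * N + A * N) + A * N) := by
        rw [lintegral_const_mul _ (by fun_prop), lintegral_add_left (by fun_prop),
          lintegral_const_mul _ (by fun_prop), lintegral_add_left (by fun_prop)]
        gcongr
    _ = _ := by ring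

/-- Minkowski's inequality in τ at each fixed output frequency reduces to the scalar estimate. -/
theorem lintegral_sq_rhoKernel_mixed_le {h : ℤ → ℤ → ℝ → ℝ≥0∞} {a b : ℤ → ℝ≥0∞}
    (hh : ∀ n m, Measurable (h n m))
    (hle : ∀ n m, ∫⁻ τ, h n m τ ^ 2 ≤ (a m * b (n - m)) ^ 2) :
    sqL2 lam (fun n τ => ∫⁻ m, rhoKernel s lam n m * h n m τ ∂freqMeasure lam) ≤
      36 * A * ((∫⁻ n, a n ^ 2 ∂freqMeasure lam) * ∫⁻ n, b n ^ 2 ∂freqMeasure lam) := by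
  refine le_trans (lintegral_mono fun n => ?_) (lintegral_sq_rhoKernel_le hA a b)
  refine lintegral_sq_lintegral_le (h := fun m τ => rhoKernel s lam n m * h n m τ)
    (measurable_prod_int fun m => (hh n m).const_mul _) (by fun_prop) fun m => ?_
  simp_rw [mul_pow _ (h _ _ _)]
  rw [lintegral_const_mul _ ((hh n m).pow_const 2), mul_pow]
  gcongr
  exact hle n m

end

section

variable {f g : ℤ → ℝ → ℝ≥0∞} (hf : ∀ n, Measurable (f n)) (hg : ∀ n, Measurable (g n))

include hf hg

theorem measurable_conv (n m : ℤ) : Measurable fun τ => ∫⁻ σ, f m σ * g (n - m) (τ - σ) := by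
  have h1 := hf m
  have h2 := hg (n - m)
  refine Measurable.lintegral_prod_right' (f := fun p : ℝ × ℝ => f m p.2 * g (n - m) (p.1 - p.2)) ?_
  fun_prop

section

variable {s lam : ℝ} {A : ℝ≥0∞}
  (hA : ∫⁻ n, ENNReal.ofReal (rho s (freq lam n)) ^ 2 ∂freqMeasure lam ≤ A)

include hA

theorem bilinear_rho_left :
    sqL2 lam (fun n τ => ∫⁻ m, rhoKernel s lam n m *
        (∫⁻ σ, f m σ * g (n - m) (τ - σ)) ∂freqMeasure lam) ≤ 36 * A * (sqL2 lam f *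
        sqL1 lam g) := by
  have h := lintegral_sq_rhoKernel_mixed_le hA
    (h := fun n m τ => ∫⁻ σ, f m σ * g (n - m) (τ - σ))
    (a := fun n => (∫⁻ τ, f n τ ^ 2) ^ (1 / 2 : ℝ)) (b := fun n => ∫⁻ τ, g n τ)
    (measurable_conv hf hg) fun n m => by
      rw [mul_pow, rpow_half_sq]
      exact lintegral_sq_conv_le (hf m) (hg (n - m))
  simp only [rpow_half_sq] at h
  exact h

theorem bilinear_rho_right :
    sqL2 lam (fun n τ => ∫⁻ m, rhoKernel s lam n m *
        (∫⁻ σ, f m σ * g (n - m) (τ - σ)) ∂freqMeasure lam) ≤ 36 * A * (sqL1 lam f *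
        sqL2 lam g) := by
  have h := lintegral_sq_rhoKernel_mixed_le hA
    (h := fun n m τ => ∫⁻ σ, f m σ * g (n - m) (τ - σ))
    (a := fun n => ∫⁻ τ, f n τ) (b := fun n => (∫⁻ τ, g n τ ^ 2) ^ (1 / 2 : ℝ))
    (measurable_conv hf hg) fun n m => by
      rw [mul_pow, rpow_half_sq, mul_comm]
      simp_rw [lintegral_conv_comm (f m) (g (n - m))]
      exact lintegral_sq_conv_le (hg (n - m)) (hf m)
  simp only [rpow_half_sq] at h
  exact h

/-- The convolution of two L² functions of τ is bounded, and ⟨L⟩^{-9/16} is in L² because 9/8 > 1.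
-/
theorem bilinear_rho_modulation (β : ℝ) :
    sqL2 lam (fun n τ => ∫⁻ m, rhoKernel s lam n m *
      (ENNReal.ofReal (jb (τ - disp lam β (freq lam n)) ^ (-(9 / 16) : ℝ)) *
        ∫⁻ σ, f m σ * g (n - m) (τ - σ)) ∂freqMeasure lam) ≤
      36 * A * jbIntegral (9 / 8) * (sqL2 lam f *
        sqL2 lam g) := by
  have hw (n : ℤ) : Measurable fun τ =>
      ENNReal.ofReal (jb (τ - disp lam β (freq lam n)) ^ (-(9 / 16) : ℝ)) := by
    have := measurable_jb
    fun_prop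
  have h := lintegral_sq_rhoKernel_mixed_le hA
    (h := fun n m τ => ENNReal.ofReal (jb (τ - disp lam β (freq lam n)) ^ (-(9 / 16) : ℝ)) *
        ∫⁻ σ, f m σ * g (n - m) (τ - σ))
    (a := fun n => (jbIntegral (9 / 8) * ∫⁻ τ, f n τ ^ 2) ^ (1 / 2 : ℝ))
    (b := fun n => (∫⁻ τ, g n τ ^ 2) ^ (1 / 2 : ℝ))
    (fun n m => (hw n).mul (measurable_conv hf hg n m)) fun n m => by
      rw [mul_pow, rpow_half_sq, rpow_half_sq, mul_assoc]
      calc _ ≤ ∫⁻ τ, ENNReal.ofReal (jb (τ - disp lam β (freq lam n)) ^ (-(9 / 8) : ℝ)) *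
            ((∫⁻ τ, f m τ ^ 2) * ∫⁻ τ, g (n - m) τ ^ 2) := by
            refine lintegral_mono fun τ => ?_
            rw [mul_pow, ← ENNReal.ofReal_pow (jb_rpow_pos _ _).le, ← Real.rpow_natCast,
              ← Real.rpow_mul (jb_pos _).le]
            have := sq_conv_le (μ := volume) (hf m) (hg (n - m)) τ
            norm_num
            gcongr
        _ = _ := by
            rw [lintegral_mul_const _ (by have := measurable_jb; fun_prop),
              lintegral_sub_right_eq_self (fun x : ℝ => ENNReal.ofReal (jb x ^ (-(9 / 8) : ℝ)))]
            rfl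
  simp only [rpow_half_sq] at h
  rw [lintegral_const_mul _ Measurable.of_discrete] at h
  refine h.trans (le_of_eq (by rw [sqL2, sqL2]; ring))

theorem bilinear_rho_one :
    sqL1 lam (fun n τ => ∫⁻ m, rhoKernel s lam n m *
        (∫⁻ σ, f m σ * g (n - m) (τ - σ)) ∂freqMeasure lam) ≤ 36 * A * (sqL1 lam f *
        sqL1 lam g) := by
  refine le_trans (le_of_eq (lintegral_congr fun n => ?_))
    (lintegral_sq_rhoKernel_le hA (fun n => ∫⁻ τ, f n τ) fun n => ∫⁻ τ, g n τ)
  congr 1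
  rw [lintegral_lintegral_swap]
  · refine lintegral_congr fun m => ?_
    rw [lintegral_const_mul _ (measurable_conv hf hg n m), lintegral_conv (hf m) (hg (n - m))]
  · have := measurable_prod_int (f := fun m τ => rhoKernel s lam n m *
      ∫⁻ σ, f m σ * g (n - m) (τ - σ)) fun m => (measurable_conv hf hg n m).const_mul _
    exact (this.comp measurable_swap).aemeasurable

end

end

/-! ### Bilinear estimates with two modulation factors. -/

/-- After multiplication by ⟨t - t'⟩^{1/2} ≤ ⟨t⟩^{1/2} + ⟨t'⟩^{1/2}, both products are bounded by
the sum of the -3/2 powers. -/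
theorem jb_conv_le (t t' : ℝ) :
    jb t ^ (-(1 / 2) : ℝ) * jb t' ^ (-(3 / 2) : ℝ) ≤
      2 * jb (t - t') ^ (-(1 / 2) : ℝ) * (jb t ^ (-(3 / 2) : ℝ) + jb t' ^ (-(3 / 2) : ℝ)) := by
  have p := jb_pos t
  have p' := jb_pos t'
  have q := jb_pos (t - t')
  have h : jb (t - t') ≤ jb t + jb t' := by
    have := jb_le_add t (-t'); rwa [jb_neg, ← sub_eq_add_neg] at this
  have h1 : jb (t - t') ^ (1 / 2 : ℝ) ≤ jb t ^ (1 / 2 : ℝ) + jb t' ^ (1 / 2 : ℝ) :=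
    (Real.rpow_le_rpow q.le h (by norm_num)).trans
      (Real.rpow_add_le_add_rpow p.le p'.le (by norm_num) (by norm_num))
  have e1 : jb (t - t') ^ (-(1 / 2) : ℝ) * jb (t - t') ^ (1 / 2 : ℝ) = 1 := by
    rw [← Real.rpow_add q]; norm_num
  have n1 := jb_rpow_pos (t - t') (-(1 / 2))
  have n2 := jb_rpow_pos t (-(1 / 2))
  have n3 := jb_rpow_pos t' (-(3 / 2))
  have n4 := jb_rpow_pos t (-(3 / 2))
  have key : jb t ^ (-(1 / 2) : ℝ) * jb t' ^ (-(3 / 2) : ℝ) * jb (t - t') ^ (1 / 2 : ℝ) ≤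
      2 * (jb t ^ (-(3 / 2) : ℝ) + jb t' ^ (-(3 / 2) : ℝ)) := by
    have e2 : jb t ^ (-(1 / 2) : ℝ) * jb t ^ (1 / 2 : ℝ) = 1 := by
      rw [← Real.rpow_add p]; norm_num
    have e3 : jb t' ^ (-(3 / 2) : ℝ) * jb t' ^ (1 / 2 : ℝ) = jb t' ^ (-1 : ℝ) := by
      rw [← Real.rpow_add p']; norm_num
    have e4 : jb t ^ (-(1 / 2) : ℝ) * jb t' ^ (-1 : ℝ) ≤
        jb t ^ (-(3 / 2) : ℝ) + jb t' ^ (-(3 / 2) : ℝ) := by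
      rcases le_total (jb t) (jb t') with hc | hc
      · refine le_add_of_le_of_nonneg ?_ n3.le
        rw [show (-(3 / 2) : ℝ) = -(1 / 2) + -1 by norm_num, Real.rpow_add p]
        exact mul_le_mul_of_nonneg_left (Real.rpow_le_rpow_of_nonpos p hc (by norm_num)) n2.le
      · refine le_add_of_nonneg_of_le n4.le ?_
        rw [show (-(3 / 2) : ℝ) = -(1 / 2) + -1 by norm_num, Real.rpow_add p']
        exact mul_le_mul_of_nonneg_right (Real.rpow_le_rpow_of_nonpos p' hc (by norm_num))
          (jb_rpow_pos _ _).le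
    calc _ ≤ jb t ^ (-(1 / 2) : ℝ) * jb t' ^ (-(3 / 2) : ℝ) *
          (jb t ^ (1 / 2 : ℝ) + jb t' ^ (1 / 2 : ℝ)) := by gcongr
      _ = (jb t ^ (-(1 / 2) : ℝ) * jb t ^ (1 / 2 : ℝ)) * jb t' ^ (-(3 / 2) : ℝ) +
          jb t ^ (-(1 / 2) : ℝ) * (jb t' ^ (-(3 / 2) : ℝ) * jb t' ^ (1 / 2 : ℝ)) := by ring
      _ ≤ _ := by rw [e2, e3]; linarith
  calc _ = jb t ^ (-(1 / 2) : ℝ) * jb t' ^ (-(3 / 2) : ℝ) *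
        (jb (t - t') ^ (-(1 / 2) : ℝ) * jb (t - t') ^ (1 / 2 : ℝ)) := by rw [e1, mul_one]
    _ = jb (t - t') ^ (-(1 / 2) : ℝ) *
        (jb t ^ (-(1 / 2) : ℝ) * jb t' ^ (-(3 / 2) : ℝ) * jb (t - t') ^ (1 / 2 : ℝ)) := by ring
    _ ≤ jb (t - t') ^ (-(1 / 2) : ℝ) * (2 * (jb t ^ (-(3 / 2) : ℝ) + jb t' ^ (-(3 / 2) : ℝ))) := by
        gcongr
    _ = _ := by ring

theorem lintegral_jb_conv_le (a b : ℝ) :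
    ∫⁻ τ, ENNReal.ofReal (jb (τ - a) ^ (-(1 / 2) : ℝ) * jb (τ - b) ^ (-(3 / 2) : ℝ)) ≤
      4 * jbIntegral (3 / 2) * ENNReal.ofReal (jb (b - a) ^ (-(1 / 2) : ℝ)) := by
  have hm := measurable_jb
  calc _ ≤ ∫⁻ τ, 2 * ENNReal.ofReal (jb (b - a) ^ (-(1 / 2) : ℝ)) *
        (ENNReal.ofReal (jb (τ - a) ^ (-(3 / 2) : ℝ)) +
          ENNReal.ofReal (jb (τ - b) ^ (-(3 / 2) : ℝ))) := by
        refine lintegral_mono fun τ => ?_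
        have := jb_conv_le (τ - a) (τ - b)
        rw [sub_sub_sub_cancel_left] at this
        refine (ENNReal.ofReal_le_ofReal this).trans_eq ?_
        rw [ENNReal.ofReal_mul (by have := jb_rpow_pos (b - a) (-(1 / 2)); positivity),
          ENNReal.ofReal_mul two_pos.le, ENNReal.ofReal_add (jb_rpow_pos _ _).le
          (jb_rpow_pos _ _).le, ENNReal.ofReal_ofNat]
    _ = _ := by
        rw [lintegral_const_mul _ (by fun_prop), lintegral_add_left (by fun_prop),
          lintegral_sub_right_eq_self (fun x : ℝ => ENNReal.ofReal (jb x ^ (-(3 / 2) : ℝ))),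
          lintegral_sub_right_eq_self (fun x : ℝ => ENNReal.ofReal (jb x ^ (-(3 / 2) : ℝ))),
          ← jbIntegral]
        ring

/-- The squared kernel bound behind the estimates with two modulation factors. -/
def kernelBound : ℝ≥0∞ := 4 * jbIntegral (3 / 2) * (68 * (1 + 2 * jbIntegral (3 / 2)))

theorem kernelBound_lt_top : kernelBound < ∞ := by
  have := jbIntegral_lt_top (p := 3 / 2) (by norm_num)
  unfold kernelBound
  finiteness

theorem lintegral_freqMeasure_dispDiff_le {lam β : ℝ} (hlam : 1 ≤ lam) (hβ : |β| ≤ 1) {n : ℤ}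
    (hn : 1 ≤ |freq lam n|) {G : ℤ → ℝ≥0∞} (a : ℝ)
    (hG : ∀ m, G m ≤ 4 * jbIntegral (3 / 2) * ENNReal.ofReal
      (jb (a - dispDiff lam β (freq lam n) (freq lam (2 * m - n))) ^ (-(1 / 2) : ℝ))) :
    ∫⁻ m, G m ∂freqMeasure lam ≤ kernelBound := by
  refine (lintegral_mono hG).trans ?_
  rw [lintegral_const_mul _ Measurable.of_discrete, lintegral_freqMeasure, kernelBound]
  exact mul_le_mul' le_rfl (tsum_jb_dispDiff_le hlam hβ hn a)

theorem ofReal_mul_rpow_sq (x y a b : ℝ) :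
    ENNReal.ofReal (jb x ^ a * jb y ^ b) ^ 2 =
      ENNReal.ofReal (jb x ^ (2 * a) * jb y ^ (2 * b)) := by
  rw [← ENNReal.ofReal_pow (mul_nonneg (jb_rpow_pos _ _).le (jb_rpow_pos _ _).le), mul_pow,
    ← Real.rpow_natCast, ← Real.rpow_natCast, ← Real.rpow_mul (jb_pos _).le,
    ← Real.rpow_mul (jb_pos _).le, mul_comm a, mul_comm b]
  norm_num

/-- The kernel `1_{|k₁| ≥ 1} ⟨L⟩^{-1/4} ⟨L₂⟩^{-3/4}`. -/
def inputKernel (lam β : ℝ) (x y : ℤ × ℝ) : ℝ≥0∞ :=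
  ENNReal.ofReal (highFreq (freq lam y.1)) * ENNReal.ofReal
    (jb (x.2 - disp lam β (freq lam x.1)) ^ (-(1 / 4) : ℝ) *
      jb (x.2 - y.2 - disp lam β (freq lam (x.1 - y.1))) ^ (-(3 / 4) : ℝ))

/-- The kernel `1_{|k| ≥ 1} ⟨L₁⟩^{-3/4} ⟨L₂⟩^{-3/4}`. -/
def outputKernel (lam β : ℝ) (x y : ℤ × ℝ) : ℝ≥0∞ :=
  ENNReal.ofReal (highFreq (freq lam x.1)) * ENNReal.ofReal
    (jb (y.2 - disp lam β (freq lam y.1)) ^ (-(3 / 4) : ℝ) *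
      jb (x.2 - y.2 - disp lam β (freq lam (x.1 - y.1))) ^ (-(3 / 4) : ℝ))

theorem measurable_of_int_prod {α : Type*} [MeasurableSpace α] {K : (ℤ × ℝ) × (ℤ × ℝ) → α}
    (hK : ∀ n m : ℤ, Measurable fun q : ℝ × ℝ => K ((n, q.1), (m, q.2))) : Measurable K := by
  have h : Measurable fun p : (ℤ × ℤ) × (ℝ × ℝ) => K ((p.1.1, p.2.1), (p.1.2, p.2.2)) :=
    measurable_from_prod_countable_right fun p => hK p.1 p.2
  exact h.comp (((measurable_fst.comp measurable_fst).prodMk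
    (measurable_fst.comp measurable_snd)).prodMk
    ((measurable_snd.comp measurable_fst).prodMk (measurable_snd.comp measurable_snd)))

theorem measurable_inputKernel (lam β : ℝ) : Measurable (Function.uncurry (inputKernel lam β)) := by
  refine measurable_of_int_prod fun n m => ?_
  have := measurable_jb
  simp only [Function.uncurry, inputKernel]
  fun_prop

theorem measurable_outputKernel (lam β : ℝ) :
    Measurable (Function.uncurry (outputKernel lam β)) := by
  refine measurable_of_int_prod fun n m => ?_
  have := measurable_jb
  simp only [Function.uncurry, outputKernel]
  fun_prop

section

variable {lam β : ℝ} (hlam : 1 ≤ lam) (hβ : |β| ≤ 1)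

include hlam hβ

/-- Integrating ⟨L⟩^{-1/2}⟨L₂⟩^{-3/2} in τ leaves a power of σ + p(k - k₁) - p(k). With κ = k₁ and y
= 2k - k₁ this is the quantity counted above. -/
theorem lintegral_sq_inputKernel_le (y : ℤ × ℝ) :
    ∫⁻ x, inputKernel lam β x y ^ 2 ∂(freqMeasure lam).prod volume ≤ kernelBound := by
  have hm := (measurable_inputKernel lam β).of_uncurry_right (y := y)
  by_cases hy : 1 ≤ |freq lam y.1|
  · rw [lintegral_prod _ (hm.pow_const 2).aemeasurable]
    refine lintegral_freqMeasure_dispDiff_le hlam hβ hy y.2 fun n => ?_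
    have e : y.2 - dispDiff lam β (freq lam y.1) (freq lam (2 * n - y.1)) =
        (y.2 + disp lam β (freq lam (n - y.1))) - disp lam β (freq lam n) := by
      rw [dispDiff]
      have e1 : (freq lam (2 * n - y.1) + freq lam y.1) / 2 = freq lam n := by
        simp only [freq]; push_cast; ring
      have e2 : (freq lam (2 * n - y.1) - freq lam y.1) / 2 = freq lam (n - y.1) := by
        simp only [freq]; push_cast; ring
      rw [e1, e2]; ring
    rw [e]
    refine le_trans (le_of_eq ?_) (lintegral_jb_conv_le _ _)
    refine lintegral_congr fun τ => ?_
    simp only [inputKernel, highFreq, if_pos hy, ENNReal.ofReal_one, one_mul, ofReal_mul_rpow_sq]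
    norm_num
    rw [sub_sub]
  · simp [inputKernel, highFreq, hy]

/-- Now κ = k and y = 2k₁ - k; oddness of p turns the sum p(k₁) + p(k₂) into a difference. One of
the two powers -3/2 is weakened to -1/2 to fit the same integral. -/
theorem lintegral_sq_outputKernel_le (x : ℤ × ℝ) :
    ∫⁻ y, outputKernel lam β x y ^ 2 ∂(freqMeasure lam).prod volume ≤ kernelBound := by
  have hm := (measurable_outputKernel lam β).of_uncurry_left (x := x)
  by_cases hx : 1 ≤ |freq lam x.1|
  · rw [lintegral_prod _ (hm.pow_const 2).aemeasurable]
    refine lintegral_freqMeasure_dispDiff_le hlam hβ hx x.2 fun m => ?_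
    have e : x.2 - dispDiff lam β (freq lam x.1) (freq lam (2 * m - x.1)) =
        (x.2 - disp lam β (freq lam (x.1 - m))) - disp lam β (freq lam m) := by
      rw [dispDiff]
      have e1 : (freq lam (2 * m - x.1) + freq lam x.1) / 2 = freq lam m := by
        simp only [freq]; push_cast; ring
      have e2 : (freq lam (2 * m - x.1) - freq lam x.1) / 2 = -freq lam (x.1 - m) := by
        simp only [freq]; push_cast; ring
      rw [e1, e2, disp_neg]; ring
    rw [e]
    refine le_trans (lintegral_mono fun σ => ?_) (lintegral_jb_conv_le _ _)
    simp only [outputKernel, highFreq, if_pos hx, ENNReal.ofReal_one, one_mul, ofReal_mul_rpow_sq]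
    refine ENNReal.ofReal_le_ofReal (mul_le_mul ?_ (le_of_eq ?_) (jb_rpow_pos _ _).le
      (jb_rpow_pos _ _).le)
    · exact Real.rpow_le_rpow_of_exponent_le (one_le_jb _) (by norm_num)
    · rw [← jb_neg]
      norm_num
      congr 2
      ring
  · simp [outputKernel, highFreq, hx]

variable {f g : ℤ → ℝ → ℝ≥0∞} (hf : ∀ n, Measurable (f n)) (hg : ∀ n, Measurable (g n))

omit hlam hβ in
include hf in
theorem lintegral_prod_sq :
    ∫⁻ x, f x.1 x.2 ^ 2 ∂(freqMeasure lam).prod volume = sqL2 lam f :=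
  lintegral_prod _ ((measurable_prod_int hf).pow_const 2).aemeasurable

omit hlam hβ in
include hf hg in
theorem sqL2_kernel_eq {K : ℤ × ℝ → ℤ × ℝ → ℝ≥0∞} (hK : Measurable (Function.uncurry K)) :
    sqL2 lam (fun n τ => ∫⁻ m, (∫⁻ σ, K (n, τ) (m, σ) * (f m σ * g (n - m) (τ - σ)))
      ∂freqMeasure lam) =
    ∫⁻ x, (∫⁻ y, K x y * (f y.1 y.2 * g (x - y).1 (x - y).2) ∂(freqMeasure lam).prod volume) ^ 2
      ∂(freqMeasure lam).prod volume := by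
  have hF : Measurable fun q : (ℤ × ℝ) × (ℤ × ℝ) =>
      Function.uncurry K q * (f q.2.1 q.2.2 * g (q.1 - q.2).1 (q.1 - q.2).2) :=
    hK.mul (((measurable_prod_int hf).comp measurable_snd).mul
      ((measurable_prod_int hg).comp (measurable_fst.sub measurable_snd)))
  have hF' : Measurable fun x : ℤ × ℝ => (∫⁻ y, K x y * (f y.1 y.2 * g (x - y).1 (x - y).2)
      ∂(freqMeasure lam).prod volume) ^ 2 := hF.lintegral_prod_right'.pow_const 2
  symm
  refine (lintegral_prod _ hF'.aemeasurable).trans ?_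
  refine lintegral_congr fun n => lintegral_congr fun τ => congrArg (· ^ 2) ?_
  have hF2 : Measurable fun y : ℤ × ℝ =>
      K (n, τ) y * (f y.1 y.2 * g ((n, τ) - y).1 ((n, τ) - y).2) :=
    hF.comp (measurable_const.prodMk measurable_id)
  exact lintegral_prod _ hF2.aemeasurable

include hlam hβ hf hg

theorem bilinear_input_left :
    sqL2 lam (fun n τ => ∫⁻ m, (∫⁻ σ, inputKernel lam β (n, τ) (m, σ) *
      (f m σ * g (n - m) (τ - σ))) ∂freqMeasure lam) ≤
      kernelBound * (sqL2 lam f * sqL2 lam g) := by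
  rw [sqL2_kernel_eq hf hg (measurable_inputKernel lam β), ← lintegral_prod_sq hf,
    ← lintegral_prod_sq hg]
  have key := lintegral_sq_kernel_le_of_left (measurable_inputKernel lam β)
    (measurable_prod_int hf) (measurable_prod_int hg) (lintegral_sq_inputKernel_le hlam hβ)
  exact key

theorem bilinear_input_right :
    sqL2 lam (fun n τ => ∫⁻ m, (∫⁻ σ, inputKernel lam β (n, τ) (n - m, τ - σ) *
      (f m σ * g (n - m) (τ - σ))) ∂freqMeasure lam) ≤
      kernelBound * (sqL2 lam f * sqL2 lam g) := by
  have hK : Measurable (Function.uncurry fun x y : ℤ × ℝ => inputKernel lam β x (x - y)) := by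
    refine measurable_of_int_prod fun n m => ?_
    have := measurable_jb
    simp only [Function.uncurry, inputKernel, Prod.fst_sub, Prod.snd_sub]
    fun_prop
  have key := sqL2_kernel_eq (lam := lam) hf hg hK
  refine key.trans_le ?_
  rw [← lintegral_prod_sq hf, ← lintegral_prod_sq hg]
  have bound := lintegral_sq_kernel_le_of_right (μ := (freqMeasure lam).prod volume)
    (A := kernelBound) hK (measurable_prod_int hf)
    (measurable_prod_int hg) fun y => by
      simp only [sub_sub_cancel]
      exact lintegral_sq_inputKernel_le hlam hβ y
  exact bound

theorem bilinear_output :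
    sqL2 lam (fun n τ => ∫⁻ m, (∫⁻ σ, outputKernel lam β (n, τ) (m, σ) *
      (f m σ * g (n - m) (τ - σ))) ∂freqMeasure lam) ≤
      kernelBound * (sqL2 lam f * sqL2 lam g) := by
  rw [sqL2_kernel_eq hf hg (measurable_outputKernel lam β), ← lintegral_prod_sq hf,
    ← lintegral_prod_sq hg]
  have key := lintegral_sq_kernel_le_of_output (measurable_outputKernel lam β)
    (measurable_prod_int hf) (measurable_prod_int hg) (lintegral_sq_outputKernel_le hlam hβ)
  exact key

end

/-! ### Assembly of the estimate for nonnegative functions. -/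

/-- Convolution of nonnegative functions on `ℤ_lam × ℝ`. -/
def lconv (lam : ℝ) (f g : ℤ → ℝ → ℝ≥0∞) (n : ℤ) (τ : ℝ) : ℝ≥0∞ :=
  ∫⁻ m, (∫⁻ σ, f m σ * g (n - m) (τ - σ)) ∂freqMeasure lam

/-- Multiplication by the weight of the `L²` part of the `Z^s` norm. -/
def xWeighted (s lam β : ℝ) (f : ℤ → ℝ → ℝ≥0∞) (n : ℤ) (τ : ℝ) : ℝ≥0∞ :=
  ENNReal.ofReal (weight s (freq lam n) (τ - disp lam β (freq lam n))) * f n τ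

/-- Multiplication by the weight of the `Y^s` norm. -/
def yWeighted (s lam : ℝ) (f : ℤ → ℝ → ℝ≥0∞) (n : ℤ) (τ : ℝ) : ℝ≥0∞ :=
  ENNReal.ofReal (jb (freq lam n) ^ s) * f n τ

/-- The square of the `Z^s` norm, up to constants. -/
def energy (s lam β : ℝ) (f : ℤ → ℝ → ℝ≥0∞) : ℝ≥0∞ :=
  sqL2 lam (xWeighted s lam β f) + sqL1 lam (yWeighted s lam f)

/-- The convolution weighted by `strongSum`. -/
def strongConv (s lam β : ℝ) (f g : ℤ → ℝ → ℝ≥0∞) (n : ℤ) (τ : ℝ) : ℝ≥0∞ :=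
  ∫⁻ m, (∫⁻ σ, ENNReal.ofReal (strongSum s (freq lam n) (freq lam m) (freq lam (n - m))
      (τ - disp lam β (freq lam n)) (σ - disp lam β (freq lam m))
      (τ - σ - disp lam β (freq lam (n - m)))) * (f m σ * g (n - m) (τ - σ))) ∂freqMeasure lam

theorem measurable_weight (s k : ℝ) : Measurable (weight s k) := by
  have := measurable_jb
  unfold weight
  fun_prop

theorem lintegral_freqMeasure_add {lam : ℝ} {f g : ℤ → ℝ → ℝ≥0∞} (hf : ∀ m, Measurable (f m)) :
    ∫⁻ m, (∫⁻ σ, f m σ + g m σ) ∂freqMeasure lam =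
      ∫⁻ m, (∫⁻ σ, f m σ) ∂freqMeasure lam + ∫⁻ m, (∫⁻ σ, g m σ) ∂freqMeasure lam := by
  simp_rw [lintegral_add_left (hf _)]
  exact lintegral_add_left .of_discrete _

theorem lintegral_freqMeasure_add_five {lam : ℝ} {a b c d e : ℤ → ℝ → ℝ≥0∞}
    (ha : ∀ m, Measurable (a m)) (hb : ∀ m, Measurable (b m)) (hc : ∀ m, Measurable (c m))
    (hd : ∀ m, Measurable (d m)) :
    ∫⁻ m, (∫⁻ σ, a m σ + b m σ + c m σ + d m σ + e m σ) ∂freqMeasure lam =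
      ∫⁻ m, (∫⁻ σ, a m σ) ∂freqMeasure lam + ∫⁻ m, (∫⁻ σ, b m σ) ∂freqMeasure lam +
      ∫⁻ m, (∫⁻ σ, c m σ) ∂freqMeasure lam + ∫⁻ m, (∫⁻ σ, d m σ) ∂freqMeasure lam +
      ∫⁻ m, (∫⁻ σ, e m σ) ∂freqMeasure lam := by
  rw [lintegral_freqMeasure_add (f := fun m σ => a m σ + b m σ + c m σ + d m σ)
      fun m => (((ha m).add (hb m)).add (hc m)).add (hd m),
    lintegral_freqMeasure_add (f := fun m σ => a m σ + b m σ + c m σ)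
      fun m => ((ha m).add (hb m)).add (hc m),
    lintegral_freqMeasure_add (f := fun m σ => a m σ + b m σ) fun m => (ha m).add (hb m),
    lintegral_freqMeasure_add ha]

theorem lintegral_freqMeasure_const_mul {lam : ℝ} {f : ℤ → ℝ → ℝ≥0∞} (c : ℝ≥0∞)
    (hf : ∀ m, Measurable (f m)) :
    ∫⁻ m, (∫⁻ σ, c * f m σ) ∂freqMeasure lam =
      c * ∫⁻ m, (∫⁻ σ, f m σ) ∂freqMeasure lam := by
  simp_rw [lintegral_const_mul c (hf _)]
  exact lintegral_const_mul _ .of_discrete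

theorem measurable_lintegral_freqMeasure {lam : ℝ} {h : ℤ → ℝ → ℝ≥0∞} (hh : ∀ m, Measurable (h m)) :
    Measurable fun τ => ∫⁻ m, h m τ ∂freqMeasure lam := by
  simp_rw [lintegral_freqMeasure]
  exact (Measurable.tsum hh).const_mul _

theorem sqL2_add_le {lam : ℝ} {f g : ℤ → ℝ → ℝ≥0∞} (hf : ∀ n, Measurable (f n)) :
    sqL2 lam (fun n τ => f n τ + g n τ) ≤ 4 * (sqL2 lam f + sqL2 lam g) := by
  calc _ ≤ ∫⁻ n, (∫⁻ τ, 4 * (f n τ ^ 2 + g n τ ^ 2)) ∂freqMeasure lam :=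
        lintegral_mono fun n => lintegral_mono fun τ => add_sq_le_four_mul _ _
    _ = _ := by
        simp_rw [lintegral_const_mul' 4 _ (by norm_num : (4 : ℝ≥0∞) ≠ ∞)]
        rw [lintegral_freqMeasure_add fun m => (hf m).pow_const 2, sqL2, sqL2]

theorem sqL1_add_le {lam : ℝ} {f g : ℤ → ℝ → ℝ≥0∞} (hf : ∀ n, Measurable (f n)) :
    sqL1 lam (fun n τ => f n τ + g n τ) ≤ 4 * (sqL1 lam f + sqL1 lam g) := by
  calc _ ≤ ∫⁻ n, 4 * ((∫⁻ τ, f n τ) ^ 2 + (∫⁻ τ, g n τ) ^ 2) ∂freqMeasure lam := by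
        refine lintegral_mono fun n => ?_
        simp only [lintegral_add_left (hf n)]
        exact add_sq_le_four_mul _ _
    _ = _ := by
        rw [lintegral_const_mul' 4 _ (by norm_num : (4 : ℝ≥0∞) ≠ ∞),
          lintegral_add_left .of_discrete, sqL1, sqL1]

theorem sqL2_const_mul {lam : ℝ} {f : ℤ → ℝ → ℝ≥0∞} {c : ℝ≥0∞} (hc : c ≠ ∞) :
    sqL2 lam (fun n τ => c * f n τ) = c ^ 2 * sqL2 lam f := by
  simp_rw [sqL2, mul_pow, lintegral_const_mul' (c ^ 2) _ (ENNReal.pow_ne_top hc)]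

theorem sqL1_const_mul {lam : ℝ} {f : ℤ → ℝ → ℝ≥0∞} {c : ℝ≥0∞} (hc : c ≠ ∞) :
    sqL1 lam (fun n τ => c * f n τ) = c ^ 2 * sqL1 lam f := by
  simp_rw [sqL1, lintegral_const_mul' c _ hc, mul_pow,
    lintegral_const_mul' (c ^ 2) _ (ENNReal.pow_ne_top hc)]

theorem sqL2_mono {lam : ℝ} {f g : ℤ → ℝ → ℝ≥0∞} (h : ∀ n τ, f n τ ≤ g n τ) :
    sqL2 lam f ≤ sqL2 lam g :=
  lintegral_mono fun n => lintegral_mono fun τ => pow_le_pow_left' (h n τ) 2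

theorem sqL1_mono {lam : ℝ} {f g : ℤ → ℝ → ℝ≥0∞} (h : ∀ n τ, f n τ ≤ g n τ) :
    sqL1 lam f ≤ sqL1 lam g :=
  lintegral_mono fun n => pow_le_pow_left' (lintegral_mono fun τ => h n τ) 2

/-- Cauchy-Schwarz in τ, as ⟨L⟩^{-3/4} is square integrable. -/
theorem sqL1_modulation_le {lam : ℝ} (β : ℝ) {f : ℤ → ℝ → ℝ≥0∞} (hf : ∀ n, Measurable (f n)) :
    sqL1 lam (fun n τ => ENNReal.ofReal (jb (τ - disp lam β (freq lam n)) ^ (-(3 / 4) : ℝ)) *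
      f n τ) ≤ jbIntegral (3 / 2) * sqL2 lam f := by
  have hm := measurable_jb
  rw [sqL2, ← lintegral_const_mul _ .of_discrete]
  refine lintegral_mono fun n => ?_
  refine (sq_lintegral_mul_le (by fun_prop) (hf n).aemeasurable).trans_eq ?_
  congr 1
  rw [jbIntegral, ← lintegral_sub_right_eq_self (fun τ => ENNReal.ofReal (jb τ ^ (-(3 / 2) : ℝ)))
    (disp lam β (freq lam n))]
  refine lintegral_congr fun τ => ?_
  rw [← ENNReal.ofReal_pow (jb_rpow_pos _ _).le, ← Real.rpow_natCast, ← Real.rpow_mul (jb_pos _).le]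
  norm_num

section

variable {s lam β : ℝ} {f g : ℤ → ℝ → ℝ≥0∞} (hf : ∀ n, Measurable (f n))
  (hg : ∀ n, Measurable (g n))

include hf in
theorem measurable_xWeighted (n : ℤ) : Measurable (xWeighted s lam β f n) := by
  have := measurable_weight s (freq lam n)
  have := hf n
  unfold xWeighted
  fun_prop

include hf in
theorem measurable_yWeighted (n : ℤ) : Measurable (yWeighted s lam f n) := (hf n).const_mul _

include hf hg

theorem measurable_lconv (n : ℤ) : Measurable (lconv lam f g n) :=
  measurable_lintegral_freqMeasure (measurable_conv hf hg n)

theorem measurable_lconv_kernel {K : ℤ × ℝ → ℤ × ℝ → ℝ≥0∞} (hK : Measurable (Function.uncurry K))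
    (n : ℤ) : Measurable fun τ => ∫⁻ m, (∫⁻ σ, K (n, τ) (m, σ) * (f m σ * g (n - m) (τ - σ)))
      ∂freqMeasure lam := by
  refine measurable_lintegral_freqMeasure fun m => ?_
  have h1 := hf m
  have h2 := hg (n - m)
  have h3 : Measurable fun p : ℝ × ℝ => K (n, p.1) (m, p.2) :=
    hK.comp (g := Function.uncurry K) (f := fun p : ℝ × ℝ => ((n, p.1), (m, p.2))) (by fun_prop)
  refine Measurable.lintegral_prod_right'
    (f := fun p : ℝ × ℝ => K (n, p.1) (m, p.2) * (f m p.2 * g (n - m) (p.1 - p.2))) ?_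
  fun_prop

theorem strongConv_eq (n : ℤ) (τ : ℝ) : strongConv s lam β f g n τ =
    ∫⁻ m, rhoKernel s lam n m * (∫⁻ σ, xWeighted s lam β f m σ *
      yWeighted s lam g (n - m) (τ - σ)) ∂freqMeasure lam +
    ∫⁻ m, rhoKernel s lam n m * (∫⁻ σ, yWeighted s lam f m σ *
      xWeighted s lam β g (n - m) (τ - σ)) ∂freqMeasure lam +
    ∫⁻ m, rhoKernel s lam n m * (ENNReal.ofReal (jb (τ - disp lam β (freq lam n)) ^
      (-(9 / 16) : ℝ)) * ∫⁻ σ, xWeighted s lam β f m σ *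
      xWeighted s lam β g (n - m) (τ - σ)) ∂freqMeasure lam +
    ∫⁻ m, (∫⁻ σ, inputKernel lam β (n, τ) (m, σ) * (xWeighted s lam β f m σ *
      xWeighted s lam β g (n - m) (τ - σ))) ∂freqMeasure lam +
    ∫⁻ m, (∫⁻ σ, inputKernel lam β (n, τ) (n - m, τ - σ) * (xWeighted s lam β f m σ *
      xWeighted s lam β g (n - m) (τ - σ))) ∂freqMeasure lam := by
  have xf (n : ℤ) := measurable_xWeighted (s := s) (lam := lam) (β := β) hf n
  have xg (n : ℤ) := measurable_xWeighted (s := s) (lam := lam) (β := β) hg n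
  have yf (n : ℤ) := measurable_yWeighted (s := s) (lam := lam) hf n
  have yg (n : ℤ) := measurable_yWeighted (s := s) (lam := lam) hg n
  have m1 (m : ℤ) : Measurable fun σ => xWeighted s lam β f m σ *
      yWeighted s lam g (n - m) (τ - σ) := by
    have := xf m; have := yg (n - m); fun_prop
  have m2 (m : ℤ) : Measurable fun σ => yWeighted s lam f m σ *
      xWeighted s lam β g (n - m) (τ - σ) := by
    have := yf m; have := xg (n - m); fun_prop
  have m3 (m : ℤ) : Measurable fun σ => xWeighted s lam β f m σ *
      xWeighted s lam β g (n - m) (τ - σ) := by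
    have := xf m; have := xg (n - m); fun_prop
  have mK (m : ℤ) : Measurable fun σ => inputKernel lam β (n, τ) (m, σ) := by
    have := measurable_jb
    simp only [inputKernel]
    fun_prop
  simp_rw [← lintegral_const_mul _ (m1 _), ← lintegral_const_mul _ (m2 _),
    ← lintegral_const_mul _ (m3 _), ← lintegral_const_mul _ ((m3 _).const_mul _)]
  refine Eq.trans ?_ (lintegral_freqMeasure_add_five (fun m => (m1 m).const_mul _)
    (fun m => (m2 m).const_mul _) (fun m => ((m3 m).const_mul _).const_mul _)
    fun m => (mK m).mul (m3 m))
  refine lintegral_congr fun m => lintegral_congr fun σ => ?_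
  have := rho_nonneg s (freq lam n)
  have := rho_nonneg s (freq lam m)
  have := rho_nonneg s (freq lam (n - m))
  have h1 := highFreq_nonneg (freq lam m)
  have h2 := highFreq_nonneg (freq lam (n - m))
  have w1 := weight_pos s (freq lam m) (σ - disp lam β (freq lam m))
  have w2 := weight_pos s (freq lam (n - m)) (τ - σ - disp lam β (freq lam (n - m)))
  have := jb_rpow_pos (τ - disp lam β (freq lam n)) (-(9 / 16))
  have := jb_rpow_pos (τ - disp lam β (freq lam n)) (-(1 / 4))
  have := jb_rpow_pos (σ - disp lam β (freq lam m)) (-(3 / 4))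
  have := jb_rpow_pos (τ - σ - disp lam β (freq lam (n - m))) (-(3 / 4))
  have := jb_rpow_pos (freq lam m) s
  have := jb_rpow_pos (freq lam (n - m)) s
  rw [strongSum, ENNReal.ofReal_add (by positivity) (by positivity),
    ENNReal.ofReal_add (by positivity) (by positivity),
    ENNReal.ofReal_add (by positivity) (by positivity),
    ENNReal.ofReal_add (by positivity) (by positivity)]
  simp only [← ofReal_rho_add, xWeighted, yWeighted, inputKernel, sub_sub_cancel]
  repeat rw [ENNReal.ofReal_mul (by positivity)]
  ring

theorem sqL2_strongConv_le {A : ℝ≥0∞} (hlam : 1 ≤ lam) (hβ : |β| ≤ 1)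
    (hA : ∫⁻ n, ENNReal.ofReal (rho s (freq lam n)) ^ 2 ∂freqMeasure lam ≤ A) :
    sqL2 lam (strongConv s lam β f g) ≤
      596 * ((36 * A + 36 * A * jbIntegral (9 / 8) + kernelBound) *
        (energy s lam β f * energy s lam β g)) := by
  have xf (n : ℤ) := measurable_xWeighted (s := s) (lam := lam) (β := β) hf n
  have xg (n : ℤ) := measurable_xWeighted (s := s) (lam := lam) (β := β) hg n
  have yf (n : ℤ) := measurable_yWeighted (s := s) (lam := lam) hf n
  have yg (n : ℤ) := measurable_yWeighted (s := s) (lam := lam) hg n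
  have b1 := bilinear_rho_left xf yg hA
  have b2 := bilinear_rho_right yf xg hA
  have b3 := bilinear_rho_modulation xf xg hA β
  have b4 := bilinear_input_left hlam hβ xf xg
  have b5 := bilinear_input_right hlam hβ xf xg
  have m1 (n : ℤ) : Measurable fun τ => ∫⁻ m, rhoKernel s lam n m * (∫⁻ σ, xWeighted s lam β f m σ *
      yWeighted s lam g (n - m) (τ - σ)) ∂freqMeasure lam :=
    measurable_lintegral_freqMeasure fun m => (measurable_conv xf yg n m).const_mul _
  have m2 (n : ℤ) : Measurable fun τ => ∫⁻ m, rhoKernel s lam n m * (∫⁻ σ, yWeighted s lam f m σ *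
      xWeighted s lam β g (n - m) (τ - σ)) ∂freqMeasure lam :=
    measurable_lintegral_freqMeasure fun m => (measurable_conv yf xg n m).const_mul _
  have m3 (n : ℤ) : Measurable fun τ => ∫⁻ m, rhoKernel s lam n m *
      (ENNReal.ofReal (jb (τ - disp lam β (freq lam n)) ^ (-(9 / 16) : ℝ)) *
      ∫⁻ σ, xWeighted s lam β f m σ * xWeighted s lam β g (n - m) (τ - σ)) ∂freqMeasure lam := by
    refine measurable_lintegral_freqMeasure fun m => (Measurable.mul ?_
      (measurable_conv xf xg n m)).const_mul _
    have := measurable_jb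
    fun_prop
  have m4 (n : ℤ) := measurable_lconv_kernel (lam := lam) xf xg (measurable_inputKernel lam β) n
  have hE : sqL2 lam (xWeighted s lam β f) * sqL1 lam (yWeighted s lam g) ≤
      energy s lam β f * energy s lam β g := mul_le_mul' le_self_add le_add_self
  have hE' : sqL1 lam (yWeighted s lam f) * sqL2 lam (xWeighted s lam β g) ≤
      energy s lam β f * energy s lam β g := mul_le_mul' le_add_self le_self_add
  have hE'' : sqL2 lam (xWeighted s lam β f) * sqL2 lam (xWeighted s lam β g) ≤
      energy s lam β f * energy s lam β g := mul_le_mul' le_self_add le_self_add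
  set E := energy s lam β f * energy s lam β g
  set D := 36 * A + 36 * A * jbIntegral (9 / 8) + kernelBound with hD
  have d1 : 36 * A ≤ D := le_self_add.trans le_self_add
  have d2 : 36 * A * jbIntegral (9 / 8) ≤ D := le_add_self.trans le_self_add
  have d3 : kernelBound ≤ D := le_add_self
  have c1 := b1.trans (mul_le_mul' d1 hE)
  have c2 := b2.trans (mul_le_mul' d1 hE')
  have c3 := b3.trans (mul_le_mul' d2 hE'')
  have c4 := b4.trans (mul_le_mul' d3 hE'')
  have c5 := b5.trans (mul_le_mul' d3 hE'')
  -- Five terms split off one at a time at a factor 4 each; the coefficients add up to 596.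
  calc _ ≤ 4 * (4 * (4 * (4 * (D * E + D * E) + D * E) + D * E) + D * E) := by
        refine (sqL2_mono fun n τ => (strongConv_eq hf hg n τ).le).trans ?_
        refine (sqL2_add_le fun n => (((m1 n).add (m2 n)).add (m3 n)).add (m4 n)).trans ?_
        refine mul_le_mul' le_rfl (add_le_add ?_ c5)
        refine (sqL2_add_le fun n => ((m1 n).add (m2 n)).add (m3 n)).trans ?_
        refine mul_le_mul' le_rfl (add_le_add ?_ c4)
        refine (sqL2_add_le fun n => (m1 n).add (m2 n)).trans ?_
        refine mul_le_mul' le_rfl (add_le_add ?_ c3)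
        exact (sqL2_add_le m1).trans (mul_le_mul' le_rfl (add_le_add c1 c2))
    _ = _ := by ring

end

theorem lintegral_freqMeasure_const_mul_add {lam : ℝ} {f g : ℤ → ℝ → ℝ≥0∞} (c : ℝ≥0∞)
    (hf : ∀ m, Measurable (f m)) (hg : ∀ m, Measurable (g m)) :
    ∫⁻ m, (∫⁻ σ, c * (f m σ + g m σ)) ∂freqMeasure lam =
      c * (∫⁻ m, (∫⁻ σ, f m σ) ∂freqMeasure lam + ∫⁻ m, (∫⁻ σ, g m σ) ∂freqMeasure lam) := by
  rw [lintegral_freqMeasure_const_mul (f := fun m σ => f m σ + g m σ) c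
    fun m => (hf m).add (hg m), lintegral_freqMeasure_add hf]

section

variable {s lam β : ℝ} {f g : ℤ → ℝ → ℝ≥0∞} (hf : ∀ n, Measurable (f n))
  (hg : ∀ n, Measurable (g n))

include hf hg

theorem measurable_strongConv_integrand (n m : ℤ) (τ : ℝ) : Measurable fun σ =>
    ENNReal.ofReal (strongSum s (freq lam n) (freq lam m) (freq lam (n - m))
      (τ - disp lam β (freq lam n)) (σ - disp lam β (freq lam m))
      (τ - σ - disp lam β (freq lam (n - m)))) * (f m σ * g (n - m) (τ - σ)) := by
  have := hf m
  have := hg (n - m)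
  have := measurable_jb
  have := measurable_weight s (freq lam m)
  have := measurable_weight s (freq lam (n - m))
  simp only [strongSum]
  fun_prop

theorem measurable_strongConv (n : ℤ) : Measurable (strongConv s lam β f g n) := by
  refine measurable_lintegral_freqMeasure fun m => ?_
  have := hf m
  have := hg (n - m)
  have := measurable_jb
  have := measurable_weight s (freq lam m)
  have := measurable_weight s (freq lam (n - m))
  refine Measurable.lintegral_prod_right' (f := fun p : ℝ × ℝ =>
    ENNReal.ofReal (strongSum s (freq lam n) (freq lam m) (freq lam (n - m))
      (p.1 - disp lam β (freq lam n)) (p.2 - disp lam β (freq lam m))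
      (p.1 - p.2 - disp lam β (freq lam (n - m)))) * (f m p.2 * g (n - m) (p.1 - p.2))) ?_
  simp only [strongSum]
  fun_prop

theorem lconv_mul_le (n : ℤ) (τ : ℝ) {c : ℝ≥0∞} {K : ℤ → ℝ → ℝ≥0∞}
    (h : ∀ m σ, c * (f m σ * g (n - m) (τ - σ)) ≤ K m σ) :
    c * lconv lam f g n τ ≤ ∫⁻ m, (∫⁻ σ, K m σ) ∂freqMeasure lam := by
  rw [lconv, ← lintegral_freqMeasure_const_mul c fun m => by
    have := hf m
    have := hg (n - m)
    fun_prop]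
  exact lintegral_mono fun m => lintegral_mono fun σ => h m σ

variable (hs₁ : -3 / 2 ≤ s) (hs₂ : s ≤ -1) (hlam : 1 ≤ lam) (hβ : |β| ≤ 1)
  (hf₀ : ∀ τ, f 0 τ = 0) (hg₀ : ∀ τ, g 0 τ = 0)

omit hf hg in
include hs₁ hs₂ hlam hβ hf₀ hg₀ in
theorem output_integrand_bounds (n m : ℤ) (τ σ : ℝ) :
    ENNReal.ofReal (|freq lam n| * jb (τ - disp lam β (freq lam n)) ^ (-1 : ℝ) *
        weight s (freq lam n) (τ - disp lam β (freq lam n))) * (f m σ * g (n - m) (τ - σ)) ≤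
      ENNReal.ofReal (Real.exp 1000) * (
        ENNReal.ofReal (strongSum s (freq lam n) (freq lam m) (freq lam (n - m))
          (τ - disp lam β (freq lam n)) (σ - disp lam β (freq lam m))
          (τ - σ - disp lam β (freq lam (n - m)))) * (f m σ * g (n - m) (τ - σ)) +
        outputKernel lam β (n, τ) (m, σ) *
          (xWeighted s lam β f m σ * xWeighted s lam β g (n - m) (τ - σ))) ∧
    ENNReal.ofReal (|freq lam n| * jb (τ - disp lam β (freq lam n)) ^ (-1 : ℝ) *
        jb (freq lam n) ^ s) * (f m σ * g (n - m) (τ - σ)) ≤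
      ENNReal.ofReal (Real.exp 1000) * (
        ENNReal.ofReal (jb (τ - disp lam β (freq lam n)) ^ (-(3 / 4) : ℝ)) *
        (ENNReal.ofReal (strongSum s (freq lam n) (freq lam m) (freq lam (n - m))
          (τ - disp lam β (freq lam n)) (σ - disp lam β (freq lam m))
          (τ - σ - disp lam β (freq lam (n - m)))) * (f m σ * g (n - m) (τ - σ))) +
        rhoKernel s lam n m * (yWeighted s lam f m σ * yWeighted s lam g (n - m) (τ - σ))) := by
  -- The pointwise bounds need three nonzero frequencies. At k = 0 the derivative vanishes, and k₁ =
  -- 0 or k₂ = 0 is excluded by the mean-zero condition.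
  rcases eq_or_ne n 0 with rfl | hn
  · simp [freq]
  rcases eq_or_ne m 0 with rfl | hm
  · simp [hf₀]
  rcases eq_or_ne (n - m) 0 with h | hnm
  · simp [h, hg₀]
  have h0 : 0 < lam := one_pos.trans_le hlam
  obtain ⟨ha, hb⟩ := output_weight_bounds (s := s) (lam := lam) (β := β)
    (k := freq lam n) (k₁ := freq lam m) (k₂ := freq lam (n - m))
    (L := τ - disp lam β (freq lam n)) (L₁ := σ - disp lam β (freq lam m))
    (L₂ := τ - σ - disp lam β (freq lam (n - m))) hs₁ hs₂ hβ
    (inv_sq_le_freq lam hm) (freq_ne_zero h0 hm) (freq_ne_zero h0 hnm) (freq_ne_zero h0 hn)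
    (freq_add lam n m) h0 (by rw [freq_add lam n m, disp_add]; ring)
  have h1 := rho_nonneg s (freq lam n)
  have h2 := rho_nonneg s (freq lam m)
  have h3 := rho_nonneg s (freq lam (n - m))
  have h4 := highFreq_nonneg (freq lam n)
  have w1 := weight_pos s (freq lam m) (σ - disp lam β (freq lam m))
  have w2 := weight_pos s (freq lam (n - m)) (τ - σ - disp lam β (freq lam (n - m)))
  have := jb_rpow_pos (τ - disp lam β (freq lam n)) (-(3 / 4))
  have := jb_rpow_pos (σ - disp lam β (freq lam m)) (-(3 / 4))
  have := jb_rpow_pos (τ - σ - disp lam β (freq lam (n - m))) (-(3 / 4))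
  have := jb_rpow_pos (freq lam m) s
  have := jb_rpow_pos (freq lam (n - m)) s
  have hS := strongSum_nonneg (s := s) (k := freq lam n) (k₁ := freq lam m)
    (k₂ := freq lam (n - m)) (L := τ - disp lam β (freq lam n))
    (L₁ := σ - disp lam β (freq lam m)) (L₂ := τ - σ - disp lam β (freq lam (n - m)))
  constructor
  · refine (mul_le_mul' (ENNReal.ofReal_le_ofReal ha) le_rfl).trans_eq ?_
    rw [ENNReal.ofReal_mul (by positivity), ENNReal.ofReal_add hS (by positivity)]
    simp only [xWeighted, outputKernel]
    repeat rw [ENNReal.ofReal_mul (by positivity)]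
    ring
  · refine (mul_le_mul' (ENNReal.ofReal_le_ofReal hb) le_rfl).trans_eq ?_
    rw [ENNReal.ofReal_mul (by positivity), ENNReal.ofReal_add (by positivity) (by positivity)]
    simp only [yWeighted, ← ofReal_rho_add]
    repeat rw [ENNReal.ofReal_mul (by positivity)]
    ring

include hs₁ hs₂ hlam hβ hf₀ hg₀

theorem xWeighted_lconv_le (n : ℤ) (τ : ℝ) :
    xWeighted s lam β (fun n τ => ENNReal.ofReal (|freq lam n| *
      jb (τ - disp lam β (freq lam n)) ^ (-1 : ℝ)) * lconv lam f g n τ) n τ ≤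
    ENNReal.ofReal (Real.exp 1000) * (strongConv s lam β f g n τ +
      ∫⁻ m, (∫⁻ σ, outputKernel lam β (n, τ) (m, σ) * (xWeighted s lam β f m σ *
        xWeighted s lam β g (n - m) (τ - σ))) ∂freqMeasure lam) := by
  have m1 (m : ℤ) := measurable_strongConv_integrand (s := s) (lam := lam) (β := β) hf hg n m τ
  have m2 (m : ℤ) : Measurable fun σ => outputKernel lam β (n, τ) (m, σ) *
      (xWeighted s lam β f m σ * xWeighted s lam β g (n - m) (τ - σ)) := by
    have := measurable_xWeighted (s := s) (lam := lam) (β := β) hf m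
    have := measurable_xWeighted (s := s) (lam := lam) (β := β) hg (n - m)
    have := measurable_jb
    simp only [outputKernel]
    fun_prop
  rw [strongConv, xWeighted, ← mul_assoc, ← ENNReal.ofReal_mul (weight_pos _ _ _).le,
    mul_comm (weight _ _ _)]
  refine le_of_le_of_eq ?_ (lintegral_freqMeasure_const_mul_add _ m1 m2)
  exact lconv_mul_le hf hg n τ fun m σ =>
    (output_integrand_bounds hs₁ hs₂ hlam hβ hf₀ hg₀ n m τ σ).1

theorem yWeighted_lconv_le (n : ℤ) (τ : ℝ) :
    yWeighted s lam (fun n τ => ENNReal.ofReal (|freq lam n| *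
      jb (τ - disp lam β (freq lam n)) ^ (-1 : ℝ)) * lconv lam f g n τ) n τ ≤
    ENNReal.ofReal (Real.exp 1000) * (ENNReal.ofReal (jb (τ - disp lam β (freq lam n)) ^
      (-(3 / 4) : ℝ)) * strongConv s lam β f g n τ +
      ∫⁻ m, rhoKernel s lam n m * (∫⁻ σ, yWeighted s lam f m σ *
        yWeighted s lam g (n - m) (τ - σ)) ∂freqMeasure lam) := by
  have m1 (m : ℤ) := measurable_strongConv_integrand (s := s) (lam := lam) (β := β) hf hg n m τ
  have m2 (m : ℤ) : Measurable fun σ => yWeighted s lam f m σ *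
      yWeighted s lam g (n - m) (τ - σ) := by
    have := measurable_yWeighted (s := s) (lam := lam) hf m
    have := measurable_yWeighted (s := s) (lam := lam) hg (n - m)
    fun_prop
  simp_rw [← lintegral_const_mul _ (m2 _)]
  rw [strongConv, ← lintegral_freqMeasure_const_mul _ m1,
    yWeighted, ← mul_assoc, ← ENNReal.ofReal_mul (jb_rpow_pos _ _).le, mul_comm (jb _ ^ s)]
  refine le_of_le_of_eq ?_ (lintegral_freqMeasure_const_mul_add _ (fun m => (m1 m).const_mul _)
    fun m => (m2 m).const_mul _)
  exact lconv_mul_le hf hg n τ fun m σ =>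
    (output_integrand_bounds hs₁ hs₂ hlam hβ hf₀ hg₀ n m τ σ).2

theorem energy_lconv_le {A : ℝ≥0∞}
    (hA : ∫⁻ n, ENNReal.ofReal (rho s (freq lam n)) ^ 2 ∂freqMeasure lam ≤ A) :
    energy s lam β (fun n τ => ENNReal.ofReal (|freq lam n| *
      jb (τ - disp lam β (freq lam n)) ^ (-1 : ℝ)) * lconv lam f g n τ) ≤
    ENNReal.ofReal (Real.exp 1000) ^ 2 * (4 * ((596 * (1 + jbIntegral (3 / 2)) + 1) *
      (36 * A + 36 * A * jbIntegral (9 / 8) + kernelBound))) *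
      (energy s lam β f * energy s lam β g) := by
  have xf (n : ℤ) := measurable_xWeighted (s := s) (lam := lam) (β := β) hf n
  have xg (n : ℤ) := measurable_xWeighted (s := s) (lam := lam) (β := β) hg n
  have yf (n : ℤ) := measurable_yWeighted (s := s) (lam := lam) hf n
  have yg (n : ℤ) := measurable_yWeighted (s := s) (lam := lam) hg n
  have mS (n : ℤ) := measurable_strongConv (s := s) (lam := lam) (β := β) hf hg n
  have mW (n : ℤ) : Measurable fun τ => ENNReal.ofReal (jb (τ - disp lam β (freq lam n)) ^
      (-(3 / 4) : ℝ)) * strongConv s lam β f g n τ := by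
    have := mS n
    have := measurable_jb
    fun_prop
  have b0 := sqL2_strongConv_le (s := s) hf hg hlam hβ hA
  have b1 := bilinear_output hlam hβ xf xg
  have b2 := bilinear_rho_one yf yg hA
  have b3 := sqL1_modulation_le (lam := lam) β mS
  have hx := sqL2_mono (lam := lam) fun n τ =>
    xWeighted_lconv_le hf hg hs₁ hs₂ hlam hβ hf₀ hg₀ n τ
  have hy := sqL1_mono (lam := lam) fun n τ =>
    yWeighted_lconv_le hf hg hs₁ hs₂ hlam hβ hf₀ hg₀ n τ
  rw [sqL2_const_mul ENNReal.ofReal_ne_top] at hx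
  rw [sqL1_const_mul ENNReal.ofReal_ne_top] at hy
  have hE : sqL2 lam (xWeighted s lam β f) * sqL2 lam (xWeighted s lam β g) ≤
      energy s lam β f * energy s lam β g := mul_le_mul' le_self_add le_self_add
  have hE' : sqL1 lam (yWeighted s lam f) * sqL1 lam (yWeighted s lam g) ≤
      energy s lam β f * energy s lam β g := mul_le_mul' le_add_self le_add_self
  rw [energy]
  set E := energy s lam β f * energy s lam β g
  set J := jbIntegral (3 / 2)
  have d : 36 * A + kernelBound ≤ 36 * A + 36 * A * jbIntegral (9 / 8) + kernelBound :=
    add_le_add le_self_add le_rfl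
  set D := 36 * A + 36 * A * jbIntegral (9 / 8) + kernelBound
  set e := ENNReal.ofReal (Real.exp 1000) ^ 2
  calc _ ≤ e * (4 * (596 * (D * E) + kernelBound * E)) +
        e * (4 * (J * (596 * (D * E)) + 36 * A * E)) := by
        refine add_le_add (hx.trans (mul_le_mul' le_rfl ((sqL2_add_le mS).trans ?_)))
          (hy.trans (mul_le_mul' le_rfl ((sqL1_add_le mW).trans ?_)))
        · exact mul_le_mul' le_rfl (add_le_add b0 (b1.trans (mul_le_mul' le_rfl hE)))
        · exact mul_le_mul' le_rfl (add_le_add (b3.trans (mul_le_mul' le_rfl b0))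
            (b2.trans (mul_le_mul' le_rfl hE')))
    _ = e * (4 * (596 * (1 + J) * D + (36 * A + kernelBound))) * E := by ring
    _ ≤ e * (4 * (596 * (1 + J) * D + D)) * E := by gcongr
    _ = _ := by ring

end

/-- The bilinear estimate, for nonnegative functions. -/
theorem exists_energy_lconv_le {s : ℝ} (hs₁ : -3 / 2 ≤ s) (hs₂ : s < -1) :
    ∃ C : ℝ≥0∞, C < ∞ ∧ ∀ lam β : ℝ, 1 ≤ lam → |β| ≤ 1 → ∀ f g : ℤ → ℝ → ℝ≥0∞,
      (∀ n, Measurable (f n)) → (∀ n, Measurable (g n)) → (∀ τ, f 0 τ = 0) → (∀ τ, g 0 τ = 0) →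
      energy s lam β (fun n τ => ENNReal.ofReal (|freq lam n| *
        jb (τ - disp lam β (freq lam n)) ^ (-1 : ℝ)) * lconv lam f g n τ) ≤
      C * (energy s lam β f * energy s lam β g) := by
  obtain ⟨A, hA, h⟩ := exists_tsum_sq_rho_le hs₁ hs₂
  refine ⟨_, ?_, fun lam β hlam hβ f g hf hg hf₀ hg₀ =>
    energy_lconv_le hf hg hs₁ hs₂.le hlam hβ hf₀ hg₀ (h lam hlam)⟩
  have := jbIntegral_lt_top (p := 3 / 2) (by norm_num)
  have := jbIntegral_lt_top (p := 9 / 8) (by norm_num)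
  have := kernelBound_lt_top
  finiteness

/-! ### Comparison of the energy with the Z norm. -/

theorem log_jb_nonneg (x : ℝ) : 0 ≤ Real.log (jb x) := Real.log_nonneg (one_le_jb x)

theorem two_pow_forty_le_exp : (2 : ℝ) ^ 40 ≤ Real.exp 40 := by
  have := pow_le_pow_left₀ (by norm_num) (Real.add_one_le_exp 1) 40
  rw [← Real.exp_nat_mul] at this
  norm_num at this ⊢
  exact this

/-- Converts multiplicative comparisons, with constants up to 2⁴⁰ ≤ e⁴⁰, into the additive slack 40
of the weight bounds. -/
theorem log_jb_le_of_le_pow {k L c : ℝ} {m : ℕ} (h : jb L ≤ c * jb k ^ m) (hc : c ≤ 2 ^ 40) :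
    Real.log (jb L) ≤ m * Real.log (jb k) + 40 := by
  have h1 : jb L ≤ 2 ^ 40 * jb k ^ m := h.trans (by have := jb_pos k; gcongr)
  have h2 := two_pow_forty_le_exp
  have h3 : jb L ≤ Real.exp 40 * jb k ^ m := h1.trans (by have := jb_pos k; gcongr)
  have h4 := Real.log_le_log (jb_pos L) h3
  rwa [Real.log_mul (Real.exp_pos _).ne' (pow_pos (jb_pos k) m).ne', Real.log_exp, Real.log_pow,
    add_comm] at h4

theorem log_jb_mul_le_of_pow_le {k L c : ℝ} {m : ℕ} (h : jb k ^ m ≤ c * jb L) (hc : c ≤ 2 ^ 40) :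
    m * Real.log (jb k) ≤ Real.log (jb L) + 40 := by
  have h1 : jb k ^ m ≤ 2 ^ 40 * jb L := h.trans (by have := jb_pos L; gcongr)
  have h2 := two_pow_forty_le_exp
  have h3 : jb k ^ m ≤ Real.exp 40 * jb L := h1.trans (by have := jb_pos L; gcongr)
  have h4 := Real.log_le_log (pow_pos (jb_pos k) m) h3
  rwa [Real.log_mul (Real.exp_pos _).ne' (jb_pos L).ne', Real.log_exp, Real.log_pow,
    add_comm] at h4

theorem jb_le_two_mul_abs {k : ℝ} (hk : 1 ≤ |k|) : jb k ≤ 2 * |k| :=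
  (jb_le k).trans (by linarith)

theorem jb_le_of_abs_le_pow {k L : ℝ} {m : ℕ} (h : |L| ≤ |k| ^ m / 10) : jb L ≤ 2 * jb k ^ m := by
  have h1 : |k| ^ m ≤ jb k ^ m := pow_le_pow_left₀ (abs_nonneg k) (abs_le_jb k) m
  have h2 : 1 ≤ jb k ^ m := one_le_pow₀ (one_le_jb k)
  linarith [jb_le L]

theorem pow_jb_le_of_le_abs {k L : ℝ} {m : ℕ} (hk : 1 ≤ |k|) (h : |k| ^ m / 10 ≤ |L|) :
    jb k ^ m ≤ 10 * 2 ^ m * jb L := by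
  have h1 := pow_le_pow_left₀ (jb_pos k).le (jb_le_two_mul_abs hk) m
  rw [mul_pow] at h1
  have h2 : |k| ^ m ≤ 10 * jb L := by linarith [abs_le_jb L]
  calc _ ≤ 2 ^ m * |k| ^ m := h1
    _ ≤ 2 ^ m * (10 * jb L) := by gcongr
    _ = _ := by ring

theorem pow_jb_le_of_abs_le_one {k : ℝ} (L : ℝ) (m : ℕ) (hk : |k| ≤ 1) :
    jb k ^ m ≤ 2 ^ m * jb L := by
  have h1 := pow_le_pow_left₀ (jb_pos k).le ((jb_le k).trans (by linarith : 1 + |k| ≤ 2)) m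
  exact h1.trans (le_mul_of_one_le_right (by positivity) (one_le_jb L))

/-- The two weights are comparable, with constant `exp 100`. -/
def Comparable (x y : ℝ) : Prop := x ≤ Real.exp 100 * y ∧ y ≤ Real.exp 100 * x

theorem comparable_weight {s k L a b : ℝ}
    (h₁ : a * Real.log (jb k) + b * Real.log (jb L) - 100 ≤
      logWeight s (Real.log (jb k)) (Real.log (jb L)))
    (h₂ : logWeight s (Real.log (jb k)) (Real.log (jb L)) ≤
      a * Real.log (jb k) + b * Real.log (jb L) + 100) :
    Comparable (jb k ^ a * jb L ^ b) (weight s k L) := by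
  rw [weight_eq, jb_rpow_eq, jb_rpow_eq, ← Real.exp_add]
  constructor <;> rw [← Real.exp_add, Real.exp_le_exp] <;> linarith

section

variable {s lam β τ : ℝ} {n : ℤ} (hs₁ : -3 / 2 ≤ s) (hs₂ : s ≤ -1)

include hs₁ hs₂

theorem comparable_weight_of_mem_D₁ (h : (τ, freq lam n) ∈ D₁ lam β) :
    Comparable (jb (freq lam n) ^ s * jb (τ - disp lam β (freq lam n)) ^ (3 / 4 : ℝ))
      (weight s (freq lam n) (τ - disp lam β (freq lam n))) := by
  have h1 := log_jb_le_of_le_pow (jb_le_of_abs_le_pow h.1) (by norm_num)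
  push_cast at h1
  apply comparable_weight
  · linarith [le_logWeight_of_le hs₁ hs₂ h1]
  · have : logWeight s (Real.log (jb (freq lam n)))
      (Real.log (jb (τ - disp lam β (freq lam n)))) ≤ _ := min_le_left _ _
    linarith

theorem comparable_weight_of_mem_D₂ (h : (τ, freq lam n) ∈ D₂ lam β) :
    Comparable (jb (freq lam n) ^ (-3 * s - 1) * jb (τ - disp lam β (freq lam n)) ^ (s + 1))
      (weight s (freq lam n) (τ - disp lam β (freq lam n))) := by
  have h1 := log_jb_le_of_le_pow (jb_le_of_abs_le_pow h.2.1) (by norm_num)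
  have h2 := log_jb_mul_le_of_pow_le (pow_jb_le_of_le_abs h.2.2 h.1) (by norm_num)
  have hx := log_jb_nonneg (freq lam n)
  push_cast at h1 h2
  apply comparable_weight
  · linarith [le_logWeight_of_ge_left hs₁ hs₂ hx (sub_le_iff_le_add.2 h2)]
  · refine (min_le_right _ _).trans (max_le (by linarith) ?_)
    apply le_of_affine hs₁ hs₂ <;> [(intro; ring); linarith; linarith]

theorem comparable_weight_of_mem_D₃ (h : (τ, freq lam n) ∈ D₃ lam β) :
    Comparable (jb (freq lam n) ^ (-s / 2 - 1) *
        jb (τ - disp lam β (freq lam n)) ^ (s / 2 + 1))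
      (weight s (freq lam n) (τ - disp lam β (freq lam n))) := by
  have h2 : 5 * Real.log (jb (freq lam n)) ≤
      Real.log (jb (τ - disp lam β (freq lam n))) + 40 := by
    -- D₃ contains all nonzero frequencies with |k| ≤ 1, whatever the modulation; there ⟨k⟩ is
    -- bounded, so the inequality is trivial.
    rcases le_total |freq lam n| 1 with hk | hk
    · exact_mod_cast log_jb_mul_le_of_pow_le (pow_jb_le_of_abs_le_one _ 5 hk) (by norm_num)
    · rcases h with h | h
      · exact_mod_cast log_jb_mul_le_of_pow_le (pow_jb_le_of_le_abs hk h) (by norm_num)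
      · exact_mod_cast log_jb_mul_le_of_pow_le (pow_jb_le_of_abs_le_one _ 5 h.2) (by norm_num)
  have hx := log_jb_nonneg (freq lam n)
  apply comparable_weight
  · linarith [le_logWeight_of_ge_right hs₁ hs₂ hx (by linarith)]
  · refine (min_le_right _ _).trans (max_le ?_ (by linarith))
    apply le_of_affine hs₁ hs₂ <;> [(intro; ring); linarith; linarith]

end

theorem mem_D₁_or_D₂_or_D₃ {lam : ℝ} (hlam : 0 < lam) (β τ : ℝ) {n : ℤ} (hn : n ≠ 0) :
    (τ, freq lam n) ∈ D₁ lam β ∨ (τ, freq lam n) ∈ D₂ lam β ∨ (τ, freq lam n) ∈ D₃ lam β := by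
  have h0 : 1 / lam ≤ |freq lam n| := by
    rw [freq, abs_div, abs_of_pos hlam]
    have : (1 : ℝ) ≤ |(n : ℝ)| := by exact_mod_cast Int.one_le_abs hn
    gcongr
  simp only [D₁, D₂, D₃, Set.mem_ofPred_eq]
  rcases le_total |freq lam n| 1 with hk | hk
  · exact Or.inr (Or.inr (Or.inr ⟨h0, hk⟩))
  rcases le_total (|freq lam n| ^ 5 / 10) |τ - disp lam β (freq lam n)| with h5 | h5
  · exact Or.inr (Or.inr (Or.inl h5))
  rcases le_total (|freq lam n| ^ 4 / 10) |τ - disp lam β (freq lam n)| with h4 | h4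
  · exact Or.inr (Or.inl ⟨h4, h5, hk⟩)
  · exact Or.inl ⟨h4, hk⟩

theorem lintegral_freqMeasure_ne_zero (lam : ℝ) (h : ℤ → ℝ≥0∞) :
    ENNReal.ofReal lam⁻¹ * ∑' n : {n : ℤ // n ≠ 0}, h n =
      ∫⁻ n, {n : ℤ | n ≠ 0}.indicator h n ∂freqMeasure lam := by
  rw [lintegral_freqMeasure]
  congr 1
  exact tsum_subtype {n : ℤ | n ≠ 0} h

/-- The absolute value of a Fourier transform. -/
def absFT (F : FT) (n : ℤ) (τ : ℝ) : ℝ≥0∞ := ‖F n τ‖ₑ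

theorem yNorm_sq_le (s lam : ℝ) (F : FT) :
    yNorm lam s F ^ 2 ≤ sqL1 lam (yWeighted s lam (absFT F)) := by
  rw [yNorm, rpow_half_sq, lintegral_freqMeasure_ne_zero lam
    (fun n => (ENNReal.ofReal (jb (freq lam n) ^ s) * ∫⁻ τ : ℝ, ‖F n τ‖ₑ) ^ 2)]
  refine lintegral_mono fun n => Set.indicator_le_self' (fun _ _ => zero_le) n |>.trans ?_
  simp only [yWeighted, absFT, lintegral_const_mul' _ _ ENNReal.ofReal_ne_top, le_refl]

/-- The norm omits the zero frequency while `freqMeasure` charges it, so this direction needs the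
zero mode to vanish. -/
theorem sqL1_le_yNorm_sq (s lam : ℝ) {F : FT} (hF : ∀ τ, F 0 τ = 0) :
    sqL1 lam (yWeighted s lam (absFT F)) ≤ yNorm lam s F ^ 2 := by
  rw [yNorm, rpow_half_sq, lintegral_freqMeasure_ne_zero lam
    (fun n => (ENNReal.ofReal (jb (freq lam n) ^ s) * ∫⁻ τ : ℝ, ‖F n τ‖ₑ) ^ 2)]
  refine lintegral_mono fun n => ?_
  simp only [yWeighted, absFT, lintegral_const_mul' _ _ ENNReal.ofReal_ne_top]
  rcases eq_or_ne n 0 with rfl | hn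
  · simp [hF]
  · rw [Set.indicator_of_mem (show n ∈ {n : ℤ | n ≠ 0} from hn)]

theorem xNorm_sq (lam β a b : ℝ) (F : FT) : xNorm lam β a b F ^ 2 =
    ∫⁻ n, {n : ℤ | n ≠ 0}.indicator (fun n : ℤ => ∫⁻ τ : ℝ,
      (ENNReal.ofReal (jb (freq lam n) ^ a * jb (τ - disp lam β (freq lam n)) ^ b) *
        ‖F n τ‖ₑ) ^ 2) n ∂freqMeasure lam := by
  rw [xNorm, rpow_half_sq, ← lintegral_freqMeasure_ne_zero]

theorem xNorm_proj_sq_le {s lam β a b : ℝ} {D : Set (ℝ × ℝ)} (F : FT)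
    (h : ∀ (n : ℤ) (τ : ℝ), (τ, freq lam n) ∈ D →
      Comparable (jb (freq lam n) ^ a * jb (τ - disp lam β (freq lam n)) ^ b)
        (weight s (freq lam n) (τ - disp lam β (freq lam n)))) :
    xNorm lam β a b (proj lam D F) ^ 2 ≤
      ENNReal.ofReal (Real.exp 100) ^ 2 * sqL2 lam (xWeighted s lam β (absFT F)) := by
  rw [xNorm_sq, ← sqL2_const_mul ENNReal.ofReal_ne_top]
  refine lintegral_mono fun n => (Set.indicator_le_self' (fun _ _ => zero_le) n).trans
    (lintegral_mono fun τ => pow_le_pow_left' ?_ 2)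
  simp only [xWeighted, absFT, proj]
  rw [← mul_assoc, ← ENNReal.ofReal_mul (Real.exp_pos _).le]
  by_cases hD : (τ, freq lam n) ∈ D
  · rw [Set.indicator_of_mem (show τ ∈ {τ : ℝ | (τ, freq lam n) ∈ D} from hD)]
    exact mul_le_mul' (ENNReal.ofReal_le_ofReal (h n τ hD).1) le_rfl
  · rw [Set.indicator_of_notMem (show τ ∉ {τ : ℝ | (τ, freq lam n) ∈ D} from hD)]
    simp

theorem le_of_sq_le {x c e : ℝ≥0∞} (h : x ^ 2 ≤ c ^ 2 * e) : x ≤ c * e ^ (1 / 2 : ℝ) := by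
  have := ENNReal.rpow_le_rpow h (z := 1 / 2) (by norm_num)
  rwa [sq_rpow_half, ENNReal.mul_rpow_of_nonneg _ _ (by norm_num), sq_rpow_half] at this

theorem zNorm_le_energy {s lam β : ℝ} (hs₁ : -3 / 2 ≤ s) (hs₂ : s ≤ -1) (F : FT) :
    zNorm lam β s F ≤ (3 * ENNReal.ofReal (Real.exp 100) + 1) *
      energy s lam β (absFT F) ^ (1 / 2 : ℝ) := by
  have hE : sqL2 lam (xWeighted s lam β (absFT F)) ≤ energy s lam β (absFT F) := le_self_add
  have hE' : sqL1 lam (yWeighted s lam (absFT F)) ≤ energy s lam β (absFT F) := le_add_self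
  have h1 := le_of_sq_le ((xNorm_proj_sq_le F fun n τ =>
    comparable_weight_of_mem_D₁ (lam := lam) (β := β) hs₁ hs₂).trans (mul_le_mul' le_rfl hE))
  have h2 := le_of_sq_le ((xNorm_proj_sq_le F fun n τ =>
    comparable_weight_of_mem_D₂ (lam := lam) (β := β) hs₁ hs₂).trans (mul_le_mul' le_rfl hE))
  have h3 := le_of_sq_le ((xNorm_proj_sq_le F fun n τ =>
    comparable_weight_of_mem_D₃ (lam := lam) (β := β) hs₁ hs₂).trans (mul_le_mul' le_rfl hE))
  have h4 : yNorm lam s F ≤ 1 * energy s lam β (absFT F) ^ (1 / 2 : ℝ) :=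
    le_of_sq_le (by rw [one_pow, one_mul]; exact (yNorm_sq_le s lam F).trans hE')
  refine (add_le_add (add_le_add (add_le_add h1 h2) h3) h4).trans_eq (by ring)

theorem measurableSet_D₁_section (lam β k : ℝ) : MeasurableSet {τ : ℝ | (τ, k) ∈ D₁ lam β} := by
  have h : Measurable fun τ : ℝ => |τ - disp lam β k| := by fun_prop
  exact ((h (measurableSet_Iic (a := |k| ^ 4 / 10))).inter (MeasurableSet.const (1 ≤ |k|))).congr
    (Set.ext fun _ => Iff.rfl)

theorem measurableSet_D₂_section (lam β k : ℝ) : MeasurableSet {τ : ℝ | (τ, k) ∈ D₂ lam β} := by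
  have h : Measurable fun τ : ℝ => |τ - disp lam β k| := by fun_prop
  exact ((h (measurableSet_Ici (a := |k| ^ 4 / 10))).inter
    ((h (measurableSet_Iic (a := |k| ^ 5 / 10))).inter
    (MeasurableSet.const (1 ≤ |k|)))).congr (Set.ext fun _ => Iff.rfl)

/-- Additivity needs measurability of all summands but one, so D₃ needs no measurability argument.
-/
theorem lintegral_add_three {α : Type*} [MeasurableSpace α] {μ : Measure α} {u v : α → ℝ≥0∞}
    (w : α → ℝ≥0∞) (hu : AEMeasurable u μ) (hv : AEMeasurable v μ) :
    ∫⁻ a, u a + v a + w a ∂μ = ∫⁻ a, u a ∂μ + ∫⁻ a, v a ∂μ + ∫⁻ a, w a ∂μ := by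
  rw [lintegral_add_left' (f := fun a => u a + v a) (hu.add hv), lintegral_add_left' hu]

theorem aemeasurable_xNorm_integrand {lam β a b : ℝ} {D : Set (ℝ × ℝ)} {F : FT} {n : ℤ}
    (hF : AEStronglyMeasurable (F n) volume)
    (hD : MeasurableSet {τ : ℝ | (τ, freq lam n) ∈ D}) :
    AEMeasurable (fun τ => (ENNReal.ofReal (jb (freq lam n) ^ a *
      jb (τ - disp lam β (freq lam n)) ^ b) * ‖proj lam D F n τ‖ₑ) ^ 2) volume := by
  have h : AEStronglyMeasurable (proj lam D F n) volume := hF.indicator hD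
  have := measurable_jb
  exact ((Measurable.aemeasurable (by fun_prop)).mul h.enorm).pow_const 2

theorem energy_le_zNorm {s lam β : ℝ} (hs₁ : -3 / 2 ≤ s) (hs₂ : s ≤ -1) (hlam : 0 < lam) {F : FT}
    (hF : ∀ n, AEStronglyMeasurable (F n) volume) (hF₀ : ∀ τ, F 0 τ = 0) :
    energy s lam β (absFT F) ≤ ENNReal.ofReal (Real.exp 100) ^ 2 * zNorm lam β s F ^ 2 := by
  set e := ENNReal.ofReal (Real.exp 100) with he
  have he1 : 1 ≤ e := by
    rw [he, ENNReal.one_le_ofReal]; exact Real.one_le_exp (by norm_num)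
  have key : sqL2 lam (xWeighted s lam β (absFT F)) ≤ e ^ 2 *
      (xNorm lam β s (3 / 4) (proj lam (D₁ lam β) F) ^ 2 +
        xNorm lam β (-3 * s - 1) (s + 1) (proj lam (D₂ lam β) F) ^ 2 +
        xNorm lam β (-s / 2 - 1) (s / 2 + 1) (proj lam (D₃ lam β) F) ^ 2) := by
    rw [xNorm_sq, xNorm_sq, xNorm_sq, ← lintegral_add_left .of_discrete,
      ← lintegral_add_left .of_discrete, ← lintegral_const_mul _ .of_discrete, sqL2]
    refine lintegral_mono fun n => ?_
    rcases eq_or_ne n 0 with rfl | hn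
    · simp [xWeighted, absFT, hF₀]
    simp only [Set.indicator_of_mem (show n ∈ {n : ℤ | n ≠ 0} from hn)]
    have m1 := aemeasurable_xNorm_integrand (lam := lam) (β := β) (a := s) (b := 3 / 4) (hF n)
      (measurableSet_D₁_section lam β (freq lam n))
    have m2 := aemeasurable_xNorm_integrand (lam := lam) (β := β) (a := -3 * s - 1) (b := s + 1)
      (hF n) (measurableSet_D₂_section lam β (freq lam n))
    rw [← lintegral_add_three _ m1 m2,
      ← lintegral_const_mul' _ _ (ENNReal.pow_ne_top ENNReal.ofReal_ne_top)]
    refine lintegral_mono fun τ => ?_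
    have bound {a b : ℝ} {D : Set (ℝ × ℝ)} (hD : (τ, freq lam n) ∈ D)
        (h : Comparable (jb (freq lam n) ^ a * jb (τ - disp lam β (freq lam n)) ^ b)
          (weight s (freq lam n) (τ - disp lam β (freq lam n)))) :
        xWeighted s lam β (absFT F) n τ ^ 2 ≤ e ^ 2 * (ENNReal.ofReal (jb (freq lam n) ^ a *
          jb (τ - disp lam β (freq lam n)) ^ b) * ‖proj lam D F n τ‖ₑ) ^ 2 := by
      rw [← mul_pow, xWeighted, ← mul_assoc, he, ← ENNReal.ofReal_mul (Real.exp_pos _).le, proj,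
        Set.indicator_of_mem (show τ ∈ {τ : ℝ | (τ, freq lam n) ∈ D} from hD), absFT]
      exact pow_le_pow_left' (mul_le_mul' (ENNReal.ofReal_le_ofReal h.2) le_rfl) 2
    rcases mem_D₁_or_D₂_or_D₃ hlam β τ hn with h | h | h
    · exact (bound h (comparable_weight_of_mem_D₁ hs₁ hs₂ h)).trans
        (mul_le_mul' le_rfl (le_self_add.trans le_self_add))
    · exact (bound h (comparable_weight_of_mem_D₂ hs₁ hs₂ h)).trans
        (mul_le_mul' le_rfl (le_add_self.trans le_self_add))
    · exact (bound h (comparable_weight_of_mem_D₃ hs₁ hs₂ h)).trans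
        (mul_le_mul' le_rfl le_add_self)
  have hy := sqL1_le_yNorm_sq s lam hF₀
  rw [energy, zNorm]
  generalize xNorm lam β s (3 / 4) (proj lam (D₁ lam β) F) = x₁ at *
  generalize xNorm lam β (-3 * s - 1) (s + 1) (proj lam (D₂ lam β) F) = x₂ at *
  generalize xNorm lam β (-s / 2 - 1) (s / 2 + 1) (proj lam (D₃ lam β) F) = x₃ at *
  generalize yNorm lam s F = y at *
  have hadd (a b : ℝ≥0∞) : a ^ 2 + b ^ 2 ≤ (a + b) ^ 2 := by
    rw [add_sq, add_right_comm]; exact le_self_add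
  calc _ ≤ e ^ 2 * (x₁ ^ 2 + x₂ ^ 2 + x₃ ^ 2) + e ^ 2 * y ^ 2 :=
        add_le_add key (hy.trans (le_mul_of_one_le_left (zero_le) (one_le_pow₀ he1)))
    _ = e ^ 2 * (x₁ ^ 2 + x₂ ^ 2 + x₃ ^ 2 + y ^ 2) := by ring
    _ ≤ _ := by
        refine mul_le_mul' le_rfl (le_trans ?_ (hadd _ _))
        refine add_le_add (le_trans ?_ (hadd _ _)) le_rfl
        exact add_le_add (hadd _ _) le_rfl

/-! ### From nonnegative functions to complex Fourier transforms. -/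

theorem exists_stronglyMeasurable_modification {F : FT}
    (hF : ∀ n, AEStronglyMeasurable (F n) volume) (hF₀ : ∀ τ, F 0 τ = 0) :
    ∃ F' : FT, (∀ n, StronglyMeasurable (F' n)) ∧ (∀ τ, F' 0 τ = 0) ∧ ∀ n, F n =ᵐ[volume] F' n := by
  refine ⟨fun n => if n = 0 then 0 else (hF n).mk (F n), fun n => ?_, fun τ => by simp, fun n => ?_⟩
  · dsimp only
    split_ifs
    · exact stronglyMeasurable_zero
    · exact (hF n).stronglyMeasurable_mk
  · dsimp only
    split_ifs with h
    · subst h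
      exact .of_forall fun τ => hF₀ τ
    · exact (hF n).ae_eq_mk

theorem measurable_absFT {F : FT} (hF : ∀ n, StronglyMeasurable (F n)) (n : ℤ) :
    Measurable (absFT F n) := (hF n).enorm

theorem energy_congr_ae {s lam β : ℝ} {f g : ℤ → ℝ → ℝ≥0∞} (h : ∀ n, f n =ᵐ[volume] g n) :
    energy s lam β f = energy s lam β g := by
  have hx (n : ℤ) : ∫⁻ τ, xWeighted s lam β f n τ ^ 2 = ∫⁻ τ, xWeighted s lam β g n τ ^ 2 :=
    lintegral_congr_ae ((h n).mono fun τ hτ => by simp only [xWeighted, hτ])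
  have hy (n : ℤ) : ∫⁻ τ, yWeighted s lam f n τ = ∫⁻ τ, yWeighted s lam g n τ :=
    lintegral_congr_ae ((h n).mono fun τ hτ => by simp only [yWeighted, hτ])
  simp only [energy, sqL2, sqL1, hx, hy]

theorem energy_mono {s lam β : ℝ} {f g : ℤ → ℝ → ℝ≥0∞} (h : ∀ n τ, f n τ ≤ g n τ) :
    energy s lam β f ≤ energy s lam β g :=
  add_le_add (sqL2_mono fun n τ => mul_le_mul' le_rfl (h n τ))
    (sqL1_mono fun n τ => mul_le_mul' le_rfl (h n τ))

section

variable {F G F' G' : FT} (hF : ∀ n, F n =ᵐ[volume] F' n) (hG : ∀ n, G n =ᵐ[volume] G' n)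

include hF hG

theorem mul_sub_ae_eq (n m : ℤ) (τ : ℝ) :
    (fun σ => F m σ * G (n - m) (τ - σ)) =ᵐ[volume] fun σ => F' m σ * G' (n - m) (τ - σ) :=
  (hF m).mul ((quasiMeasurePreserving_sub_left volume τ).ae_eq_comp (hG (n - m)))

theorem fourierProduct_congr_ae (lam : ℝ) : fourierProduct lam F G = fourierProduct lam F' G' := by
  funext n τ
  simp only [fourierProduct, integral_congr_ae (mul_sub_ae_eq hF hG n _ τ)]

theorem lintegral_enorm_mul_congr_ae (n m : ℤ) (τ : ℝ) :
    ∫⁻ σ, ‖F m σ‖ₑ * ‖G (n - m) (τ - σ)‖ₑ = ∫⁻ σ, ‖F' m σ‖ₑ * ‖G' (n - m) (τ - σ)‖ₑ := by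
  simp_rw [← enorm_mul]
  exact lintegral_congr_ae ((mul_sub_ae_eq hF hG n m τ).mono fun σ h => congrArg enorm h)

end

theorem measurable_fourierProduct (lam : ℝ) {F G : FT} (hF : ∀ n, StronglyMeasurable (F n))
    (hG : ∀ n, StronglyMeasurable (G n)) (n : ℤ) : Measurable (fourierProduct lam F G n) := by
  refine Measurable.const_mul (Measurable.tsum fun m => ?_) _
  have h : StronglyMeasurable fun p : ℝ × ℝ => F m p.2 * G (n - m) (p.1 - p.2) :=
    ((hF m).comp_measurable measurable_snd).mul
      ((hG (n - m)).comp_measurable (measurable_fst.sub measurable_snd))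
  exact h.integral_prod_right'.measurable

/-- The factor 1/(2π) ≤ 1 is dropped. The bound also covers divergent integrals and sums, to which
the value 0 is assigned. -/
theorem enorm_fourierProduct_le {lam : ℝ} (hlam : 0 < lam) (F G : FT) (n : ℤ) (τ : ℝ) :
    ‖fourierProduct lam F G n τ‖ₑ ≤ lconv lam (absFT F) (absFT G) n τ := by
  have hπ : (2 * Real.pi)⁻¹ * lam⁻¹ ≤ lam⁻¹ := by
    refine mul_le_of_le_one_left (by positivity) (inv_le_one_of_one_le₀ ?_)
    linarith [Real.two_le_pi]
  rw [fourierProduct, enorm_mul, lconv, lintegral_freqMeasure]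
  refine mul_le_mul' ?_ (enorm_tsum_le_tsum_enorm.trans (ENNReal.tsum_le_tsum fun m => ?_))
  · rw [← ofReal_norm, Complex.norm_real, Real.norm_of_nonneg (by positivity)]
    exact ENNReal.ofReal_le_ofReal hπ
  · refine (enorm_integral_le_lintegral_enorm _).trans_eq ?_
    simp only [absFT, enorm_mul]

theorem enorm_output_le {lam : ℝ} (hlam : 0 < lam) (β : ℝ) (F G : FT) (n : ℤ) (τ : ℝ) :
    absFT (bigLambda lam β (-1) (dx lam (fourierProduct lam F G))) n τ ≤
      ENNReal.ofReal (|freq lam n| * jb (τ - disp lam β (freq lam n)) ^ (-1 : ℝ)) *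
        lconv lam (absFT F) (absFT G) n τ := by
  have h := jb_rpow_pos (τ - disp lam β (freq lam n)) (-1)
  rw [absFT, bigLambda, dx, enorm_mul, enorm_mul, ← mul_assoc]
  refine mul_le_mul' (le_of_eq ?_) (enorm_fourierProduct_le hlam F G n τ)
  rw [← enorm_mul, ← ofReal_norm, norm_mul, norm_mul, Complex.norm_I, Complex.norm_real,
    Complex.norm_real, Real.norm_of_nonneg h.le, Real.norm_eq_abs, one_mul, mul_comm]

/-- The bilinear estimate, in terms of the `Z^s` norm, for the majorant of the output. -/
theorem exists_zNorm_output_le {s : ℝ} (hs₁ : -3 / 2 ≤ s) (hs₂ : s < -1) :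
    ∃ C : ℝ≥0∞, C < ∞ ∧ ∀ lam β : ℝ, 1 ≤ lam → |β| ≤ 1 → ∀ F G : FT,
      (∀ n, AEStronglyMeasurable (F n) volume) → (∀ n, AEStronglyMeasurable (G n) volume) →
      (∀ τ, F 0 τ = 0) → (∀ τ, G 0 τ = 0) →
      energy s lam β (fun n τ => ENNReal.ofReal (|freq lam n| *
        jb (τ - disp lam β (freq lam n)) ^ (-1 : ℝ)) * lconv lam (absFT F) (absFT G) n τ) ≤
        C ^ 2 * (zNorm lam β s F * zNorm lam β s G) ^ 2 ∧
      zNorm lam β s (bigLambda lam β (-1) (dx lam (fourierProduct lam F G))) ≤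
        C * zNorm lam β s F * zNorm lam β s G := by
  obtain ⟨C₀, hC₀, h⟩ := exists_energy_lconv_le hs₁ hs₂
  set e := ENNReal.ofReal (Real.exp 100) with he
  set C := (3 * e + 1) * (C₀ ^ (1 / 2 : ℝ) * e ^ 2) with hC
  have he_top : e < ∞ := ENNReal.ofReal_lt_top
  have hC_le : C₀ ^ (1 / 2 : ℝ) * e ^ 2 ≤ C := le_mul_of_one_le_left zero_le le_add_self
  refine ⟨C, ?_, fun lam β hlam hβ F G hF hG hF₀ hG₀ => ?_⟩
  · have := ENNReal.rpow_lt_top_of_nonneg (y := 1 / 2) (by norm_num) hC₀.ne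
    finiteness
  have h0 : 0 < lam := one_pos.trans_le hlam
  obtain ⟨F', hF'm, hF'₀, hFF'⟩ := exists_stronglyMeasurable_modification hF hF₀
  obtain ⟨G', hG'm, hG'₀, hGG'⟩ := exists_stronglyMeasurable_modification hG hG₀
  have hconv : lconv lam (absFT F) (absFT G) = lconv lam (absFT F') (absFT G') := by
    funext n τ
    simp only [lconv, absFT, lintegral_enorm_mul_congr_ae hFF' hGG']
  have e1 : energy s lam β (absFT F') = energy s lam β (absFT F) :=
    energy_congr_ae fun n => (hFF' n).symm.mono fun τ h => congrArg enorm h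
  have e2 : energy s lam β (absFT G') = energy s lam β (absFT G) :=
    energy_congr_ae fun n => (hGG' n).symm.mono fun τ h => congrArg enorm h
  have key : energy s lam β (fun n τ => ENNReal.ofReal (|freq lam n| *
        jb (τ - disp lam β (freq lam n)) ^ (-1 : ℝ)) * lconv lam (absFT F) (absFT G) n τ) ≤
      (C₀ ^ (1 / 2 : ℝ) * e ^ 2) ^ 2 * (zNorm lam β s F * zNorm lam β s G) ^ 2 := by
    rw [hconv]
    refine (h lam β hlam hβ _ _ (measurable_absFT hF'm) (measurable_absFT hG'm)
      (fun τ => by simp [absFT, hF'₀]) fun τ => by simp [absFT, hG'₀]).trans ?_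
    rw [e1, e2, mul_pow, rpow_half_sq]
    calc _ ≤ C₀ * (e ^ 2 * zNorm lam β s F ^ 2 * (e ^ 2 * zNorm lam β s G ^ 2)) :=
          mul_le_mul' le_rfl (mul_le_mul' (energy_le_zNorm hs₁ hs₂.le h0 hF hF₀)
            (energy_le_zNorm hs₁ hs₂.le h0 hG hG₀))
      _ = _ := by ring
  refine ⟨key.trans (mul_le_mul' (pow_le_pow_left' hC_le 2) le_rfl), ?_⟩
  refine (zNorm_le_energy hs₁ hs₂.le _).trans ?_
  rw [mul_assoc C, hC, mul_assoc]
  refine mul_le_mul' le_rfl ?_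
  have h1 := ENNReal.rpow_le_rpow ((energy_mono (enorm_output_le h0 β F G)).trans key)
    (z := 1 / 2) (by norm_num)
  rwa [← mul_pow, sq_rpow_half] at h1

/-- The Y part of the energy bounds an integral in τ of the convolution times a factor that is
positive for k ≠ 0, so the convolution is finite almost everywhere. -/
theorem ae_lconv_lt_top {s lam β : ℝ} (hlam : 0 < lam) {f g : ℤ → ℝ → ℝ≥0∞}
    (hf : ∀ n, Measurable (f n)) (hg : ∀ n, Measurable (g n))
    (h : energy s lam β (fun n τ => ENNReal.ofReal (|freq lam n| *
      jb (τ - disp lam β (freq lam n)) ^ (-1 : ℝ)) * lconv lam f g n τ) < ∞) {n : ℤ} (hn : n ≠ 0) :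
    ∀ᵐ τ, ∑' m, ∫⁻ σ, f m σ * g (n - m) (τ - σ) < ∞ := by
  have hlam' : ENNReal.ofReal lam⁻¹ ≠ 0 := by simpa using hlam
  have h1 := le_add_self.trans_lt h
  rw [sqL1, lintegral_freqMeasure] at h1
  have h2 := ENNReal.lt_top_of_mul_ne_top_right h1.ne hlam'
  have h3 := (ENNReal.le_tsum n).trans_lt h2
  have h4 := (ENNReal.pow_lt_top_iff.1 h3).resolve_right two_ne_zero
  have hm : Measurable fun τ => yWeighted s lam (fun n τ => ENNReal.ofReal (|freq lam n| *
      jb (τ - disp lam β (freq lam n)) ^ (-1 : ℝ)) * lconv lam f g n τ) n τ := by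
    have := measurable_jb
    have := measurable_lconv (lam := lam) hf hg n
    unfold yWeighted
    fun_prop
  filter_upwards [ae_lt_top hm h4.ne] with τ hτ
  have c1 : ENNReal.ofReal (jb (freq lam n) ^ s) ≠ 0 := by simpa using jb_rpow_pos _ _
  have c2 : ENNReal.ofReal (|freq lam n| * jb (τ - disp lam β (freq lam n)) ^ (-1 : ℝ)) ≠ 0 := by
    have := abs_pos.2 (freq_ne_zero hlam hn)
    have := jb_rpow_pos (τ - disp lam β (freq lam n)) (-1)
    simp only [ne_eq, ENNReal.ofReal_eq_zero, not_le]
    positivity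
  have h5 := ENNReal.lt_top_of_mul_ne_top_right
    (ENNReal.lt_top_of_mul_ne_top_right hτ.ne c1).ne c2
  rw [lconv, lintegral_freqMeasure] at h5
  exact ENNReal.lt_top_of_mul_ne_top_right h5.ne hlam'

/-- The bilinear estimate for functions given by their Fourier transforms. -/
theorem bilinear_of_memZ {s lam β : ℝ} (hlam : 0 < lam) {C : ℝ≥0∞} (hC : C < ∞) {F G : FT}
    (hF : MemZ lam β s F) (hG : MemZ lam β s G)
    (h : energy s lam β (fun n τ => ENNReal.ofReal (|freq lam n| *
        jb (τ - disp lam β (freq lam n)) ^ (-1 : ℝ)) * lconv lam (absFT F) (absFT G) n τ) ≤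
        C ^ 2 * (zNorm lam β s F * zNorm lam β s G) ^ 2)
    (hZ : zNorm lam β s (bigLambda lam β (-1) (dx lam (fourierProduct lam F G))) ≤
        C * zNorm lam β s F * zNorm lam β s G) :
    (∀ n : ℤ, n ≠ 0 → ∀ᵐ τ : ℝ, ∑' m : ℤ, ∫⁻ σ : ℝ, ‖F m σ‖ₑ * ‖G (n - m) (τ - σ)‖ₑ < ∞) ∧
      MemZ lam β s (bigLambda lam β (-1) (dx lam (fourierProduct lam F G))) := by
  have hFf := hF.finite
  have hGf := hG.finite
  obtain ⟨F', hF'm, hF'₀, hFF'⟩ :=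
    exists_stronglyMeasurable_modification hF.measurable hF.zero_mode
  obtain ⟨G', hG'm, hG'₀, hGG'⟩ :=
    exists_stronglyMeasurable_modification hG.measurable hG.zero_mode
  have hconv : lconv lam (absFT F) (absFT G) = lconv lam (absFT F') (absFT G') := by
    funext n τ
    simp only [lconv, absFT, lintegral_enorm_mul_congr_ae hFF' hGG']
  refine ⟨fun n hn => ?_, ⟨fun n => ?_, fun τ => ?_, ?_⟩⟩
  · simp only [lintegral_enorm_mul_congr_ae hFF' hGG']
    refine ae_lconv_lt_top (s := s) (β := β) hlam (measurable_absFT hF'm) (measurable_absFT hG'm)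
      ?_ hn
    rw [← hconv]
    exact h.trans_lt (by finiteness)
  · rw [fourierProduct_congr_ae hFF' hGG']
    have := measurable_fourierProduct lam hF'm hG'm n
    have := measurable_jb
    refine Measurable.aestronglyMeasurable ?_
    unfold bigLambda dx
    fun_prop
  · simp [bigLambda, dx, freq]
  · exact hZ.trans_lt (by finiteness)

/-! ### The Fourier transform in time: decay, inversion, products. -/

/-- The Fourier transform in time, `∫ e^{-itτ} c(t) dt`. -/
def timeFourier (c : ℝ → ℂ) (τ : ℝ) : ℂ :=
  ∫ t : ℝ, Complex.exp (-(Complex.I * ((t * τ : ℝ) : ℂ))) * c t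

theorem norm_exp_neg_I_mul (x : ℝ) : ‖Complex.exp (-(Complex.I * (x : ℂ)))‖ = 1 := by
  rw [show -(Complex.I * (x : ℂ)) = ((-x : ℝ) : ℂ) * Complex.I by push_cast; ring,
    Complex.norm_exp_ofReal_mul_I]

theorem timeFourier_eq (c : ℝ → ℂ) (τ : ℝ) :
    timeFourier c τ = FourierTransform.fourier c (τ / (2 * Real.pi)) := by
  rw [Real.fourier_real_eq_integral_exp_smul, timeFourier]
  refine integral_congr_ae (.of_forall fun t => ?_)
  dsimp only
  rw [smul_eq_mul]
  congr 2
  have : (Real.pi : ℂ) ≠ 0 := Complex.ofReal_ne_zero.2 Real.pi_ne_zero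
  push_cast
  field_simp

theorem norm_timeFourier_le (c : ℝ → ℂ) (τ : ℝ) : ‖timeFourier c τ‖ ≤ ∫ t, ‖c t‖ := by
  refine (norm_integral_le_integral_norm _).trans_eq ?_
  simp only [norm_mul, norm_exp_neg_I_mul, one_mul]

theorem integrable_exp_mul {c : ℝ → ℂ} (hc : Integrable c) (τ : ℝ) :
    Integrable fun t : ℝ => Complex.exp (-(Complex.I * ((t * τ : ℝ) : ℂ))) * c t := by
  refine hc.bdd_mul (c := 1) (Continuous.aestronglyMeasurable (by fun_prop))
    (.of_forall fun t => (norm_exp_neg_I_mul _).le)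

theorem continuous_timeFourier {c : ℝ → ℂ} (hc : Integrable c) : Continuous (timeFourier c) := by
  refine continuous_of_dominated (bound := fun t => ‖c t‖)
    (fun τ => (integrable_exp_mul hc τ).aestronglyMeasurable) (fun τ => .of_forall fun t => ?_)
    hc.norm (.of_forall fun t => by fun_prop)
  rw [norm_mul, norm_exp_neg_I_mul, one_mul]

theorem timeFourier_deriv {c c' : ℝ → ℂ} (hc : Integrable c) (hc' : Integrable c')
    (h : ∀ t, HasDerivAt c (c' t) t) (τ : ℝ) :
    timeFourier c' τ = Complex.I * τ * timeFourier c τ := by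
  have e : deriv c = c' := funext fun t => (h t).deriv
  have := congrFun (Real.fourier_deriv hc (fun t => (h t).differentiableAt) (e ▸ hc'))
    (τ / (2 * Real.pi))
  rw [e] at this
  rw [timeFourier_eq, timeFourier_eq, this, smul_eq_mul]
  have : (Real.pi : ℂ) ≠ 0 := Complex.ofReal_ne_zero.2 Real.pi_ne_zero
  push_cast
  field_simp

/-- Two integrable derivatives give decay like (1 + τ²)⁻¹. -/
theorem integrable_timeFourier {c c' c'' : ℝ → ℂ} (hc : Integrable c) (hc' : Integrable c')
    (hc'' : Integrable c'') (h : ∀ t, HasDerivAt c (c' t) t) (h' : ∀ t, HasDerivAt c' (c'' t) t) :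
    Integrable (timeFourier c) := by
  refine (integrable_inv_one_add_sq.const_mul ((∫ t, ‖c t‖) + ∫ t, ‖c'' t‖)).mono'
    (continuous_timeFourier hc).aestronglyMeasurable (.of_forall fun τ => ?_)
  have e : timeFourier c'' τ = -((τ ^ 2 : ℝ) : ℂ) * timeFourier c τ := by
    rw [timeFourier_deriv hc' hc'' h', timeFourier_deriv hc hc' h]
    push_cast
    linear_combination (τ : ℂ) ^ 2 * timeFourier c τ * Complex.I_sq
  have h1 := norm_timeFourier_le c τ
  have h2 := norm_timeFourier_le c'' τ
  rw [e, norm_mul, norm_neg, Complex.norm_real, Real.norm_of_nonneg (sq_nonneg τ)] at h2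
  rw [← div_eq_mul_inv, le_div_iff₀ (by positivity)]
  linarith

theorem integral_exp_mul_timeFourier {c : ℝ → ℂ} (hcont : Continuous c) (hc : Integrable c)
    (hF : Integrable (timeFourier c)) (t : ℝ) :
    ∫ σ : ℝ, Complex.exp (Complex.I * ((t * σ : ℝ) : ℂ)) * timeFourier c σ =
      2 * Real.pi * c t := by
  have hπ : (Real.pi : ℂ) ≠ 0 := Complex.ofReal_ne_zero.2 Real.pi_ne_zero
  have h2π : 2 * Real.pi ≠ 0 := by positivity
  have hF' : Integrable (FourierTransform.fourier c) := by
    have := hF.comp_mul_right' h2π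
    refine this.congr (.of_forall fun τ => ?_)
    dsimp only
    rw [timeFourier_eq, mul_div_cancel_right₀ _ h2π]
  have h1 := congrFun (hcont.fourierInv_fourier_eq hc hF') t
  rw [Real.fourierInv_eq'] at h1
  have h2 := Measure.integral_comp_div (fun w : ℝ =>
    Complex.exp (((2 * Real.pi * inner ℝ w t : ℝ) : ℂ) * Complex.I) • FourierTransform.fourier c w) (2 * Real.pi)
  rw [h1, abs_of_pos (by positivity)] at h2
  rw [← smul_eq_mul (2 * (Real.pi : ℂ))]
  refine Eq.trans (integral_congr_ae (.of_forall fun σ => ?_)) (h2.trans ?_)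
  · dsimp only
    rw [timeFourier_eq, smul_eq_mul]
    congr 2
    rw [RCLike.inner_apply, conj_trivial]
    push_cast
    field_simp
  · rw [Complex.real_smul]; simp

theorem integral_timeFourier_mul {c g : ℝ → ℂ} (hc : Integrable c) (hg : Integrable g) :
    ∫ σ, timeFourier c σ * g σ = ∫ t, c t * timeFourier g t := by
  have h : Integrable (fun p : ℝ × ℝ =>
      Complex.exp (-(Complex.I * ((p.2 * p.1 : ℝ) : ℂ))) * (g p.1 * c p.2))
      (volume.prod volume) :=
    (hg.mul_prod hc).bdd_mul (c := 1) (Continuous.aestronglyMeasurable (by fun_prop))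
      (.of_forall fun p => (norm_exp_neg_I_mul _).le)
  have h1 := integral_integral_swap (f := fun σ t : ℝ =>
    Complex.exp (-(Complex.I * ((t * σ : ℝ) : ℂ))) * (g σ * c t)) h
  simp only [timeFourier, ← integral_mul_const, ← integral_const_mul]
  refine Eq.trans ?_ (h1.trans ?_)
  · refine integral_congr_ae (.of_forall fun σ => integral_congr_ae (.of_forall fun t => ?_))
    dsimp only
    ring
  · refine integral_congr_ae (.of_forall fun t => integral_congr_ae (.of_forall fun σ => ?_))
    dsimp only
    rw [mul_comm t σ]
    ring

/-- The Fourier transform takes products to convolutions. -/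
theorem integral_timeFourier_mul_timeFourier {c d : ℝ → ℂ} (hc : Integrable c)
    (hdcont : Continuous d) (hd : Integrable d) (hF : Integrable (timeFourier d)) (τ : ℝ) :
    ∫ σ, timeFourier c σ * timeFourier d (τ - σ) =
      2 * Real.pi * timeFourier (fun t => c t * d t) τ := by
  -- The multiplication formula moves the transform from `c` to the reflected transform of `d`,
  -- where Fourier inversion recovers `d`.
  rw [integral_timeFourier_mul hc (g := fun σ => timeFourier d (τ - σ)) (hF.comp_sub_left τ),
    timeFourier, ← integral_const_mul]
  refine integral_congr_ae (.of_forall fun t => ?_)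
  dsimp only
  have h : timeFourier (fun σ => timeFourier d (τ - σ)) t =
      Complex.exp (-(Complex.I * ((t * τ : ℝ) : ℂ))) * (2 * Real.pi * d t) := by
    rw [← integral_exp_mul_timeFourier hdcont hd hF t, ← integral_const_mul, timeFourier,
      ← integral_sub_left_eq_self (fun σ => Complex.exp (-(Complex.I * ((σ * t : ℝ) : ℂ))) *
        timeFourier d (τ - σ)) volume τ]
    refine integral_congr_ae (.of_forall fun σ => ?_)
    dsimp only
    rw [sub_sub_cancel, ← mul_assoc, ← Complex.exp_add]
    congr 2
    push_cast
    ring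
  rw [h]
  ring

/-! ### Fourier series in space. -/

/-- The Fourier coefficient `∫_0^{2 π lam} e^{-ikx} f(x) dx` at the frequency `k = n / lam`. -/
def periodCoeff (lam : ℝ) (f : ℝ → ℂ) (n : ℤ) : ℂ :=
  ∫ x in (0 : ℝ)..(2 * Real.pi * lam),
    Complex.exp (-(Complex.I * ((freq lam n * x : ℝ) : ℂ))) * f x

theorem hasSum_periodCoeff {lam : ℝ} (hlam : 0 < lam) {f : ℝ → ℂ} (hf : Continuous f)
    (hper : Function.Periodic f (2 * Real.pi * lam)) (hsum : Summable (periodCoeff lam f)) (x : ℝ) :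
    HasSum (fun m => ((2 * Real.pi * lam)⁻¹ : ℝ) * periodCoeff lam f m *
      Complex.exp (Complex.I * ((freq lam m * x : ℝ) : ℂ))) (f x) := by
  have hP : 0 < 2 * Real.pi * lam := by positivity
  have : Fact (0 < 2 * Real.pi * lam) := ⟨hP⟩
  have hπ : (Real.pi : ℂ) ≠ 0 := Complex.ofReal_ne_zero.2 Real.pi_ne_zero
  have hl : (lam : ℂ) ≠ 0 := Complex.ofReal_ne_zero.2 hlam.ne'
  let g : C(AddCircle (2 * Real.pi * lam), ℂ) :=
    ⟨hper.lift, continuous_coinduced_dom.2 (by exact hf)⟩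
  have hg (y : ℝ) : g y = f y := rfl
  have hc (m : ℤ) : fourierCoeff g m = ((2 * Real.pi * lam)⁻¹ : ℝ) * periodCoeff lam f m := by
    rw [fourierCoeff_eq_intervalIntegral _ _ 0, zero_add, one_div, Complex.real_smul, periodCoeff]
    congr 1
    refine intervalIntegral.integral_congr fun y _ => ?_
    rw [fourier_coe_apply, smul_eq_mul, hg]
    congr 2
    rw [freq]
    push_cast
    field_simp
  have h := has_pointwise_sum_fourier_series_of_summable (f := g)
    (by simp_rw [funext hc]; exact hsum.mul_left _) (x : AddCircle (2 * Real.pi * lam))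
  rw [hg] at h
  refine h.congr_fun fun m => ?_
  rw [hc, fourier_coe_apply, smul_eq_mul]
  congr 2
  rw [freq]
  push_cast
  field_simp

/-- Expand `f` in its absolutely convergent Fourier series and integrate term by term against `g`.
-/
theorem hasSum_periodCoeff_mul {lam : ℝ} (hlam : 0 < lam) {f g : ℝ → ℂ} (hf : Continuous f)
    (hg : Continuous g) (hper : Function.Periodic f (2 * Real.pi * lam))
    (hsum : Summable (periodCoeff lam f)) (n : ℤ) :
    HasSum (fun m => ((2 * Real.pi * lam)⁻¹ : ℝ) * periodCoeff lam f m * periodCoeff lam g (n - m))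
      (periodCoeff lam (fun x => f x * g x) n) := by
  have hs : Summable fun m => ‖((2 * Real.pi * lam)⁻¹ : ℝ) * periodCoeff lam f m‖ :=
    (hsum.mul_left _).norm
  have key := intervalIntegral.hasSum_integral_of_dominated_convergence
    (a := 0) (b := 2 * Real.pi * lam) (μ := volume)
    (F := fun m x => ((2 * Real.pi * lam)⁻¹ : ℝ) * periodCoeff lam f m *
      (Complex.exp (-(Complex.I * ((freq lam (n - m) * x : ℝ) : ℂ))) * g x))
    (f := fun x => Complex.exp (-(Complex.I * ((freq lam n * x : ℝ) : ℂ))) * (f x * g x))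
    (fun m x => ‖((2 * Real.pi * lam)⁻¹ : ℝ) * periodCoeff lam f m‖ * ‖g x‖)
    (fun m => Continuous.aestronglyMeasurable (by fun_prop))
    (fun m => .of_forall fun x _ => by rw [norm_mul, norm_mul _ (g x), norm_exp_neg_I_mul, one_mul])
    (.of_forall fun x _ => hs.mul_right _)
    (by
      simp_rw [tsum_mul_right]
      exact Continuous.intervalIntegrable (by fun_prop) _ _)
    (.of_forall fun x _ => by
      refine (((hasSum_periodCoeff hlam hf hper hsum x).mul_right (g x)).mul_left
        (Complex.exp (-(Complex.I * ((freq lam n * x : ℝ) : ℂ))))).congr_fun fun m => ?_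
      have e : Complex.exp (-(Complex.I * ((freq lam (n - m) * x : ℝ) : ℂ))) =
          Complex.exp (-(Complex.I * ((freq lam n * x : ℝ) : ℂ))) *
            Complex.exp (Complex.I * ((freq lam m * x : ℝ) : ℂ)) := by
        rw [← Complex.exp_add, freq_add lam n m]
        congr 1
        push_cast
        ring
      rw [e]
      ring)
  refine key.congr_fun fun m => ?_
  rw [intervalIntegral.integral_const_mul, periodCoeff]
  rfl

theorem periodCoeff_deriv {lam : ℝ} (hlam : 0 < lam) {f f' : ℝ → ℂ}
    (hper : Function.Periodic f (2 * Real.pi * lam)) (hf : ∀ x, HasDerivAt f (f' x) x)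
    (hf' : Continuous f') (n : ℤ) :
    periodCoeff lam f' n = Complex.I * freq lam n * periodCoeff lam f n := by
  have hd (x : ℝ) : HasDerivAt
      (fun x : ℝ => Complex.exp (-(Complex.I * ((freq lam n * x : ℝ) : ℂ))))
      (-(Complex.I * freq lam n) * Complex.exp (-(Complex.I * ((freq lam n * x : ℝ) : ℂ)))) x := by
    have h1 : HasDerivAt (fun x : ℝ => -(Complex.I * ((freq lam n * x : ℝ) : ℂ)))
        (-(Complex.I * freq lam n)) x := by
      have := ((hasDerivAt_id x).const_mul (freq lam n)).ofReal_comp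
      refine (this.const_mul Complex.I).neg.congr_deriv ?_
      simp
    exact h1.cexp.congr_deriv (mul_comm _ _)
  have hbdry : Complex.exp (-(Complex.I * ((freq lam n * (2 * Real.pi * lam) : ℝ) : ℂ))) = 1 := by
    rw [Complex.exp_eq_one_iff]
    refine ⟨-n, ?_⟩
    have hl : (lam : ℂ) ≠ 0 := Complex.ofReal_ne_zero.2 hlam.ne'
    rw [freq]
    push_cast
    field_simp
  have h0 : f (2 * Real.pi * lam) = f 0 := by simpa using hper 0
  have h := intervalIntegral.integral_mul_deriv_eq_deriv_mul (a := 0) (b := 2 * Real.pi * lam)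
    (fun x _ => hd x) (fun x _ => hf x) (Continuous.intervalIntegrable (by fun_prop) _ _)
    (hf'.intervalIntegrable _ _)
  rw [hbdry, h0] at h
  simp_rw [mul_assoc _ _ (f _)] at h
  rw [intervalIntegral.integral_const_mul] at h
  rw [periodCoeff, h, periodCoeff]
  simp

/-! ### Test functions and the convolution theorem. -/

/-- Smooth functions of `(t, x)` that decay rapidly in `t` together with all derivatives. -/
structure IsRapid (U : ℝ × ℝ → ℂ) : Prop where
  smooth : ContDiff ℝ (⊤ : ℕ∞) U
  decay : ∀ N j : ℕ, ∃ A : ℝ, ∀ q : ℝ × ℝ, |q.1| ^ N * ‖iteratedFDeriv ℝ j U q‖ ≤ A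

theorem IsRapid.fderiv_apply {U : ℝ × ℝ → ℂ} (h : IsRapid U) (e : ℝ × ℝ) :
    IsRapid fun q => fderiv ℝ U q e := by
  have h1 : ContDiff ℝ (⊤ : ℕ∞) (fderiv ℝ U) := h.smooth.fderiv_right (by simp)
  refine ⟨h1.clm_apply contDiff_const, fun N j => ?_⟩
  obtain ⟨A, hA⟩ := h.decay N (j + 1)
  refine ⟨‖e‖ * A, fun q => ?_⟩
  have h2 := norm_iteratedFDeriv_clm_apply_const (c := e) (x := q) (n := j) h1.contDiffAt
    (by exact_mod_cast le_top)
  rw [norm_iteratedFDeriv_fderiv] at h2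
  calc _ ≤ |q.1| ^ N * (‖e‖ * ‖iteratedFDeriv ℝ (j + 1) U q‖) := by gcongr
    _ = ‖e‖ * (|q.1| ^ N * ‖iteratedFDeriv ℝ (j + 1) U q‖) := by ring
    _ ≤ _ := by gcongr; exact hA q

theorem IsRapid.exists_bound {U : ℝ × ℝ → ℂ} (h : IsRapid U) :
    ∃ B : ℝ, 0 ≤ B ∧ ∀ q, ‖U q‖ ≤ B * (1 + q.1 ^ 2)⁻¹ := by
  obtain ⟨A₀, h₀⟩ := h.decay 0 0
  obtain ⟨A₂, h₂⟩ := h.decay 2 0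
  simp only [norm_iteratedFDeriv_zero, pow_zero, one_mul, sq_abs] at h₀ h₂
  have p₀ := (norm_nonneg _).trans (h₀ 0)
  have p₂ := (mul_nonneg (sq_nonneg _) (norm_nonneg _)).trans (h₂ 0)
  refine ⟨A₀ + A₂, by positivity, fun q => ?_⟩
  rw [← div_eq_mul_inv, le_div_iff₀ (by positivity)]
  linarith [h₀ q, h₂ q]

theorem IsRapid.hasDerivAt_left {U : ℝ × ℝ → ℂ} (h : IsRapid U) (t x : ℝ) :
    HasDerivAt (fun t => U (t, x)) (fderiv ℝ U (t, x) (1, 0)) t :=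
  ((h.smooth.differentiable (by simp)) (t, x)).hasFDerivAt.comp_hasDerivAt t
    ((hasDerivAt_id t).prodMk (hasDerivAt_const t x))

theorem IsRapid.hasDerivAt_right {U : ℝ × ℝ → ℂ} (h : IsRapid U) (t x : ℝ) :
    HasDerivAt (fun x => U (t, x)) (fderiv ℝ U (t, x) (0, 1)) x :=
  ((h.smooth.differentiable (by simp)) (t, x)).hasFDerivAt.comp_hasDerivAt x
    ((hasDerivAt_const x t).prodMk (hasDerivAt_id x))

theorem periodic_fderiv_apply {U : ℝ × ℝ → ℂ} {P : ℝ}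
    (hper : ∀ t, Function.Periodic (fun x => U (t, x)) P) (e : ℝ × ℝ) (t : ℝ) :
    Function.Periodic (fun x => fderiv ℝ U (t, x) e) P := by
  intro x
  have h : (fun q => U (q + (0, P))) = U := by
    funext q
    have := hper q.1 q.2
    simpa [Prod.add_def] using this
  have h1 := fderiv_comp_add_right (𝕜 := ℝ) (f := U) (x := (t, x)) ((0, P) : ℝ × ℝ)
  rw [h] at h1
  simp [h1]

/-- The Fourier coefficient in `x` of a function of `(t, x)`. -/
def spaceCoeff (lam : ℝ) (U : ℝ × ℝ → ℂ) (n : ℤ) (t : ℝ) : ℂ :=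
  periodCoeff lam (fun x => U (t, x)) n

theorem spaceTimeFourier_eq (lam : ℝ) (u : ℝ → ℝ → ℂ) (n : ℤ) (τ : ℝ) :
    spaceTimeFourier lam u n τ =
      ((2 * Real.pi)⁻¹ : ℝ) * timeFourier (spaceCoeff lam (fun q => u q.1 q.2) n) τ := by
  rw [spaceTimeFourier, timeFourier]
  congr 1
  refine integral_congr_ae (.of_forall fun t => ?_)
  dsimp only
  rw [spaceCoeff, periodCoeff, ← intervalIntegral.integral_const_mul]
  refine intervalIntegral.integral_congr fun x _ => ?_
  dsimp only
  rw [← mul_assoc, ← Complex.exp_add]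
  congr 2
  push_cast
  ring

section

variable {U : ℝ × ℝ → ℂ} (h : IsRapid U) (lam : ℝ) (n : ℤ)

include h

theorem IsRapid.exists_bound_spaceCoeff :
    ∃ B : ℝ, 0 ≤ B ∧ ∀ n t, ‖spaceCoeff lam U n t‖ ≤ B * (1 + t ^ 2)⁻¹ := by
  obtain ⟨B, hB, hU⟩ := h.exists_bound
  refine ⟨B * |2 * Real.pi * lam - 0|, by positivity, fun n t => ?_⟩
  rw [mul_right_comm]
  refine intervalIntegral.norm_integral_le_of_norm_le_const fun x _ => ?_
  rw [norm_mul, norm_exp_neg_I_mul, one_mul]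
  exact hU (t, x)

theorem IsRapid.hasDerivAt_spaceCoeff (t : ℝ) :
    HasDerivAt (spaceCoeff lam U n) (spaceCoeff lam (fun q => fderiv ℝ U q (1, 0)) n t) t := by
  have h' := h.fderiv_apply (1, 0)
  have hc := h.smooth.continuous
  have hc' := h'.smooth.continuous
  obtain ⟨B, hB, hU⟩ := h'.exists_bound
  refine (intervalIntegral.hasDerivAt_integral_of_dominated_loc_of_deriv_le (bound := fun _ => B)
    (F := fun t x => Complex.exp (-(Complex.I * ((freq lam n * x : ℝ) : ℂ))) * U (t, x))
    (F' := fun t x => Complex.exp (-(Complex.I * ((freq lam n * x : ℝ) : ℂ))) *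
      fderiv ℝ U (t, x) (1, 0)) Filter.univ_mem ?_ ?_ ?_ ?_ ?_ ?_).2
  · exact .of_forall fun t => Continuous.aestronglyMeasurable (by fun_prop)
  · exact Continuous.intervalIntegrable (by fun_prop) _ _
  · exact Continuous.aestronglyMeasurable
      (Continuous.mul (by fun_prop) (hc'.comp (by fun_prop : Continuous fun x : ℝ => (t, x))))
  · refine .of_forall fun x _ t _ => ?_
    rw [norm_mul, norm_exp_neg_I_mul, one_mul]
    refine (hU (t, x)).trans (mul_le_of_le_one_right hB (inv_le_one_of_one_le₀ ?_))
    nlinarith [sq_nonneg t]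
  · exact intervalIntegrable_const
  · exact .of_forall fun x _ t _ => (h.hasDerivAt_left t x).const_mul _

theorem IsRapid.continuous_spaceCoeff : Continuous (spaceCoeff lam U n) :=
  continuous_iff_continuousAt.2 fun t => (h.hasDerivAt_spaceCoeff lam n t).continuousAt

theorem IsRapid.integrable_spaceCoeff : Integrable (spaceCoeff lam U n) := by
  obtain ⟨B, -, hB⟩ := h.exists_bound_spaceCoeff lam
  exact (integrable_inv_one_add_sq.const_mul B).mono'
    (h.continuous_spaceCoeff lam n).aestronglyMeasurable (.of_forall fun t => hB n t)

theorem IsRapid.integrable_timeFourier_spaceCoeff :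
    Integrable (timeFourier (spaceCoeff lam U n)) := by
  have h' := h.fderiv_apply (1, 0)
  have h'' := h'.fderiv_apply (1, 0)
  exact integrable_timeFourier (h.integrable_spaceCoeff lam n) (h'.integrable_spaceCoeff lam n)
    (h''.integrable_spaceCoeff lam n) (h.hasDerivAt_spaceCoeff lam n)
    (h'.hasDerivAt_spaceCoeff lam n)

end

/-- Two integrations by parts in x gain k², while the decay in t passes through the integral. The
product bound makes sums over frequencies and integrals in time converge together. -/
theorem IsRapid.exists_decay_spaceCoeff {U : ℝ × ℝ → ℂ} (h : IsRapid U) {lam : ℝ} (hlam : 0 < lam)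
    (hper : ∀ t, Function.Periodic (fun x => U (t, x)) (2 * Real.pi * lam)) :
    ∃ B : ℝ, 0 ≤ B ∧ ∀ n t, ‖spaceCoeff lam U n t‖ ≤
      B * (1 + freq lam n ^ 2)⁻¹ * (1 + t ^ 2)⁻¹ := by
  have h' := h.fderiv_apply (0, 1)
  have h'' := h'.fderiv_apply (0, 1)
  have hc' := h'.smooth.continuous
  have hc'' := h''.smooth.continuous
  obtain ⟨B, hB, h1⟩ := h.exists_bound_spaceCoeff lam
  obtain ⟨B', hB', h2⟩ := h''.exists_bound_spaceCoeff lam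
  refine ⟨B + B', by positivity, fun n t => ?_⟩
  have e1 := periodCoeff_deriv hlam (hper t) (fun x => h.hasDerivAt_right t x)
    (hc'.comp (by fun_prop : Continuous fun x : ℝ => (t, x))) n
  have e2 := periodCoeff_deriv hlam (periodic_fderiv_apply hper (0, 1) t)
    (fun x => h'.hasDerivAt_right t x)
    (hc''.comp (by fun_prop : Continuous fun x : ℝ => (t, x))) n
  rw [e1, ← mul_assoc] at e2
  have e3 := congrArg norm e2
  rw [norm_mul, norm_mul, norm_mul, Complex.norm_I, one_mul, Complex.norm_real, ← sq,
    Real.norm_eq_abs, sq_abs] at e3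
  have h3 := (e3.symm.le.trans (h2 n t))
  have h4 := h1 n t
  rw [mul_right_comm, ← div_eq_mul_inv, le_div_iff₀ (by positivity)]
  change freq lam n ^ 2 * ‖spaceCoeff lam U n t‖ ≤ _ at h3
  linarith

theorem summable_inv_one_add_freq_sq {lam : ℝ} (hlam : 0 < lam) :
    Summable fun n : ℤ => (1 + freq lam n ^ 2)⁻¹ := by
  refine Summable.of_norm_bounded_eventually
    ((Real.summable_one_div_int_pow (p := 2)).2 one_lt_two |>.mul_left (lam ^ 2)) ?_
  refine (Set.finite_singleton (0 : ℤ)).subset fun n hn => ?_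
  by_contra h0
  have hn0 : (n : ℝ) ≠ 0 := Int.cast_ne_zero.2 h0
  refine hn ?_
  rw [Set.mem_ofPred_eq, Real.norm_of_nonneg (by positivity), freq, ← div_eq_mul_one_div,
    inv_le_comm₀ (by positivity) (by positivity), inv_div, div_pow]
  linarith

section

variable {U V : ℝ × ℝ → ℂ} (hU : IsRapid U) (hV : IsRapid V) {lam : ℝ} (hlam : 0 < lam)
  (hper : ∀ t, Function.Periodic (fun x => U (t, x)) (2 * Real.pi * lam))

include hU hV hlam hper

theorem hasSum_spaceCoeff_mul (n : ℤ) (t : ℝ) :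
    HasSum (fun m => ((2 * Real.pi * lam)⁻¹ : ℝ) * spaceCoeff lam U m t *
      spaceCoeff lam V (n - m) t) (spaceCoeff lam (fun q => U q * V q) n t) := by
  obtain ⟨B, hB, h⟩ := hU.exists_decay_spaceCoeff hlam hper
  have hc := hU.smooth.continuous
  have hc' := hV.smooth.continuous
  refine hasSum_periodCoeff_mul hlam (f := fun x => U (t, x)) (g := fun x => V (t, x))
    (by fun_prop) (by fun_prop) (hper t) (Summable.of_norm_bounded
      (((summable_inv_one_add_freq_sq hlam).mul_left B).mul_right (1 + t ^ 2)⁻¹)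
      fun m => h m t) n

/-- The product formula at each time is integrated in t; the joint decay justifies exchanging sum
and integral. -/
theorem hasSum_timeFourier_spaceCoeff_mul (n : ℤ) (τ : ℝ) :
    HasSum (fun m => ((2 * Real.pi * lam)⁻¹ : ℝ) *
      timeFourier (fun t => spaceCoeff lam U m t * spaceCoeff lam V (n - m) t) τ)
      (timeFourier (spaceCoeff lam (fun q => U q * V q) n) τ) := by
  obtain ⟨B, hB, h⟩ := hU.exists_decay_spaceCoeff hlam hper
  obtain ⟨B', hB', h'⟩ := hV.exists_bound_spaceCoeff lam
  have hbound (m : ℤ) (t : ℝ) : ‖Complex.exp (-(Complex.I * ((t * τ : ℝ) : ℂ))) *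
      (((2 * Real.pi * lam)⁻¹ : ℝ) * spaceCoeff lam U m t * spaceCoeff lam V (n - m) t)‖ ≤
      (2 * Real.pi * lam)⁻¹ * B * B' * (1 + freq lam m ^ 2)⁻¹ * (1 + t ^ 2)⁻¹ := by
    have h1 : (1 + t ^ 2)⁻¹ ≤ 1 := inv_le_one_of_one_le₀ (by nlinarith [sq_nonneg t])
    rw [norm_mul, norm_exp_neg_I_mul, one_mul, norm_mul, norm_mul, Complex.norm_real,
      Real.norm_of_nonneg (by positivity)]
    calc _ ≤ (2 * Real.pi * lam)⁻¹ * (B * (1 + freq lam m ^ 2)⁻¹ * (1 + t ^ 2)⁻¹) *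
          (B' * (1 + t ^ 2)⁻¹) := by
          gcongr
          · exact h m t
          · exact h' (n - m) t
      _ ≤ (2 * Real.pi * lam)⁻¹ * (B * (1 + freq lam m ^ 2)⁻¹ * (1 + t ^ 2)⁻¹) * (B' * 1) := by
          gcongr
      _ = _ := by ring
  have hcont (m : ℤ) : Continuous fun t : ℝ => Complex.exp (-(Complex.I * ((t * τ : ℝ) : ℂ))) *
      (((2 * Real.pi * lam)⁻¹ : ℝ) * spaceCoeff lam U m t * spaceCoeff lam V (n - m) t) := by
    have := hU.continuous_spaceCoeff lam m
    have := hV.continuous_spaceCoeff lam (n - m)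
    fun_prop
  have hint (m : ℤ) := (integrable_inv_one_add_sq.const_mul ((2 * Real.pi * lam)⁻¹ * B * B' *
    (1 + freq lam m ^ 2)⁻¹)).mono' (hcont m).aestronglyMeasurable (.of_forall (hbound m))
  have key := hasSum_integral_of_summable_integral_norm hint (Summable.of_nonneg_of_le
    (fun m => integral_nonneg fun t => norm_nonneg _)
    (fun m => (integral_mono (hint m).norm (integrable_inv_one_add_sq.const_mul _)
      (hbound m)).trans_eq (integral_const_mul _ _))
    (((summable_inv_one_add_freq_sq hlam).mul_left ((2 * Real.pi * lam)⁻¹ * B * B')).mul_right _))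
  have e (t : ℝ) : ∑' m, Complex.exp (-(Complex.I * ((t * τ : ℝ) : ℂ))) *
      (((2 * Real.pi * lam)⁻¹ : ℝ) * spaceCoeff lam U m t * spaceCoeff lam V (n - m) t) =
      Complex.exp (-(Complex.I * ((t * τ : ℝ) : ℂ))) *
        spaceCoeff lam (fun q => U q * V q) n t := by
    rw [tsum_mul_left, (hasSum_spaceCoeff_mul hU hV hlam hper n t).tsum_eq]
  simp_rw [e] at key
  refine key.congr_fun fun m => ?_
  rw [timeFourier, ← integral_const_mul]
  refine integral_congr_ae (.of_forall fun t => ?_)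
  dsimp only
  ring

end

section

variable {lam : ℝ} {u v : ℝ → ℝ → ℂ}

theorem IsTestFunction.isRapid (hu : IsTestFunction lam u) : IsRapid fun q => u q.1 q.2 :=
  ⟨hu.smooth, hu.decay⟩

/-- The Fourier transform of a product of test functions is the convolution of the Fourier
transforms. -/
theorem spaceTimeFourier_mul (hlam : 0 < lam) (hu : IsTestFunction lam u)
    (hv : IsTestFunction lam v) : spaceTimeFourier lam (fun t x => u t x * v t x) =
      fourierProduct lam (spaceTimeFourier lam u) (spaceTimeFourier lam v) := by
  have hU := hu.isRapid
  have hV := hv.isRapid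
  have hπ : (Real.pi : ℂ) ≠ 0 := Complex.ofReal_ne_zero.2 Real.pi_ne_zero
  have hl : (lam : ℂ) ≠ 0 := Complex.ofReal_ne_zero.2 hlam.ne'
  funext n τ
  have h := hasSum_timeFourier_spaceCoeff_mul hU hV hlam hu.periodic n τ
  rw [spaceTimeFourier_eq, ← h.tsum_eq, fourierProduct, ← tsum_mul_left, ← tsum_mul_left]
  refine tsum_congr fun m => ?_
  have e : ∫ σ, spaceTimeFourier lam u m σ * spaceTimeFourier lam v (n - m) (τ - σ) =
      (((2 * Real.pi)⁻¹ : ℝ) * ((2 * Real.pi)⁻¹ : ℝ) : ℂ) * (2 * Real.pi * timeFourier (fun t =>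
        spaceCoeff lam (fun q => u q.1 q.2) m t * spaceCoeff lam (fun q => v q.1 q.2) (n - m) t)
          τ) := by
    rw [← integral_timeFourier_mul_timeFourier (hU.integrable_spaceCoeff lam m)
      (hV.continuous_spaceCoeff lam (n - m)) (hV.integrable_spaceCoeff lam (n - m))
      (hV.integrable_timeFourier_spaceCoeff lam (n - m)), ← integral_const_mul]
    refine integral_congr_ae (.of_forall fun σ => ?_)
    dsimp only
    rw [spaceTimeFourier_eq, spaceTimeFourier_eq]
    ring
  rw [e]
  push_cast
  field_simp

theorem IsTestFunction.aestronglyMeasurable_spaceTimeFourier (hu : IsTestFunction lam u) (n : ℤ) :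
    AEStronglyMeasurable (spaceTimeFourier lam u n) volume := by
  rw [funext (spaceTimeFourier_eq lam u n)]
  exact ((continuous_timeFourier
    (hu.isRapid.integrable_spaceCoeff lam n)).const_mul _).aestronglyMeasurable

theorem IsTestFunction.spaceTimeFourier_zero (hu : IsTestFunction lam u) (τ : ℝ) :
    spaceTimeFourier lam u 0 τ = 0 := by
  have h : spaceCoeff lam (fun q => u q.1 q.2) 0 = 0 := by
    funext t
    simpa [spaceCoeff, periodCoeff, freq] using hu.mean_zero t
  simp [spaceTimeFourier_eq, h, timeFourier]

end

end Kawahara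

end

/-- The bilinear estimate `‖Λ⁻¹ ∂ₓ(uv)‖_{Z^s} ≤ C ‖u‖_{Z^s} ‖v‖_{Z^s}`, with `C` independent of `lam`:
for smooth `u`, `v` with the pointwise product `uv`, and for arbitrary `u`, `v` in `Z^s`, given by their
Fourier transforms `F`, `G`, with the product given by the convolution of these, which converges
absolutely almost everywhere at every nonzero frequency. -/
theorem proposition1p1 (s : ℝ) (hs₁ : -3 / 2 ≤ s) (hs₂ : s < -1)
    (β : ℝ) (hβ : β = -1 ∨ β = 0 ∨ β = 1) :
    ∃ C : ℝ, 0 < C ∧ ∀ lam : ℝ, 1 ≤ lam →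
      (∀ u v : ℝ → ℝ → ℂ, Kawahara.IsTestFunction lam u → Kawahara.IsTestFunction lam v →
        Kawahara.zNorm lam β s (Kawahara.bigLambda lam β (-1) (Kawahara.dx lam
            (Kawahara.spaceTimeFourier lam (fun t x => u t x * v t x)))) ≤
          ENNReal.ofReal C * Kawahara.zNorm lam β s (Kawahara.spaceTimeFourier lam u) *
            Kawahara.zNorm lam β s (Kawahara.spaceTimeFourier lam v)) ∧
      (∀ F G : Kawahara.FT, Kawahara.MemZ lam β s F → Kawahara.MemZ lam β s G →
        (∀ n : ℤ, n ≠ 0 → ∀ᵐ τ : ℝ,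
          ∑' m : ℤ, ∫⁻ σ : ℝ, ‖F m σ‖ₑ * ‖G (n - m) (τ - σ)‖ₑ < ∞) ∧
        Kawahara.MemZ lam β s (Kawahara.bigLambda lam β (-1) (Kawahara.dx lam
          (Kawahara.fourierProduct lam F G))) ∧
        Kawahara.zNorm lam β s (Kawahara.bigLambda lam β (-1) (Kawahara.dx lam
            (Kawahara.fourierProduct lam F G))) ≤
          ENNReal.ofReal C * Kawahara.zNorm lam β s F * Kawahara.zNorm lam β s G) := by
  obtain ⟨C, hC, h⟩ := Kawahara.exists_zNorm_output_le hs₁ hs₂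
  have hβ' : |β| ≤ 1 := by rcases hβ with rfl | rfl | rfl <;> norm_num
  -- Adding 1 makes the real constant positive.
  have hC' : C ≤ ENNReal.ofReal (C.toReal + 1) := by
    conv_lhs => rw [← ENNReal.ofReal_toReal hC.ne]
    exact ENNReal.ofReal_le_ofReal (by linarith)
  refine ⟨C.toReal + 1, by positivity, fun lam hlam => ⟨fun u v hu hv => ?_, fun F G hF hG => ?_⟩⟩
  · rw [Kawahara.spaceTimeFourier_mul (one_pos.trans_le hlam) hu hv]
    refine (h lam β hlam hβ' _ _ hu.aestronglyMeasurable_spaceTimeFourier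
      hv.aestronglyMeasurable_spaceTimeFourier hu.spaceTimeFourier_zero
      hv.spaceTimeFourier_zero).2.trans ?_
    gcongr
  · obtain ⟨hE, hZ⟩ := h lam β hlam hβ' F G hF.measurable hG.measurable hF.zero_mode hG.zero_mode
    obtain ⟨hae, hmem⟩ := Kawahara.bilinear_of_memZ (one_pos.trans_le hlam) hC hF hG hE hZ
    exact ⟨hae, hmem, hZ.trans (by gcongr)⟩
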